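/- Identify $\mathbb R^2$ with $\mathbb C$, $x=x_1+ix_2$, and write $x^*$ for the complex conjugate, $x^\perp=ix$, $x\cdot y=\mathrm{Re}(xy^*)$, $\nabla=\partial_1+i\partial_2$, $\nabla^\perp=i\nabla$. Let $\ell>0$ and let $\mathbb T=[-\ell/2,\ell/2]$ with its end points identified. Let $T,\delta>0$, $c\in C^{1,\delta}(\mathbb T)$ with $c\ge 0$, and $z\in C^1([0,T];C^{1,\delta}(\mathbb T;\mathbb R^2))$ with $z^\circ:=z|_{t=0}\in C^{2,\delta}(\mathbb T;\mathbb R^2)$ parametrized by arc length ($|\partial_\alpha z^\circ|=1$) and clockwise oriented (winding number $-1$ around its interior points). Put $\tau=\partial_\alpha z^\circ$, and for $\lambda\in[-1,1]$ $$z_\lambda(t,\alpha)=z(t,\alpha)-\lambda\,t\,c(\alpha)\,\tau(\alpha)^\perp,\qquad z_\pm=z_{\pm1}.$$ Assume the equi-angle and equi-chord-arc conditions $$\inf_{\alpha,\lambda,t}\frac{\partial_\alpha z_\lambda(t,\alpha)}{|\partial_\alpha z_\lambda(t,\alpha)|}\cdot\tau(\alpha)>0,\qquad \sup_{\alpha,\beta,\lambda,\mu,t}\frac{\sqrt{\beta^2+((\lambda-\mu)tc(\alpha))^2}}{|z_\lambda(t,\alpha)-z_\mu(t,\alpha-\beta)|}<\infty,$$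 with $\alpha,\beta\in\mathbb T$, $\lambda,\mu\in[-1,1]$, $t\in[0,T]$. Let $\Omega_+(t)$ be the interior domain of $z_+(t)$, $\Omega_-(t)$ the exterior domain of $z_-(t)$, $\Omega_{\mathrm{mix}}(t)=\{z_\lambda(t,\alpha): c(\alpha)>0,\ \lambda\in(-1,1)\}$ for $t>0$, and $\bar\rho(t,\cdot)=1_{\Omega_+(t)}-1_{\Omega_-(t)}$. Define the Biot--Savart velocity, for $x$ off the curves $z_\pm(t)$, by $$\bar v(t,x)^*=-\frac1{2\pi i}\sum_{b=\pm}\int_{\mathbb T}\frac{(\partial_\alpha z_b(t,\beta))_2}{x-z_b(t,\beta)}\,d\beta .$$ Then: (1) $\bar v$ belongs to $C([0,T];L^\infty_{w^*}(\mathbb R^2;\mathbb R^2))$, vanishes as $|x|\to\infty$ for each $t\in[0,T]$, and satisfies, for all $\phi\in C^1_c(\mathbb R^3)$ and $0<t\le T$, $$\int_0^t\!\!\int_{\mathbb R^2}\bar v\cdot\nabla\phi\,dx\,ds=0,\qquad \int_0^t\!\!\int_{\mathbb R^2}(\bar v+\bar\rho\, i)\cdot\nabla^\perp\phi\,dx\,ds=0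 .$$ It is the only such field: if $u\in C([0,T];L^\infty_{w^*}(\mathbb R^2;\mathbb R^2))$ satisfies the same two equations with the same $\bar\rho$, and for each $t\in[0,T]$ vanishes as $|x|\to\infty$ (up to null sets), then $u(t)=\bar v(t)$ almost everywhere for every $t\in[0,T]$. (2) $\bar v$ is uniformly bounded: $\sup\{|\bar v(t,x)|: 0\le t\le T,\ x\notin z_+(t,\mathbb T)\cup z_-(t,\mathbb T)\}<\infty$. (3) $\bar v$ has well-defined one-sided limits on the boundaries: for $a=\pm$ and all $(t,\alpha)\in[0,T]\times\mathbb T$ the point $z_a(t,\alpha)$ lies in $\overline{\Omega_a(t)}$ and $\bar v_a^a(t,\alpha)=\lim_{\Omega_a(t)\ni x\to z_a(t,\alpha)}\bar v(t,x)$ exists; whenever $tc(\alpha)>0$, the point $z_a(t,\alpha)$ lies in $\overline{\Omega_{\mathrm{mix}}(t)}$ and $\bar v_a^{\mathrm{mix}}(t,\alpha)=\lim_{\Omega_{\mathrm{mix}}(t)\ni x\to z_a(t,\alpha)}\bar v(t,x)$ exists. These limits are continuous functions of $(t,\alpha)$ on $[0,T]\times\mathbb T$ and on $\{tc(\alpha)>0\}$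 respectively. -/

import Mathlib

open Set Filter Topology MeasureTheory
open scoped NNReal ENNReal

noncomputable section

namespace IPM

/-! The plane is identified with the complex numbers. Functions on the circle
`[-ℓ/2, ℓ/2]` (end points identified) are `ℓ`-periodic functions on the real line. -/

/-- The Euclidean scalar product of two vectors of the plane. -/
def dot (z w : ℂ) : ℝ := (z * (starRingEnd ℂ) w).re

/-! ### Hölder spaces on the circle -/

/-- `f` belongs to `C^{k,δ}` of the circle of length `ℓ`. -/
def MemCHolder {E : Type*} [NormedAddCommGroup E] [NormedSpace ℝ E]
    (ℓ : ℝ) (k : ℕ) (δ : ℝ≥0) (f : ℝ → E) : Prop :=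
  Function.Periodic f ℓ ∧ ContDiff ℝ k f ∧ MemHolder δ (iteratedDeriv k f)

/-- The norm of `C^{k,δ}`: the supremum of the derivatives up to order `k` plus the
`δ`-Hölder seminorm of the `k`-th derivative. -/
def cHolderNorm {E : Type*} [NormedAddCommGroup E] [NormedSpace ℝ E]
    (k : ℕ) (δ : ℝ≥0) (f : ℝ → E) : ℝ≥0∞ :=
  (⨆ j ≤ k, ⨆ α : ℝ, ‖iteratedDeriv j f α‖ₑ) + eHolderNorm δ (iteratedDeriv k f)

/-- `z` is a continuously differentiable map from `[0,T]` to the normed space `C^{k,δ}`: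
`w t` is the limit of the difference quotients at `t` in the norm of `C^{k,δ}`
and depends continuously on `t` in this norm. -/
def IsC1InTime {E : Type*} [NormedAddCommGroup E] [NormedSpace ℝ E]
    (T ℓ : ℝ) (k : ℕ) (δ : ℝ≥0) (z : ℝ → ℝ → E) : Prop :=
  (∀ t ∈ Icc 0 T, MemCHolder ℓ k δ (z t)) ∧
  ∃ w : ℝ → ℝ → E,
    (∀ t ∈ Icc 0 T, MemCHolder ℓ k δ (w t)) ∧
    (∀ t ∈ Icc 0 T,
      Tendsto (fun s => cHolderNorm k δ (fun α => (s - t)⁻¹ • (z s α - z t α) - w t α))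
        (𝓝[Icc 0 T \ {t}] t) (𝓝 0)) ∧
    (∀ t ∈ Icc 0 T,
      Tendsto (fun s => cHolderNorm k δ (fun α => w s α - w t α)) (𝓝[Icc 0 T] t) (𝓝 0))

/-! ### Closed curves -/

/-- The interior domain of a closed curve: the bounded components of the complement. -/
def curveInterior (γ : ℝ → ℂ) : Set ℂ :=
  {x | x ∉ range γ ∧ Bornology.IsBounded (connectedComponentIn (range γ)ᶜ x)}

/-- The exterior domain of a closed curve: the unbounded components of the complement. -/
def curveExterior (γ : ℝ → ℂ) : Set ℂ :=
  {x | x ∉ range γ ∧ ¬ Bornology.IsBounded (connectedComponentIn (range γ)ᶜ x)}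

/-- The (counterclockwise) winding number of the closed `ℓ`-periodic curve `γ` around `x`. -/
def windingNumber (ℓ : ℝ) (γ : ℝ → ℂ) (x : ℂ) : ℂ :=
  (2 * Real.pi * Complex.I)⁻¹ * ∫ β in (-ℓ / 2)..(ℓ / 2), deriv γ β / (γ β - x)

/-- `γ` runs clockwise around its interior domain. -/
def IsClockwise (ℓ : ℝ) (γ : ℝ → ℂ) : Prop :=
  ∀ x ∈ curveInterior γ, windingNumber ℓ γ x = -1

/-! ### The mixing zone -/

/-- The tangent field `τ = ∂_α z°`, where `z° = z|_{t=0}`. -/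
def tau (z : ℝ → ℝ → ℂ) (α : ℝ) : ℂ := deriv (z 0) α

/-- The curves `z_λ(t,α) = z(t,α) - λ t c(α) τ(α)^⊥`; the boundaries `z_±` are those with
`λ = ±1`. -/
def zCurve (c : ℝ → ℝ) (z : ℝ → ℝ → ℂ) (lam t α : ℝ) : ℂ :=
  z t α - ((lam * t * c α : ℝ) : ℂ) * (Complex.I * tau z α)

/-- The equi-angle condition: the infimum of `(∂_α z_λ / |∂_α z_λ|) · τ` is positive. -/
def EquiAngle (T : ℝ) (c : ℝ → ℝ) (z : ℝ → ℝ → ℂ) : Prop :=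
  ∃ κ > 0, ∀ α : ℝ, ∀ lam ∈ Icc (-1 : ℝ) 1, ∀ t ∈ Icc 0 T,
    deriv (zCurve c z lam t) α ≠ 0 ∧
    κ ≤ dot (deriv (zCurve c z lam t) α / (‖deriv (zCurve c z lam t) α‖ : ℂ)) (tau z α)

/-- The equi-chord-arc condition: the supremum of
`√(β² + ((λ-μ) t c(α))²) / |z_λ(t,α) - z_μ(t,α-β)|` is finite. -/
def EquiChordArc (T ℓ : ℝ) (c : ℝ → ℝ) (z : ℝ → ℝ → ℂ) : Prop :=
  ∃ C : ℝ, ∀ α : ℝ, ∀ β ∈ Icc (-ℓ / 2) (ℓ / 2),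
    ∀ lam ∈ Icc (-1 : ℝ) 1, ∀ μ ∈ Icc (-1 : ℝ) 1, ∀ t ∈ Icc 0 T,
      √(β ^ 2 + ((lam - μ) * t * c α) ^ 2) ≤
        C * ‖zCurve c z lam t α - zCurve c z μ t (α - β)‖

/-- `Ω_+(t)`, the interior domain of `z_+(t)`. -/
def omegaPlus (c : ℝ → ℝ) (z : ℝ → ℝ → ℂ) (t : ℝ) : Set ℂ := curveInterior (zCurve c z 1 t)

/-- `Ω_-(t)`, the exterior domain of `z_-(t)`. -/
def omegaMinus (c : ℝ → ℝ) (z : ℝ → ℝ → ℂ) (t : ℝ) : Set ℂ := curveExterior (zCurve c z (-1) t)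

/-- The mixing zone `Ω_mix(t)` at a time `t > 0`. -/
def omegaMix (c : ℝ → ℝ) (z : ℝ → ℝ → ℂ) (t : ℝ) : Set ℂ :=
  {x | ∃ α : ℝ, 0 < c α ∧ ∃ lam ∈ Ioo (-1 : ℝ) 1, x = zCurve c z lam t α}

/-- The piecewise constant density: `1` on `Ω_+`, `-1` on `Ω_-`, `0` elsewhere. -/
def rhoBar (c : ℝ → ℝ) (z : ℝ → ℝ → ℂ) (t : ℝ) (x : ℂ) : ℝ :=
  (omegaPlus c z t).indicator 1 x - (omegaMinus c z t).indicator 1 x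

/-- The integral of `(∂_α z_b)_2 / (x - z_b)` over the boundary `z_b`. -/
def boundaryIntegral (ℓ : ℝ) (c : ℝ → ℝ) (z : ℝ → ℝ → ℂ) (b t : ℝ) (x : ℂ) : ℂ :=
  ∫ β in (-ℓ / 2)..(ℓ / 2),
    ((deriv (zCurve c z b t) β).im : ℂ) / (x - zCurve c z b t β)

/-- The Biot-Savart velocity of the two boundaries `z_±` (meaningful off the boundaries). -/
def vBar (ℓ : ℝ) (c : ℝ → ℝ) (z : ℝ → ℝ → ℂ) (t : ℝ) (x : ℂ) : ℂ :=
  (starRingEnd ℂ) (-(2 * Real.pi * Complex.I)⁻¹ *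
    (boundaryIntegral ℓ c z 1 t x + boundaryIntegral ℓ c z (-1) t x))

/-! ### The relaxed equations for the velocity -/

/-- The spatial gradient `∂₁φ + i ∂₂φ` of a function of time and space. -/
def gradX (φ : ℝ × ℂ → ℝ) (s : ℝ) (x : ℂ) : ℂ :=
  (fderiv ℝ φ (s, x) (0, 1) : ℂ) + Complex.I * (fderiv ℝ φ (s, x) (0, Complex.I) : ℂ)

/-- `v ∈ C([0,T]; L^∞)` for the weak-star topology of `L^∞` of the plane. -/
def IsWeakStarContinuous (T : ℝ) (v : ℝ → ℂ → ℂ) : Prop :=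
  (∀ t ∈ Icc 0 T, MemLp (v t) ∞ volume) ∧
  ∀ g : ℂ → ℝ, Integrable g volume → ContinuousOn (fun t => ∫ x, g x • v t x) (Icc 0 T)

/-- The relaxed incompressibility condition `∫₀ᵗ ∫ v · ∇φ dx ds = 0`. -/
def RelaxedDivFree (T : ℝ) (v : ℝ → ℂ → ℂ) : Prop :=
  ∀ φ : ℝ × ℂ → ℝ, ContDiff ℝ 1 φ → HasCompactSupport φ → ∀ t ∈ Ioc 0 T,
    ∫ s in (0 : ℝ)..t, ∫ x, dot (v s x) (gradX φ s x) = 0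

/-- The relaxed Darcy law `∫₀ᵗ ∫ (v + ρ i) · ∇^⊥φ dx ds = 0`. -/
def RelaxedDarcy (T : ℝ) (ρ : ℝ → ℂ → ℝ) (v : ℝ → ℂ → ℂ) : Prop :=
  ∀ φ : ℝ × ℂ → ℝ, ContDiff ℝ 1 φ → HasCompactSupport φ → ∀ t ∈ Ioc 0 T,
    ∫ s in (0 : ℝ)..t, ∫ x, dot (v s x + (ρ s x : ℂ) * Complex.I)
      (Complex.I * gradX φ s x) = 0

/-- At each time, `v(t,x) → 0` as `|x| → ∞`, up to null sets. -/
def VanishesAtInfinity (T : ℝ) (v : ℝ → ℂ → ℂ) : Prop :=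
  ∀ t ∈ Icc 0 T, Tendsto (v t) (ae volume ⊓ cocompact ℂ) (𝓝 0)

/-- `v` is a velocity field for the density `ρ`: it solves the relaxed divergence-free and
Darcy equations and vanishes at infinity. -/
structure IsRelaxedVelocity (T : ℝ) (ρ : ℝ → ℂ → ℝ) (v : ℝ → ℂ → ℂ) : Prop where
  weakStar : IsWeakStarContinuous T v
  divFree : RelaxedDivFree T v
  darcy : RelaxedDarcy T ρ v
  vanishes : VanishesAtInfinity T v

/-- The field `v` has continuous one-sided limits along the boundary curve `γ(t,α)` from the
domains `Ω(t)`, at the parameters `(t,α)` in `S`; the points of the curve are adherent to the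
domains, so that the limits are unique. -/
def HasContinuousLimits (v : ℝ → ℂ → ℂ) (Ω : ℝ → Set ℂ) (γ : ℝ → ℝ → ℂ) (S : Set (ℝ × ℝ)) :
    Prop :=
  ∃ f : ℝ × ℝ → ℂ, ContinuousOn f S ∧
    ∀ p ∈ S, γ p.1 p.2 ∈ closure (Ω p.1) ∧
      Tendsto (v p.1) (𝓝[Ω p.1] (γ p.1 p.2)) (𝓝 (f p))

end IPM

end

namespace IPM

/-! The conjugate velocity is a sum of integrals of `Im γ' / (x - γ)` over the two boundaries, and
both the estimates and the equations rest on comparing these integrals with winding numbers.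

Estimates. Let `α` be the parameter of a point of `γ` nearest to `x`, and subtract from `Im γ'` the
multiple `κ γ'` with `κ = Im γ'(α) / γ'(α)`, so that `|κ| ≤ 1`. The new numerator vanishes at `α`
and is `O(|u|^δ)` at `α + u`, while the chord-arc condition and the minimality of the distance give
`|x - γ(α + u)| ≥ |u| / (2C)`. The integrand is therefore dominated by a multiple of `|u|^(δ - 1)`,
uniformly in the point and the curve. The subtracted part is `-2πi κ` times the winding number
(`imIntegral_eq`). This bounds the velocity (`exists_norm_imIntegral_le`) and, by dominated
convergence, gives limits at the curves, jointly in time and space, along sets of constant winding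
number (`exists_tendsto_imIntegral`).

Topology. The Jordan curve theorem is not used. A thin collar on one side of all curves of the
family is connected, so the integer-valued winding number is constant on it, and it jumps by `1`
across a curve (`tendsto_windingNumber_sub`). A segment towards the nearest point joins every point
off a curve to a collar, so only two values occur. Decay at infinity and the orientation of one
curve identify them as `0` on the left and `-1` on the right; interior and exterior are then read
off from the winding number (`mem_curveInterior_iff`, `mem_curveExterior_iff`). Moving along `λ ↦
z_λ(t,α)`, or moving the curve with `λ`, gives both winding numbers on the two outer domains and on
the mixing zone.

Equations. Almost everywhere the density is `-w_+ - w_- - 1`, with `w_±` the winding numbers. Tested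
against a gradient, the Cauchy integral becomes a boundary integral of `Im γ' φ(γ)` by the
Cauchy-Pompeiu formula; tested against `∂₁φ`, the winding number gives the same boundary integral by
a Green formula. Hence the divergence vanishes and the curl is balanced by the density, at each
fixed time.

Uniqueness. A time cutoff and weak-star continuity turn the relaxed equations into equations at
fixed times. The conjugate of the difference of two solutions then satisfies the Cauchy-Riemann
equations weakly; its mollifications are entire and vanish at infinity, so they are zero by
Liouville (`ae_eq_zero_of_integral_mul_cgrad_eq_zero`). -/

/-- A family of `ℓ`-periodic simple curves of class `C^{1,δ}`, continuous in the parameter, with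
uniform Hölder and chord-arc constants. -/
structure IsCurveFamily {X : Type*} [TopologicalSpace X] (ℓ δ H C : ℝ) (γ : X → ℝ → ℂ) :
    Prop where
  length_pos : 0 < ℓ
  exponent_pos : 0 < δ
  bound_pos : 0 < H
  chord_pos : 0 < C
  periodic : ∀ p, Function.Periodic (γ p) ℓ
  differentiable : ∀ p, Differentiable ℝ (γ p)
  continuous_uncurry : Continuous (fun q : X × ℝ => γ q.1 q.2)
  continuous_deriv : Continuous (fun q : X × ℝ => deriv (γ q.1) q.2)
  norm_deriv_le : ∀ p α, ‖deriv (γ p) α‖ ≤ H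
  holder : ∀ p α β, ‖deriv (γ p) α - deriv (γ p) β‖ ≤ H * |α - β| ^ δ
  chord : ∀ p α u, |u| ≤ ℓ / 2 → |u| ≤ C * ‖γ p (α + u) - γ p α‖

lemma periodic_deriv {E : Type*} [NormedAddCommGroup E] [NormedSpace ℝ E] {ℓ : ℝ} {f : ℝ → E}
    (h : Function.Periodic f ℓ) : Function.Periodic (deriv f) ℓ := by
  intro α
  rw [← deriv_comp_add_const]
  congr 1
  ext x
  exact h x

/-- The parameter `α` realizes the distance of `x` to the curve `γ`. -/
def IsNearest (γ : ℝ → ℂ) (x : ℂ) (α : ℝ) : Prop := ∀ β, ‖x - γ α‖ ≤ ‖x - γ β‖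

/-! ### Chord-arc geometry: transversals, nearest points, null range. -/

namespace IsCurveFamily

variable {X : Type*} [TopologicalSpace X] {ℓ δ H C : ℝ} {γ : X → ℝ → ℂ}

lemma hasDerivAt (h : IsCurveFamily ℓ δ H C γ) (p : X) (α : ℝ) :
    HasDerivAt (γ p) (deriv (γ p) α) α := (h.differentiable p α).hasDerivAt

lemma continuous (h : IsCurveFamily ℓ δ H C γ) (p : X) : Continuous (γ p) :=
  (h.differentiable p).continuous

lemma continuous_deriv_apply (h : IsCurveFamily ℓ δ H C γ) (p : X) : Continuous (deriv (γ p)) :=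
  h.continuous_deriv.comp (Continuous.prodMk_right p)

lemma taylor (h : IsCurveFamily ℓ δ H C γ) (p : X) (α u : ℝ) :
    ‖γ p (α + u) - γ p α - u * deriv (γ p) α‖ ≤ H * |u| ^ δ * |u| := by
  have hd : ∀ v ∈ Icc (-|u|) |u|, HasDerivWithinAt
      (fun v : ℝ => γ p (α + v) - v * deriv (γ p) α)
      (deriv (γ p) (α + v) - deriv (γ p) α) (Icc (-|u|) |u|) v := by
    intro v _
    have h1 : HasDerivAt (fun v : ℝ => γ p (α + v)) (deriv (γ p) (α + v)) v :=
      (h.hasDerivAt p (α + v)).comp_const_add α v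
    have h2 : HasDerivAt (fun v : ℝ => (v : ℂ) * deriv (γ p) α) (1 * deriv (γ p) α) v :=
      (Complex.ofRealCLM.hasDerivAt (x := v)).mul_const _
    simpa using (h1.fun_sub h2).hasDerivWithinAt
  have hb : ∀ v ∈ Icc (-|u|) |u|, ‖deriv (γ p) (α + v) - deriv (γ p) α‖ ≤ H * |u| ^ δ := by
    intro v hv
    refine (h.holder p _ _).trans ?_
    have : |α + v - α| ≤ |u| := by simpa [abs_le] using hv
    have := h.exponent_pos
    have := h.bound_pos
    gcongr
  have := (convex_Icc (-|u|) |u|).norm_image_sub_le_of_norm_hasDerivWithin_le hd hb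
    (x := 0) (y := u) (by simp) (by simp [neg_abs_le, le_abs_self])
  simpa [sub_right_comm] using this

/-- Divide the chord-arc bound by `u` and let `u` decrease to `0`; the Taylor remainder disappears.
-/
lemma one_le_norm_deriv (h : IsCurveFamily ℓ δ H C γ) (p : X) (α : ℝ) :
    1 ≤ C * ‖deriv (γ p) α‖ := by
  have hC := h.chord_pos
  have hev : ∀ᶠ u in 𝓝[>] (0 : ℝ), 1 ≤ C * ‖deriv (γ p) α‖ + C * H * u ^ δ := by
    filter_upwards [Ioo_mem_nhdsGT (half_pos h.length_pos)] with u hu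
    have hu0 := hu.1
    have h1 := h.chord p α u (by rw [abs_of_pos hu0]; exact hu.2.le)
    have h2 := h.taylor p α u
    rw [abs_of_pos hu0] at h1 h2
    have h3 : ‖γ p (α + u) - γ p α‖ ≤ H * u ^ δ * u + u * ‖deriv (γ p) α‖ := by
      calc ‖γ p (α + u) - γ p α‖
          = ‖(γ p (α + u) - γ p α - u * deriv (γ p) α) + u * deriv (γ p) α‖ := by ring_nf
        _ ≤ _ := (norm_add_le _ _).trans (by
          rw [norm_mul, Complex.norm_real, Real.norm_of_nonneg hu0.le]; gcongr)
    have h4 : u * 1 ≤ u * (C * ‖deriv (γ p) α‖ + C * H * u ^ δ) := by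
      nlinarith [mul_le_mul_of_nonneg_left h3 hC.le]
    exact le_of_mul_le_mul_left h4 hu0
  have hlim : Tendsto (fun u : ℝ => C * ‖deriv (γ p) α‖ + C * H * u ^ δ) (𝓝[>] 0)
      (𝓝 (C * ‖deriv (γ p) α‖ + C * H * 0 ^ δ)) :=
    (((Real.continuousAt_rpow_const 0 δ (Or.inr h.exponent_pos.le)).tendsto.mono_left
      nhdsWithin_le_nhds).const_mul _).const_add _
  rw [Real.zero_rpow h.exponent_pos.ne', mul_zero, add_zero] at hlim
  exact ge_of_tendsto hlim hev

lemma deriv_ne_zero (h : IsCurveFamily ℓ δ H C γ) (p : X) (α : ℝ) : deriv (γ p) α ≠ 0 := by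
  intro h0
  have := h.one_le_norm_deriv p α
  simp [h0] at this
  linarith

/-- Points reached from the curve in a direction transversal to it stay away from the curve. -/
lemma transversal (h : IsCurveFamily ℓ δ H C γ) {κ D : ℝ} (hκ : 0 < κ) (hD : 0 < D) :
    ∃ ε > 0, ∃ b > 0, ∀ p α, ∀ d : ℂ, ‖d‖ ≤ D →
      κ ≤ (d * (starRingEnd ℂ) (deriv (γ p) α)).re → ∀ s : ℝ, |s| ≤ ε → ∀ u : ℝ, |u| ≤ ℓ / 2 →
        b * (|u| + |s|) ≤ ‖γ p (α + u) - γ p α - s * (Complex.I * d)‖ := by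
  have hH := h.bound_pos
  have hC := h.chord_pos
  set K : ℝ := H / κ + C * (1 + D * H / κ) with hK
  have hK0 : 0 < K := by positivity
  -- For `|u| ≤ u₀` the Taylor remainder uses up at most half of the linear lower bound `(|u| + |s|)
  -- / K`.
  obtain ⟨u₀, hu₀, hsmall⟩ : ∃ u₀ > 0, ∀ u : ℝ, |u| ≤ u₀ → H * |u| ^ δ ≤ 1 / (2 * K) := by
    have hlim : Tendsto (fun u : ℝ => H * |u| ^ δ) (𝓝 0) (𝓝 (H * |(0:ℝ)| ^ δ)) := by
      have : Continuous (fun u : ℝ => H * |u| ^ δ) :=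
        continuous_const.mul (continuous_abs.rpow_const fun _ => Or.inr h.exponent_pos.le)
      exact this.tendsto 0
    rw [abs_zero, Real.zero_rpow h.exponent_pos.ne', mul_zero] at hlim
    have := hlim.eventually (gt_mem_nhds (show (0:ℝ) < 1 / (2 * K) by positivity))
    obtain ⟨r, hr, hball⟩ := Metric.eventually_nhds_iff.1 this
    refine ⟨r / 2, by positivity, fun u hu => (hball ?_).le⟩
    rw [Real.dist_eq, sub_zero]
    linarith
  refine ⟨min u₀ (u₀ / (2 * C * D)), by positivity, min (1 / (2 * K)) (1 / (4 * C)),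
    by positivity, ?_⟩
  intro p α d hd hκd s hs u hu
  have hsu : |s| ≤ u₀ := hs.trans (min_le_left _ _)
  have hsD : |s| * D ≤ u₀ / (2 * C) := by
    have := hs.trans (min_le_right _ _)
    calc |s| * D ≤ u₀ / (2 * C * D) * D := by gcongr
      _ = u₀ / (2 * C) := by field_simp
  have hsum : 0 ≤ |u| + |s| := by positivity
  rcases le_or_gt |u| u₀ with hle | hgt
  · have hA : |u| + |s| ≤ K * ‖u * deriv (γ p) α - s * (Complex.I * d)‖ := by
      set A : ℂ := u * deriv (γ p) α - s * (Complex.I * d) with hAdef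
      -- Pairing with the normal `I * γ'` removes the tangential term in `u`, so `A` controls `s`;
      -- the triangle inequality then controls `u`.
      have e1 : (A * (starRingEnd ℂ) (Complex.I * deriv (γ p) α)).re
          = -s * (d * (starRingEnd ℂ) (deriv (γ p) α)).re := by
        rw [hAdef]; simp; ring
      have e2 : |s| * κ ≤ ‖A‖ * H := by
        calc |s| * κ ≤ |s| * |(d * (starRingEnd ℂ) (deriv (γ p) α)).re| := by
              gcongr; exact hκd.trans (le_abs_self _)
          _ = |(A * (starRingEnd ℂ) (Complex.I * deriv (γ p) α)).re| := by
              rw [e1, abs_mul, abs_neg]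
          _ ≤ ‖A * (starRingEnd ℂ) (Complex.I * deriv (γ p) α)‖ := Complex.abs_re_le_norm _
          _ = ‖A‖ * ‖deriv (γ p) α‖ := by simp
          _ ≤ ‖A‖ * H := by gcongr; exact h.norm_deriv_le p α
      have e3 : |s| ≤ ‖A‖ * H / κ := by rw [le_div_iff₀ hκ]; exact e2
      have e4 : |u| ≤ C * (‖A‖ + |s| * D) := by
        have : |u| * ‖deriv (γ p) α‖ ≤ ‖A‖ + |s| * D := by
          calc |u| * ‖deriv (γ p) α‖ = ‖A + s * (Complex.I * d)‖ := by
                rw [hAdef, sub_add_cancel, norm_mul, Complex.norm_real, Real.norm_eq_abs]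
            _ ≤ ‖A‖ + |s| * ‖d‖ := (norm_add_le _ _).trans (by simp)
            _ ≤ _ := by gcongr
        calc |u| = |u| * 1 := (mul_one _).symm
          _ ≤ |u| * (C * ‖deriv (γ p) α‖) := by gcongr; exact h.one_le_norm_deriv p α
          _ = C * (|u| * ‖deriv (γ p) α‖) := by ring
          _ ≤ _ := by gcongr
      calc |u| + |s| ≤ C * (‖A‖ + (‖A‖ * H / κ) * D) + ‖A‖ * H / κ := by
            refine add_le_add (e4.trans ?_) e3
            gcongr
        _ = K * ‖A‖ := by rw [hK]; field_simp; ring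
    have hT := h.taylor p α u
    have h1 : (|u| + |s|) / K ≤ ‖u * deriv (γ p) α - s * (Complex.I * d)‖ := by
      rw [div_le_iff₀ hK0, mul_comm]; exact hA
    have h2 : H * |u| ^ δ * |u| ≤ 1 / (2 * K) * (|u| + |s|) := by
      have := hsmall u hle
      calc H * |u| ^ δ * |u| ≤ 1 / (2 * K) * |u| := by gcongr
        _ ≤ _ := by gcongr; linarith [abs_nonneg s]
    have h3 : ‖u * deriv (γ p) α - s * (Complex.I * d)‖ ≤
        ‖γ p (α + u) - γ p α - s * (Complex.I * d)‖
          + ‖γ p (α + u) - γ p α - u * deriv (γ p) α‖ := by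
      refine le_trans (le_of_eq ?_) (norm_sub_le _ _)
      congr 1; ring
    have h4 : 1 / (2 * K) * (|u| + |s|) = (|u| + |s|) / K - 1 / (2 * K) * (|u| + |s|) := by
      field_simp; ring
    calc min (1 / (2 * K)) (1 / (4 * C)) * (|u| + |s|) ≤ 1 / (2 * K) * (|u| + |s|) := by
          gcongr; exact min_le_left _ _
      _ ≤ _ := by linarith
  -- Far from `α` no linearization is available: the chord is at least `|u| / C`, and `ε` is so
  -- small that the transversal displacement takes away at most half of it.
  · have h1 := h.chord p α u hu
    have h2 : ‖γ p (α + u) - γ p α‖ ≤ ‖γ p (α + u) - γ p α - s * (Complex.I * d)‖ + |s| * D := by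
      calc ‖γ p (α + u) - γ p α‖
          = ‖(γ p (α + u) - γ p α - s * (Complex.I * d)) + s * (Complex.I * d)‖ := by ring_nf
        _ ≤ _ := (norm_add_le _ _).trans (by
            gcongr
            simp only [norm_mul, Complex.norm_real, Real.norm_eq_abs, Complex.norm_I, one_mul]
            gcongr)
    have h3 : |u| / C ≤ ‖γ p (α + u) - γ p α‖ := by
      rw [div_le_iff₀ hC, mul_comm]; exact h1
    have h4 : u₀ / (2 * C) ≤ |u| / (2 * C) := by gcongr
    have h5 : |u| / C - |u| / (2 * C) = |u| / (2 * C) := by field_simp; ring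
    calc min (1 / (2 * K)) (1 / (4 * C)) * (|u| + |s|) ≤ 1 / (4 * C) * (|u| + |u|) := by
          exact mul_le_mul (min_le_right _ _) (by linarith) hsum (by positivity)
      _ = |u| / (2 * C) := by field_simp; ring
      _ ≤ _ := by linarith

lemma exists_eq_add (h : IsCurveFamily ℓ δ H C γ) (p : X) (α β : ℝ) :
    ∃ u, |u| ≤ ℓ / 2 ∧ γ p β = γ p (α + u) := by
  obtain ⟨y, hy, e⟩ := (h.periodic p).exists_mem_Ico h.length_pos β (α - ℓ / 2)
  refine ⟨y - α, ?_, by rw [e]; ring_nf⟩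
  rw [abs_le]
  constructor <;> linarith [hy.1, hy.2]

lemma notMem_range_of_transversal (h : IsCurveFamily ℓ δ H C γ) {b s : ℝ} {d : ℂ} {p : X} {α : ℝ}
    (hb : 0 < b) (hs : s ≠ 0)
    (ht : ∀ u : ℝ, |u| ≤ ℓ / 2 →
        b * (|u| + |s|) ≤ ‖γ p (α + u) - γ p α - s * (Complex.I * d)‖) :
    γ p α + s * (Complex.I * d) ∉ range (γ p) := by
  rintro ⟨β, hβ⟩
  obtain ⟨u, hu, e⟩ := h.exists_eq_add p α β
  have h1 := ht u hu
  rw [← e, hβ] at h1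
  have : (0:ℝ) < b * (|u| + |s|) := by positivity
  simp at h1
  linarith

lemma exists_isNearest (h : IsCurveFamily ℓ δ H C γ) (p : X) (x : ℂ) (α₀ : ℝ) :
    ∃ α, |α - α₀| ≤ ℓ / 2 ∧ IsNearest (γ p) x α := by
  have hne : (Icc (α₀ - ℓ / 2) (α₀ + ℓ / 2)).Nonempty :=
    nonempty_Icc.2 (by linarith [h.length_pos])
  obtain ⟨α, hα, hmin⟩ := (isCompact_Icc (a := α₀ - ℓ / 2) (b := α₀ + ℓ / 2)).exists_isMinOn hne
    ((continuous_const.sub (h.continuous p)).norm.continuousOn (f := fun β => ‖x - γ p β‖))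
  refine ⟨α, by rw [abs_le]; constructor <;> linarith [hα.1, hα.2], fun β => ?_⟩
  obtain ⟨u, hu, e⟩ := h.exists_eq_add p α₀ β
  rw [e]
  rw [abs_le] at hu
  exact hmin ⟨by linarith, by linarith⟩

/-- The chord from `γ α` to `γ (α + u)` is at most the sum of the distances of its ends to `x`, and
the first of these is the smaller one. -/
lemma le_of_isNearest (h : IsCurveFamily ℓ δ H C γ) {p : X} {x : ℂ} {α : ℝ}
    (hα : IsNearest (γ p) x α) {u : ℝ} (hu : |u| ≤ ℓ / 2) :
    |u| ≤ 2 * C * ‖x - γ p (α + u)‖ := by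
  have h1 := h.chord p α u hu
  have h2 : ‖γ p (α + u) - γ p α‖ ≤ 2 * ‖x - γ p (α + u)‖ := by
    calc ‖γ p (α + u) - γ p α‖ = ‖(x - γ p α) - (x - γ p (α + u))‖ := by ring_nf
      _ ≤ ‖x - γ p α‖ + ‖x - γ p (α + u)‖ := norm_sub_le _ _
      _ ≤ _ := by linarith [hα (α + u)]
  have := h.chord_pos
  calc |u| ≤ _ := h1
    _ ≤ C * (2 * ‖x - γ p (α + u)‖) := by gcongr
    _ = _ := by ring

/-- The squared distance is critical at `α`, so `x - γ α` is orthogonal to the tangent. -/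
lemma exists_eq_of_isNearest (h : IsCurveFamily ℓ δ H C γ) {p : X} {x : ℂ} {α : ℝ}
    (hα : IsNearest (γ p) x α) :
    ∃ s : ℝ, x = γ p α + s * (Complex.I * deriv (γ p) α) := by
  have hd : HasDerivAt (fun β => ‖x - γ p β‖ ^ 2)
      (2 * inner ℝ (x - γ p α) (-deriv (γ p) α)) α :=
    ((h.hasDerivAt p α).const_sub x).norm_sq
  have hmin : IsLocalMin (fun β => ‖x - γ p β‖ ^ 2) α :=
    Eventually.of_forall fun β => by
      have := hα β
      dsimp only
      gcongr
  have h0 := hmin.hasDerivAt_eq_zero hd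
  rw [Complex.inner] at h0
  have hne := h.deriv_ne_zero p α
  have hre : ((x - γ p α) / deriv (γ p) α).re = 0 := by
    rw [Complex.div_re]
    simp at h0
    have : (x - γ p α).re * (deriv (γ p) α).re + (x - γ p α).im * (deriv (γ p) α).im = 0 := by
      simp; linarith
    rw [← add_div, this, zero_div]
  refine ⟨((x - γ p α) / deriv (γ p) α).im, ?_⟩
  have h2 : (x - γ p α) / deriv (γ p) α
      = (((x - γ p α) / deriv (γ p) α).im : ℂ) * Complex.I := by
    apply Complex.ext <;> simp [hre]
  have h3 : x - γ p α = (x - γ p α) / deriv (γ p) α * deriv (γ p) α := by field_simp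
  rw [h2] at h3
  linear_combination h3

lemma isCompact_range (h : IsCurveFamily ℓ δ H C γ) (p : X) : IsCompact (range (γ p)) := by
  rw [← (h.periodic p).image_Icc h.length_pos 0]
  exact isCompact_Icc.image (h.continuous p)

/-- The curve is the image of the plane under `w ↦ γ (Re w)`, whose differential has rank at most
one everywhere; the easy case of Sard's theorem applies. -/
lemma volume_range (h : IsCurveFamily ℓ δ H C γ) (p : X) : volume (range (γ p)) = 0 := by
  have e : range (γ p) = (fun w : ℂ => γ p w.re) '' univ := by
    rw [image_univ]
    ext x
    exact ⟨fun ⟨β, hβ⟩ => ⟨β, by simpa using hβ⟩, fun ⟨w, hw⟩ => ⟨w.re, hw⟩⟩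
  rw [e]
  refine addHaar_image_eq_zero_of_det_fderivWithin_eq_zero volume
    (f' := fun w => (ContinuousLinearMap.toSpanSingleton ℝ (deriv (γ p) w.re)).comp
      Complex.reCLM) (fun w _ => ?_) (fun w _ => ?_)
  · exact ((h.hasDerivAt p w.re).hasFDerivAt.comp w
      Complex.reCLM.hasFDerivAt).hasFDerivWithinAt
  · by_contra hdet
    have hinj : Function.Injective ((ContinuousLinearMap.toSpanSingleton ℝ
        (deriv (γ p) w.re)).comp Complex.reCLM) := by
      exact (LinearMap.equivOfDetNeZero _ hdet).injective
    have := @hinj Complex.I 0 (by simp)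
    exact Complex.I_ne_zero this

lemma ae_notMem_range (h : IsCurveFamily ℓ δ H C γ) (p : X) :
    ∀ᵐ x : ℂ, x ∉ range (γ p) := measure_eq_zero_iff_ae_notMem.1 (h.volume_range p)

end IsCurveFamily

namespace IsCurveFamily

variable {X : Type*} [TopologicalSpace X] {ℓ δ H C : ℝ} {γ : X → ℝ → ℂ}

/-! ### Integrals of Cauchy type -/

lemma continuousOn_cauchyIntegral (h : IsCurveFamily ℓ δ H C γ) {a : X → ℝ → ℂ}
    (ha : Continuous (fun q : X × ℝ => a q.1 q.2)) (r s : ℝ) :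
    ContinuousOn (fun q : X × ℂ => ∫ β in r..s, a q.1 β / (q.2 - γ q.1 β))
      {q | q.2 ∉ range (γ q.1)} := by
  rw [continuousOn_iff_continuous_domRestrict]
  refine intervalIntegral.continuous_parametric_intervalIntegral_of_continuous'
    (f := fun (q : {q : X × ℂ | q.2 ∉ range (γ q.1)}) β =>
      a q.1.1 β / (q.1.2 - γ q.1.1 β)) ?_ _ _
  refine Continuous.div ?_ ?_ ?_
  · exact ha.comp (((continuous_fst.comp continuous_subtype_val).comp continuous_fst).prodMk
      continuous_snd)
  · exact ((continuous_snd.comp continuous_subtype_val).comp continuous_fst).sub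
      (h.continuous_uncurry.comp (((continuous_fst.comp continuous_subtype_val).comp
        continuous_fst).prodMk continuous_snd))
  · rintro ⟨⟨q, hq⟩, β⟩ h0
    exact hq ⟨β, (sub_eq_zero.1 h0).symm⟩

lemma tendsto_cauchyIntegral_cocompact (h : IsCurveFamily ℓ δ H C γ) (p : X) {a : ℝ → ℂ}
    (ha : Continuous a) (r s : ℝ) :
    Tendsto (fun x : ℂ => ∫ β in r..s, a β / (x - γ p β)) (cocompact ℂ) (𝓝 0) := by
  obtain ⟨R, hR⟩ := (h.isCompact_range p).isBounded.exists_norm_le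
  have hfar : ∀ᶠ x : ℂ in cocompact ℂ, R + 1 ≤ ‖x‖ :=
    tendsto_norm_cocompact_atTop.eventually_ge_atTop _
  have : (cocompact ℂ).IsCountablyGenerated := by
    rw [← Metric.cobounded_eq_cocompact, ← comap_norm_atTop]
    infer_instance
  have key : Tendsto (fun x : ℂ => ∫ β in r..s, a β / (x - γ p β)) (cocompact ℂ)
      (𝓝 (∫ _β in r..s, (0 : ℂ))) := by
    refine intervalIntegral.tendsto_integral_filter_of_dominated_convergence
      (fun β => ‖a β‖) ?_ ?_ (ha.norm.intervalIntegrable _ _) ?_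
    · refine Eventually.of_forall fun x => ?_
      have : Measurable (fun β => a β / (x - γ p β)) :=
        ha.measurable.div (measurable_const.sub (h.continuous p).measurable)
      exact this.aestronglyMeasurable
    · filter_upwards [hfar] with x hx
      refine ae_of_all _ fun β _ => ?_
      rw [norm_div]
      refine div_le_self (norm_nonneg _) ?_
      have := hR _ (mem_range_self β)
      have := norm_sub_norm_le x (γ p β)
      linarith
    · refine ae_of_all _ fun β _ => ?_
      have h1 : Tendsto (fun x : ℂ => x - γ p β) (cocompact ℂ) (Bornology.cobounded ℂ) := by
        rw [← Metric.cobounded_eq_cocompact, ← tendsto_norm_atTop_iff_cobounded]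
        refine tendsto_atTop_mono (fun x => norm_sub_norm_le x (γ p β)) ?_
        exact tendsto_atTop_add_const_right _ _ tendsto_norm_cobounded_atTop
      have h2 := (tendsto_inv₀_cobounded.comp h1).const_mul (a β)
      simpa [div_eq_mul_inv] using h2
  simpa using key

/-! ### Winding numbers -/

omit [TopologicalSpace X] in
lemma windingNumber_eq (p : X) (x : ℂ) :
    windingNumber ℓ (γ p) x = -(2 * Real.pi * Complex.I)⁻¹ *
      ∫ β in (-ℓ / 2)..(ℓ / 2), deriv (γ p) β / (x - γ p β) := by
  rw [windingNumber, neg_mul, ← mul_neg, ← intervalIntegral.integral_neg]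
  congr 2
  ext β
  rw [← div_neg, neg_sub]

lemma continuousOn_windingNumber (h : IsCurveFamily ℓ δ H C γ) :
    ContinuousOn (fun q : X × ℂ => windingNumber ℓ (γ q.1) q.2) {q | q.2 ∉ range (γ q.1)} := by
  simp_rw [windingNumber_eq]
  exact ContinuousOn.mul continuousOn_const
    (h.continuousOn_cauchyIntegral (a := fun p β => deriv (γ p) β) h.continuous_deriv _ _)

/-- With `F` a primitive of `γ' / (γ - x)`, the product `(γ - x) exp(-F)` is constant. Over a period
`γ` returns to its value, so the total increment of `F` lies in `2πi ℤ`. -/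
lemma exists_windingNumber_eq_intCast (h : IsCurveFamily ℓ δ H C γ) {p : X} {x : ℂ}
    (hx : x ∉ range (γ p)) : ∃ n : ℤ, windingNumber ℓ (γ p) x = n := by
  have hne : ∀ β, γ p β - x ≠ 0 := fun β h0 => hx ⟨β, sub_eq_zero.1 h0⟩
  have hcont : Continuous (fun β => deriv (γ p) β / (γ p β - x)) :=
    (h.continuous_deriv_apply p).div ((h.continuous p).sub continuous_const) hne
  set F : ℝ → ℂ := fun y => ∫ β in (-ℓ / 2)..y, deriv (γ p) β / (γ p β - x) with hF
  have hFd : ∀ y, HasDerivAt F (deriv (γ p) y / (γ p y - x)) y := fun y =>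
    hcont.integral_hasStrictDerivAt _ y |>.hasDerivAt
  have hder : ∀ y, HasDerivAt (fun y => (γ p y - x) * Complex.exp (-F y)) 0 y := by
    intro y
    have h1 := ((h.hasDerivAt p y).sub_const x).fun_mul (hFd y).fun_neg.cexp
    refine h1.congr_deriv ?_
    have e : (γ p y - x) * (deriv (γ p) y / (γ p y - x)) = deriv (γ p) y :=
      mul_div_cancel₀ _ (hne y)
    linear_combination -Complex.exp (-F y) * e
  have hconst := is_const_of_deriv_eq_zero (fun y => (hder y).differentiableAt)
    (fun y => (hder y).deriv) (ℓ / 2) (-ℓ / 2)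
  have hper : γ p (ℓ / 2) = γ p (-ℓ / 2) := by
    rw [← h.periodic p (-ℓ / 2)]; congr 1; ring
  have hF0 : F (-ℓ / 2) = 0 := intervalIntegral.integral_same
  simp only [hper, hF0, neg_zero, Complex.exp_zero] at hconst
  have hexp := mul_left_cancel₀ (hne _) hconst
  obtain ⟨n, hn⟩ := Complex.exp_eq_one_iff.1 hexp
  refine ⟨-n, ?_⟩
  rw [windingNumber]
  change (2 * Real.pi * Complex.I)⁻¹ * F (ℓ / 2) = _
  have : F (ℓ / 2) = -(n * (2 * Real.pi * Complex.I)) := by rw [← hn, neg_neg]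
  rw [this]
  have := Complex.two_pi_I_ne_zero
  push_cast
  field_simp

/-- A continuous integer-valued function is constant on a preconnected set. The set lies in the
product with the parameter space, so the curve may move together with the point. -/
lemma windingNumber_eq_of_isPreconnected (h : IsCurveFamily ℓ δ H C γ) {S : Set (X × ℂ)}
    (hS : IsPreconnected S) (hoff : ∀ q ∈ S, q.2 ∉ range (γ q.1)) {q r : X × ℂ} (hq : q ∈ S)
    (hr : r ∈ S) : windingNumber ℓ (γ q.1) q.2 = windingNumber ℓ (γ r.1) r.2 := by
  have hex : ∀ q : X × ℂ, ∃ n : ℤ, q ∈ S → windingNumber ℓ (γ q.1) q.2 = n := by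
    intro q
    by_cases hq : q ∈ S
    · obtain ⟨n, hn⟩ := h.exists_windingNumber_eq_intCast (hoff q hq)
      exact ⟨n, fun _ => hn⟩
    · exact ⟨0, fun hh => absurd hh hq⟩
  choose n hn using hex
  have hemb : Topology.IsInducing (fun k : ℤ => (k : ℂ)) := by
    have := Complex.isometry_ofReal.isEmbedding.isInducing.comp
      Int.isClosedEmbedding_coe_real.isInducing
    convert this using 1
    ext k; simp
  have hcn : ContinuousOn n S := by
    rw [hemb.continuousOn_iff]
    refine (h.continuousOn_windingNumber.mono hoff).congr fun q hq => ?_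
    exact (hn q hq).symm
  rw [hn q hq, hn r hr, hS.constant hcn hq hr]

lemma windingNumber_eq_of_path (h : IsCurveFamily ℓ δ H C γ) {Y : Type*} [TopologicalSpace Y]
    {S : Set Y} (hS : IsPreconnected S) {f : Y → X} {g : Y → ℂ} (hf : ContinuousOn f S)
    (hg : ContinuousOn g S) (hoff : ∀ y ∈ S, g y ∉ range (γ (f y))) {y y' : Y} (hy : y ∈ S)
    (hy' : y' ∈ S) : windingNumber ℓ (γ (f y)) (g y) = windingNumber ℓ (γ (f y')) (g y') := by
  refine h.windingNumber_eq_of_isPreconnected (q := (f y, g y)) (r := (f y', g y'))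
    (hS.image _ (hf.prodMk hg)) ?_ (mem_image_of_mem _ hy) (mem_image_of_mem _ hy')
  rintro _ ⟨y, hy, rfl⟩
  exact hoff y hy

lemma eventually_windingNumber_eq_zero (h : IsCurveFamily ℓ δ H C γ) (p : X) :
    ∀ᶠ x in cocompact ℂ, x ∉ range (γ p) ∧ windingNumber ℓ (γ p) x = 0 := by
  have h0 : Tendsto (fun x => windingNumber ℓ (γ p) x) (cocompact ℂ) (𝓝 0) := by
    simp_rw [windingNumber_eq]
    simpa using (h.tendsto_cauchyIntegral_cocompact p (h.continuous_deriv_apply p) _ _).const_mul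
      (-(2 * Real.pi * Complex.I)⁻¹)
  have h1 : ∀ᶠ x in cocompact ℂ, x ∉ range (γ p) := (h.isCompact_range p).compl_mem_cocompact
  have h2 := h0.norm.eventually_lt_const (by simp : ‖(0 : ℂ)‖ < 1)
  filter_upwards [h1, h2] with x hx hx2
  refine ⟨hx, ?_⟩
  obtain ⟨n, hn⟩ := h.exists_windingNumber_eq_intCast hx
  rw [hn] at hx2 ⊢
  rw [Complex.norm_intCast] at hx2
  have : |n| < 1 := by exact_mod_cast hx2
  rw [Int.abs_lt_one_iff] at this
  simp [this]

/-- The jump of the winding number across the curve. -/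
lemma tendsto_windingNumber_sub (h : IsCurveFamily ℓ δ H C γ) (p : X) (α : ℝ) :
    Tendsto (fun s : ℝ =>
      windingNumber ℓ (γ p) (γ p α + s * (Complex.I * deriv (γ p) α)) -
      windingNumber ℓ (γ p) (γ p α - s * (Complex.I * deriv (γ p) α))) (𝓝[>] 0) (𝓝 1) := by
  have hC := h.chord_pos
  have hH := h.bound_pos
  set τ := deriv (γ p) α with hτ
  have hτ0 : τ ≠ 0 := h.deriv_ne_zero p α
  have hττ : (τ * (starRingEnd ℂ) τ).re = ‖τ‖ ^ 2 := by
    rw [Complex.mul_conj, Complex.ofReal_re, Complex.normSq_eq_norm_sq]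
  have hκ : (0:ℝ) < ‖τ‖ ^ 2 := by positivity
  obtain ⟨ε, hε, b, hb, htr⟩ := h.transversal hκ hH
  have htr' := htr p α τ (h.norm_deriv_le p α) hττ.ge
  -- `g s` is the difference of the two winding integrands. In the variable `v = (β - α) / s` it
  -- tends to `2i / (1 + v²)`, whose integral `2πi` gives the jump `1`.
  set g : ℝ → ℝ → ℂ := fun s β => deriv (γ p) β * (2 * s * (Complex.I * τ)) /
    ((γ p β - γ p α - s * (Complex.I * τ)) * (γ p β - γ p α + s * (Complex.I * τ))) with hg
  have hrep : ∀ s ∈ Ioo 0 ε,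
      windingNumber ℓ (γ p) (γ p α + s * (Complex.I * τ)) -
      windingNumber ℓ (γ p) (γ p α - s * (Complex.I * τ)) =
      (2 * Real.pi * Complex.I)⁻¹ *
        ∫ v, (Ioc ((-ℓ / 2) / s) ((ℓ / 2) / s)).indicator (fun v => s * g s (α + s * v)) v := by
    intro s hs
    have hs0 := hs.1
    have hsε : |s| ≤ ε := by rw [abs_of_pos hs0]; exact hs.2.le
    have hp : ∀ β, γ p β - (γ p α + s * (Complex.I * τ)) ≠ 0 := fun β h0 =>
      h.notMem_range_of_transversal hb hs0.ne' (htr' s hsε) ⟨β, sub_eq_zero.1 h0⟩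
    have hm : ∀ β, γ p β - (γ p α - s * (Complex.I * τ)) ≠ 0 := fun β h0 =>
      h.notMem_range_of_transversal (s := -s) hb (neg_ne_zero.2 hs0.ne')
        (htr' (-s) (by rwa [abs_neg])) ⟨β, by rw [sub_eq_zero.1 h0]; push_cast; ring⟩
    have hgp : Function.Periodic (g s) ℓ := fun β => by
      simp only [hg, h.periodic p β, periodic_deriv (h.periodic p) β]
    have hle : (-ℓ / 2) / s ≤ (ℓ / 2) / s := by
      have := h.length_pos
      gcongr; linarith
    rw [integral_indicator measurableSet_Ioc, ← intervalIntegral.integral_of_le hle,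
      intervalIntegral.integral_const_mul]
    have e1 := intervalIntegral.smul_integral_comp_add_mul (a := (-ℓ / 2) / s) (b := (ℓ / 2) / s)
      (g s) s α
    rw [Complex.real_smul] at e1
    rw [e1, mul_div_cancel₀ _ hs0.ne', mul_div_cancel₀ _ hs0.ne']
    have e2 := hgp.intervalIntegral_add_eq (α + -ℓ / 2) (-ℓ / 2)
    rw [show α + -ℓ / 2 + ℓ = α + ℓ / 2 by ring, show -ℓ / 2 + ℓ = ℓ / 2 by ring] at e2
    rw [e2, windingNumber, windingNumber, ← mul_sub, ← intervalIntegral.integral_sub]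
    · congr 2
      ext β
      rw [div_sub_div _ _ (hp β) (hm β), hg]
      dsimp only
      congr 1 <;> ring
    · exact ((h.continuous_deriv_apply p).div ((h.continuous p).sub continuous_const)
        hp).intervalIntegrable _ _
    · exact ((h.continuous_deriv_apply p).div ((h.continuous p).sub continuous_const)
        hm).intervalIntegrable _ _
  have hlim : Tendsto (fun s : ℝ => ∫ v, (Ioc ((-ℓ / 2) / s) ((ℓ / 2) / s)).indicator
      (fun v => s * g s (α + s * v)) v) (𝓝[>] 0)
      (𝓝 (∫ v : ℝ, (2 * Complex.I) * (((1 + v ^ 2)⁻¹ : ℝ) : ℂ))) := by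
    refine tendsto_integral_filter_of_dominated_convergence
      (fun v => (2 * H ^ 2 / b ^ 2) * (1 + v ^ 2)⁻¹) ?_ ?_
      (integrable_inv_one_add_sq.const_mul _) ?_
    · refine Eventually.of_forall fun s => ?_
      have hγ : Measurable (fun v => γ p (α + s * v)) :=
        (h.continuous p).measurable.comp (by fun_prop)
      have hγ' : Measurable (fun v => deriv (γ p) (α + s * v)) :=
        (h.continuous_deriv_apply p).measurable.comp (by fun_prop)
      have : Measurable (fun v => (s : ℂ) * g s (α + s * v)) := by
        simp only [hg]
        exact ((hγ'.mul_const _).div (((hγ.sub_const _).sub_const _).mul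
          ((hγ.sub_const _).add_const _))).const_mul _
      exact (this.indicator measurableSet_Ioc).aestronglyMeasurable
    · filter_upwards [Ioo_mem_nhdsGT hε] with s hs
      refine ae_of_all _ fun v => ?_
      have hs0 := hs.1
      have hsε : |s| ≤ ε := by rw [abs_of_pos hs0]; exact hs.2.le
      by_cases hv : v ∈ Ioc ((-ℓ / 2) / s) ((ℓ / 2) / s)
      · rw [indicator_of_mem hv]
        have hsv : |s * v| ≤ ℓ / 2 := by
          rw [mem_Ioc, div_lt_iff₀ hs0, le_div_iff₀ hs0] at hv
          rw [abs_le]; constructor <;> nlinarith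
        -- Transversality bounds both factors of the denominator below by `b s (1 + |v|)`; the
        -- powers of `s` cancel and leave an integrable majorant.
        have b1 := htr' s hsε _ hsv
        have b2 := htr' (-s) (by rwa [abs_neg]) _ hsv
        rw [abs_neg] at b2
        have hbb : b * (|s * v| + |s|) = b * s * (1 + |v|) := by
          rw [abs_mul, abs_of_pos hs0]; ring
        rw [hbb] at b1 b2
        have b2' : b * s * (1 + |v|) ≤
            ‖γ p (α + s * v) - γ p α + s * (Complex.I * τ)‖ := by
          refine b2.trans_eq ?_
          congr 1; push_cast; ring
        have hpos : 0 < b * s * (1 + |v|) := by positivity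
        have hnorm : ‖(s : ℂ) * g s (α + s * v)‖ ≤
            s * (H * (2 * s * H) / ((b * s * (1 + |v|)) * (b * s * (1 + |v|)))) := by
          simp only [hg, norm_mul, norm_div, Complex.norm_real, Complex.norm_I, one_mul,
            Complex.norm_two, Real.norm_of_nonneg hs0.le]
          have t1 := h.norm_deriv_le p α
          have t2 := h.norm_deriv_le p (α + s * v)
          gcongr
        refine hnorm.trans ?_
        have e1 : s * (H * (2 * s * H) / ((b * s * (1 + |v|)) * (b * s * (1 + |v|))))
            = 2 * H ^ 2 / b ^ 2 * ((1 + |v|) ^ 2)⁻¹ := by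
          field_simp
        rw [e1]
        gcongr
        nlinarith [abs_nonneg v, sq_abs v]
      · rw [indicator_of_notMem hv, norm_zero]
        positivity
    · refine ae_of_all _ fun v => ?_
      have hin : ∀ᶠ s : ℝ in 𝓝[>] 0, v ∈ Ioc ((-ℓ / 2) / s) ((ℓ / 2) / s) := by
        have hℓ := h.length_pos
        have : (0:ℝ) < ℓ / (2 * (|v| + 1)) := by positivity
        filter_upwards [Ioo_mem_nhdsGT this] with s hs
        have hs0 := hs.1
        have h2 : s * (2 * (|v| + 1)) < ℓ := (lt_div_iff₀ (by positivity)).1 hs.2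
        rw [mem_Ioc, div_lt_iff₀ hs0, le_div_iff₀ hs0]
        constructor <;> nlinarith [le_abs_self v, neg_abs_le v]
      have hsl : Tendsto (fun s : ℝ => (γ p (α + s * v) - γ p α) / s) (𝓝[>] 0) (𝓝 (v * τ)) := by
        have hd : HasDerivAt (fun s : ℝ => γ p (α + s * v)) (v • τ) 0 := by
          have h1 : HasDerivAt (fun s : ℝ => α + s * v) v 0 := by
            simpa using ((hasDerivAt_id (0:ℝ)).mul_const v).const_add α
          have h2 : HasDerivAt (γ p) τ (α + 0 * v) := by
            rw [zero_mul, add_zero]; exact h.hasDerivAt p α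
          exact h2.scomp 0 h1
        have := hd.tendsto_slope_zero_right
        refine (this.congr fun s => ?_).trans_eq ?_
        · simp [div_eq_inv_mul]
        · simp
      have hd1 : Tendsto (fun s : ℝ => deriv (γ p) (α + s * v)) (𝓝[>] 0) (𝓝 τ) := by
        have hc : Continuous (fun s : ℝ => deriv (γ p) (α + s * v)) :=
          (h.continuous_deriv_apply p).comp (by fun_prop)
        have := hc.tendsto 0
        simp only [zero_mul, add_zero] at this
        exact this.mono_left nhdsWithin_le_nhds
      have hv1 : (v : ℂ) * τ - Complex.I * τ ≠ 0 := by
        rw [← sub_mul]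
        refine mul_ne_zero (fun h0 => ?_) hτ0
        simpa using congrArg Complex.im h0
      have hv2 : (v : ℂ) * τ + Complex.I * τ ≠ 0 := by
        rw [← add_mul]
        refine mul_ne_zero (fun h0 => ?_) hτ0
        simpa using congrArg Complex.im h0
      have hfin := (hd1.mul_const (2 * (Complex.I * τ))).div
        ((hsl.sub_const (Complex.I * τ)).mul (hsl.add_const (Complex.I * τ)))
        (mul_ne_zero hv1 hv2)
      have e : τ * (2 * (Complex.I * τ)) / ((v * τ - Complex.I * τ) * (v * τ + Complex.I * τ))
          = (2 * Complex.I) * (((1 + v ^ 2)⁻¹ : ℝ) : ℂ) := by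
        have h3 : (v * τ - Complex.I * τ) * (v * τ + Complex.I * τ) = τ ^ 2 * (1 + v ^ 2) := by
          linear_combination -τ ^ 2 * Complex.I_sq
        rw [h3]
        push_cast
        have h4 : (1 + (v:ℂ) ^ 2) ≠ 0 := by
          have : (1 + v ^ 2 : ℝ) ≠ 0 := by positivity
          exact_mod_cast this
        field_simp
      rw [e] at hfin
      refine hfin.congr' ?_
      filter_upwards [hin, self_mem_nhdsWithin] with s hs hs0
      have hs0' : (s : ℂ) ≠ 0 := by exact_mod_cast (ne_of_gt hs0)
      rw [indicator_of_mem hs]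
      simp only [hg]
      have e3 : (γ p (α + s * v) - γ p α) / s - Complex.I * τ
          = (γ p (α + s * v) - γ p α - s * (Complex.I * τ)) / s := by field_simp
      have e4 : (γ p (α + s * v) - γ p α) / s + Complex.I * τ
          = (γ p (α + s * v) - γ p α + s * (Complex.I * τ)) / s := by field_simp
      simp only [Pi.div_apply]
      rw [e3, e4, div_mul_div_comm, div_div_eq_mul_div, ← mul_div_assoc]
      congr 1
      ring
  have hval : (2 * Real.pi * Complex.I)⁻¹ *
      ∫ v : ℝ, (2 * Complex.I) * (((1 + v ^ 2)⁻¹ : ℝ) : ℂ) = 1 := by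
    rw [integral_const_mul, integral_complex_ofReal, integral_univ_inv_one_add_sq]
    have h1 := Complex.two_pi_I_ne_zero
    rw [inv_mul_eq_one₀ h1]
    ring
  have := hlim.const_mul (2 * Real.pi * Complex.I)⁻¹
  rw [hval] at this
  refine this.congr' ?_
  filter_upwards [Ioo_mem_nhdsGT hε] with s hs
  exact (hrep s hs).symm

end IsCurveFamily
namespace IsCurveFamily

variable {X : Type*} [TopologicalSpace X] {ℓ δ H C : ℝ} {γ : X → ℝ → ℂ}

/-! ### The two sides of the curves -/

lemma sq_le_re_deriv_mul_conj (h : IsCurveFamily ℓ δ H C γ) (p : X) (α : ℝ) :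
    (C ^ 2)⁻¹ ≤ (deriv (γ p) α * (starRingEnd ℂ) (deriv (γ p) α)).re := by
  rw [Complex.mul_conj, Complex.ofReal_re, Complex.normSq_eq_norm_sq]
  have h1 := h.one_le_norm_deriv p α
  have hC := h.chord_pos
  rw [inv_le_iff_one_le_mul₀ (by positivity), ← mul_pow, mul_comm]
  exact one_le_pow₀ h1

/-- On each side of the curves, close to them, the winding number is constant in the whole family;
the values on the left and on the right differ by one. -/
lemma exists_sides [PreconnectedSpace X] [Nonempty X] (h : IsCurveFamily ℓ δ H C γ) :
    ∃ n : ℂ, ∀ κ > 0, ∀ D > 0, ∃ ε > 0, ∀ p α, ∀ d : ℂ, ‖d‖ ≤ D →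
      κ ≤ (d * (starRingEnd ℂ) (deriv (γ p) α)).re → ∀ s ∈ Ioo (0 : ℝ) ε,
        (γ p α + s * (Complex.I * d) ∉ range (γ p) ∧
          windingNumber ℓ (γ p) (γ p α + s * (Complex.I * d)) = n + 1) ∧
        (γ p α - s * (Complex.I * d) ∉ range (γ p) ∧
          windingNumber ℓ (γ p) (γ p α - s * (Complex.I * d)) = n) := by
  have hC := h.chord_pos
  have hH := h.bound_pos
  obtain ⟨ε₀, hε₀, b₀, hb₀, h0⟩ := h.transversal (κ := (C ^ 2)⁻¹) (by positivity) hH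
  obtain ⟨p₀⟩ := ‹Nonempty X›
  have hoff : ∀ p α (s : ℝ), s ≠ 0 → |s| ≤ ε₀ →
      γ p α + s * (Complex.I * deriv (γ p) α) ∉ range (γ p) := fun p α s hs hsε =>
    h.notMem_range_of_transversal hb₀ hs
      (h0 p α _ (h.norm_deriv_le p α) (h.sq_le_re_deriv_mul_conj p α) s hsε)
  have hcf : Continuous (fun y : (X × ℝ) × ℝ =>
      γ y.1.1 y.1.2 + y.2 * (Complex.I * deriv (γ y.1.1) y.1.2)) :=
    (h.continuous_uncurry.comp continuous_fst).add
      ((Complex.continuous_ofReal.comp continuous_snd).mul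
        (continuous_const.mul (h.continuous_deriv.comp continuous_fst)))
  have hconst : ∀ I : Set ℝ, IsPreconnected I → (∀ s ∈ I, s ≠ 0 ∧ |s| ≤ ε₀) →
      ∀ p α, ∀ s ∈ I, ∀ p' α', ∀ s' ∈ I,
      windingNumber ℓ (γ p) (γ p α + s * (Complex.I * deriv (γ p) α)) =
      windingNumber ℓ (γ p') (γ p' α' + s' * (Complex.I * deriv (γ p') α')) := by
    intro I hI hI' p α s hs p' α' s' hs'
    refine h.windingNumber_eq_of_path (S := (univ : Set (X × ℝ)) ×ˢ I)
      (f := fun y => y.1.1) (g := fun y => γ y.1.1 y.1.2 + y.2 *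
        (Complex.I * deriv (γ y.1.1) y.1.2)) (isPreconnected_univ.prod hI)
      (by fun_prop) hcf.continuousOn ?_ (y := ((p, α), s)) (y' := ((p', α'), s'))
      ⟨mem_univ _, hs⟩ ⟨mem_univ _, hs'⟩
    rintro ⟨⟨q, β⟩, r⟩ ⟨-, hr⟩
    exact hoff q β r (hI' r hr).1 (hI' r hr).2
  -- The value on the right collar at an arbitrary reference point; it is fixed before `κ` and `D`
  -- are chosen.
  set n := windingNumber ℓ (γ p₀) (γ p₀ 0 - (ε₀ / 2 : ℝ) * (Complex.I * deriv (γ p₀) 0)) with hn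
  have hneg : ∀ p α, ∀ s ∈ Ioo (0 : ℝ) ε₀,
      windingNumber ℓ (γ p) (γ p α - s * (Complex.I * deriv (γ p) α)) = n := by
    intro p α s hs
    have := hconst (Ioo (-ε₀) 0) isPreconnected_Ioo (fun s hs => ⟨hs.2.ne, by
      rw [abs_of_neg hs.2]; linarith [hs.1]⟩) p α (-s) ⟨by linarith [hs.2], by linarith [hs.1]⟩
      p₀ 0 (-(ε₀ / 2)) ⟨by linarith, by linarith⟩
    rw [hn]
    convert this using 2 <;> push_cast <;> ring
  have hpos : ∀ p α, ∀ s ∈ Ioo (0 : ℝ) ε₀,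
      windingNumber ℓ (γ p) (γ p α + s * (Complex.I * deriv (γ p) α)) = n + 1 := by
    intro p α s hs
    -- By constancy on the two collars the difference across the curve does not depend on `r`, so it
    -- equals its limit, the jump `1`.
    have hc : ∀ᶠ r : ℝ in 𝓝[>] 0,
        windingNumber ℓ (γ p) (γ p α + r * (Complex.I * deriv (γ p) α)) -
        windingNumber ℓ (γ p) (γ p α - r * (Complex.I * deriv (γ p) α)) =
        windingNumber ℓ (γ p) (γ p α + s * (Complex.I * deriv (γ p) α)) - n := by
      filter_upwards [Ioo_mem_nhdsGT hε₀] with r hr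
      rw [hneg p α r hr, hconst (Ioo 0 ε₀) isPreconnected_Ioo (fun s hs => ⟨hs.1.ne', by
        rw [abs_of_pos hs.1]; linarith [hs.2]⟩) p α r hr p α s hs]
    have hlim := h.tendsto_windingNumber_sub p α
    have := tendsto_nhds_unique (hlim.congr' hc) tendsto_const_nhds
    linear_combination -this
  refine ⟨n, fun κ hκ D hD => ?_⟩
  obtain ⟨ε₁, hε₁, b₁, hb₁, h1⟩ := h.transversal (κ := min κ (C ^ 2)⁻¹) (D := max D H)
    (by positivity) (by positivity)
  refine ⟨min ε₀ ε₁, by positivity, ?_⟩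
  intro p α d hd hκd s hs
  have hs0 : s ∈ Ioo 0 ε₀ := ⟨hs.1, hs.2.trans_le (min_le_left _ _)⟩
  have hs1 : |s| ≤ ε₁ := by rw [abs_of_pos hs.1]; exact hs.2.le.trans (min_le_right _ _)
  -- The direction `d` is deformed linearly into the tangent. Norm bound and transversality persist
  -- along the way, so the moving point never meets the curve.
  have hoff1 : ∀ σ : ℝ, σ ≠ 0 → |σ| ≤ ε₁ → ∀ r ∈ Icc (0 : ℝ) 1,
      γ p α + σ * (Complex.I * ((1 - r) * d + r * deriv (γ p) α)) ∉ range (γ p) := by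
    intro σ hσ hσε r hr
    refine h.notMem_range_of_transversal hb₁ hσ (h1 p α _ ?_ ?_ σ hσε)
    · calc ‖(1 - r) * d + r * deriv (γ p) α‖ ≤ ‖((1 - r : ℝ) : ℂ) * d‖ + ‖(r : ℂ) * deriv (γ p) α‖ := by
            push_cast; exact norm_add_le _ _
        _ ≤ (1 - r) * max D H + r * max D H := by
            rw [norm_mul, norm_mul, Complex.norm_real, Complex.norm_real,
              Real.norm_of_nonneg hr.1, Real.norm_of_nonneg (by linarith [hr.2])]
            have : 0 ≤ 1 - r := by linarith [hr.2]
            have := hr.1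
            have := h.norm_deriv_le p α
            gcongr
            · exact hd.trans (le_max_left _ _)
            · exact this.trans (le_max_right _ _)
        _ = max D H := by ring
    · have e : (((1 - r) * d + r * deriv (γ p) α) * (starRingEnd ℂ) (deriv (γ p) α)).re
          = (1 - r) * (d * (starRingEnd ℂ) (deriv (γ p) α)).re
            + r * (deriv (γ p) α * (starRingEnd ℂ) (deriv (γ p) α)).re := by
        simp; ring
      rw [e]
      have t1 := h.sq_le_re_deriv_mul_conj p α
      have t2 := min_le_left κ (C ^ 2)⁻¹
      have t3 := min_le_right κ (C ^ 2)⁻¹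
      nlinarith [hr.1, hr.2, mul_le_mul_of_nonneg_left (t3.trans t1) hr.1,
        mul_le_mul_of_nonneg_left (t2.trans hκd) (sub_nonneg.2 hr.2)]
  have hw : ∀ σ : ℝ, σ ≠ 0 → |σ| ≤ ε₁ →
      windingNumber ℓ (γ p) (γ p α + σ * (Complex.I * d)) =
      windingNumber ℓ (γ p) (γ p α + σ * (Complex.I * deriv (γ p) α)) := by
    intro σ hσ hσε
    have := h.windingNumber_eq_of_path (S := Icc (0 : ℝ) 1) isPreconnected_Icc (f := fun _ => p)
      (g := fun r : ℝ => γ p α + σ * (Complex.I * ((1 - r) * d + r * deriv (γ p) α)))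
      continuousOn_const (by fun_prop) (hoff1 σ hσ hσε) (y := 0) (y' := 1) (by simp) (by simp)
    simpa using this
  have hm : γ p α - s * (Complex.I * d) = γ p α + ((-s : ℝ) : ℂ) * (Complex.I * d) := by
    push_cast; ring
  have hm' : γ p α - s * (Complex.I * deriv (γ p) α)
      = γ p α + ((-s : ℝ) : ℂ) * (Complex.I * deriv (γ p) α) := by
    push_cast; ring
  refine ⟨⟨?_, ?_⟩, ?_, ?_⟩
  · simpa using hoff1 s hs.1.ne' hs1 0 (by simp)
  · rw [hw s hs.1.ne' hs1, hpos p α s hs0]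
  · rw [hm]
    simpa using hoff1 (-s) (neg_ne_zero.2 hs.1.ne') (by rwa [abs_neg]) 0 (by simp)
  · rw [hm, hw (-s) (neg_ne_zero.2 hs.1.ne') (by rwa [abs_neg]), ← hm', hneg p α s hs0]

/-- Every point off a curve is joined, off the curve, to points close to the curve in a normal
direction. -/
lemma exists_normal_mem_connectedComponentIn (h : IsCurveFamily ℓ δ H C γ) {p : X} {x : ℂ}
    (hx : x ∉ range (γ p)) {ε : ℝ} (hε : 0 < ε) :
    ∃ α, ∃ s : ℝ, s ≠ 0 ∧ |s| < ε ∧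
      γ p α + s * (Complex.I * deriv (γ p) α) ∈ connectedComponentIn (range (γ p))ᶜ x := by
  obtain ⟨α, -, hα⟩ := h.exists_isNearest p x 0
  obtain ⟨s, hs⟩ := h.exists_eq_of_isNearest hα
  have hs0 : s ≠ 0 := by
    rintro rfl
    exact hx ⟨α, by simpa using hs.symm⟩
  have hxα : 0 < ‖x - γ p α‖ := norm_pos_iff.2 fun h0 => hx ⟨α, (sub_eq_zero.1 h0).symm⟩
  set f : ℝ → ℂ := fun r => γ p α + ((r * s : ℝ) : ℂ) * (Complex.I * deriv (γ p) α) with hf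
  have hpre : IsPreconnected (f '' Ioc 0 1) :=
    isPreconnected_Ioc.image _ (by fun_prop)
  -- A point of the curve on the half-open segment would be closer to `x` than the nearest point.
  have hsub : f '' Ioc 0 1 ⊆ (range (γ p))ᶜ := by
    rintro _ ⟨r, hr, rfl⟩ ⟨β, hβ⟩
    have h1 := hα β
    have h2 : x - γ p β = ((1 - r : ℝ) : ℂ) * (x - γ p α) := by
      rw [hβ, hf, hs]; push_cast; ring
    rw [h2, norm_mul, Complex.norm_real, Real.norm_of_nonneg (by linarith [hr.2])] at h1
    nlinarith [hr.1]
  have hx1 : x ∈ f '' Ioc 0 1 := ⟨1, by simp, by simp only [hf, one_mul]; exact hs.symm⟩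
  have hmem := hpre.subset_connectedComponentIn hx1 hsub
  have hsa : 0 < |s| := abs_pos.2 hs0
  set r := min 1 (ε / (2 * |s|)) with hr
  have hr0 : 0 < r := by positivity
  refine ⟨α, r * s, mul_ne_zero hr0.ne' hs0, ?_, hmem ⟨r, ⟨hr0, min_le_left _ _⟩, rfl⟩⟩
  rw [abs_mul, abs_of_pos hr0]
  calc r * |s| ≤ ε / (2 * |s|) * |s| := by gcongr; exact min_le_right _ _
    _ = ε / 2 := by field_simp
    _ < ε := by linarith

lemma windingNumber_eq_of_mem_connectedComponentIn (h : IsCurveFamily ℓ δ H C γ) {p : X} {x y : ℂ}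
    (hy : y ∈ connectedComponentIn (range (γ p))ᶜ x) :
    windingNumber ℓ (γ p) y = windingNumber ℓ (γ p) x := by
  have hx : x ∈ (range (γ p))ᶜ := by
    by_contra hx
    rw [connectedComponentIn_eq_empty hx] at hy
    exact hy
  exact h.windingNumber_eq_of_path (S := connectedComponentIn (range (γ p))ᶜ x)
    isPreconnected_connectedComponentIn (f := fun _ => p) (g := fun y => y) continuousOn_const
    continuousOn_id (fun y hy => connectedComponentIn_subset _ _ hy) hy
    (mem_connectedComponentIn hx)

/-- The winding number is constant on the component and vanishes near infinity, so the component
stays away from infinity. -/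
lemma isBounded_connectedComponentIn (h : IsCurveFamily ℓ δ H C γ) {p : X} {x : ℂ}
    (hw : windingNumber ℓ (γ p) x ≠ 0) :
    Bornology.IsBounded (connectedComponentIn (range (γ p))ᶜ x) := by
  rw [Bornology.isBounded_def, Metric.cobounded_eq_cocompact]
  filter_upwards [h.eventually_windingNumber_eq_zero p] with y hy hmem
  rw [h.windingNumber_eq_of_mem_connectedComponentIn hmem] at hy
  exact hw hy.2

/-- If one of the curves is clockwise, then the left side of every curve has winding number `0`
and its right side has winding number `-1`. -/
lemma exists_sides_of_isClockwise [PreconnectedSpace X] (h : IsCurveFamily ℓ δ H C γ)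
    {p₀ : X} (hp₀ : IsClockwise ℓ (γ p₀)) :
    ∀ κ > 0, ∀ D > 0, ∃ ε > 0, ∀ p α, ∀ d : ℂ, ‖d‖ ≤ D →
      κ ≤ (d * (starRingEnd ℂ) (deriv (γ p) α)).re → ∀ s ∈ Ioo (0 : ℝ) ε,
        (γ p α + s * (Complex.I * d) ∉ range (γ p) ∧
          windingNumber ℓ (γ p) (γ p α + s * (Complex.I * d)) = 0) ∧
        (γ p α - s * (Complex.I * d) ∉ range (γ p) ∧
          windingNumber ℓ (γ p) (γ p α - s * (Complex.I * d)) = -1) := by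
  have : Nonempty X := ⟨p₀⟩
  have hC := h.chord_pos
  obtain ⟨n, hn⟩ := h.exists_sides
  suffices e : n = -1 by
    simpa [e] using hn
  obtain ⟨ε, hε, hside⟩ := hn (C ^ 2)⁻¹ (by positivity) H h.bound_pos
  have hside' := fun p α => hside p α _ (h.norm_deriv_le p α) (h.sq_le_re_deriv_mul_conj p α)
  have hleft := (hside' p₀ 0 (ε / 2) ⟨by linarith, by linarith⟩).1
  -- If `n + 1 ≠ 0`, the left collar is interior and the orientation gives `n + 1 = -1`. A far point
  -- has winding number `0` and is joined to one of the collars, so `0` would be `n` or `n + 1`, and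
  -- neither is possible.
  by_cases hn1 : n + 1 = 0
  · linear_combination hn1
  have hcw := hp₀ _ ⟨hleft.1, h.isBounded_connectedComponentIn (by rw [hleft.2]; exact hn1)⟩
  obtain ⟨y, hy, hy0⟩ := (h.eventually_windingNumber_eq_zero p₀).exists
  obtain ⟨α, s, hs0, hsε, hmem⟩ := h.exists_normal_mem_connectedComponentIn hy hε
  have hw := h.windingNumber_eq_of_mem_connectedComponentIn hmem
  rw [hy0] at hw
  rcases lt_or_gt_of_ne hs0 with hs | hs
  · have := (hside' p₀ α (-s) ⟨by linarith, by rwa [abs_of_neg hs] at hsε⟩).2.2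
    rw [Complex.ofReal_neg, neg_mul, sub_neg_eq_add, hw] at this
    rw [hleft.2, ← this] at hcw
    norm_num at hcw
  · have := (hside' p₀ α s ⟨hs, by rwa [abs_of_pos hs] at hsε⟩).1.2
    rw [hw] at this
    exact absurd this.symm hn1

lemma windingNumber_eq_zero_or [PreconnectedSpace X] (h : IsCurveFamily ℓ δ H C γ)
    {p₀ : X} (hp₀ : IsClockwise ℓ (γ p₀)) {p : X} {x : ℂ} (hx : x ∉ range (γ p)) :
    windingNumber ℓ (γ p) x = 0 ∨ windingNumber ℓ (γ p) x = -1 := by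
  have hC := h.chord_pos
  obtain ⟨ε, hε, hside⟩ := h.exists_sides_of_isClockwise hp₀ (C ^ 2)⁻¹ (by positivity) H h.bound_pos
  have hside' := fun p α => hside p α _ (h.norm_deriv_le p α) (h.sq_le_re_deriv_mul_conj p α)
  obtain ⟨α, s, hs0, hsε, hmem⟩ := h.exists_normal_mem_connectedComponentIn hx hε
  rw [← h.windingNumber_eq_of_mem_connectedComponentIn hmem]
  rcases lt_or_gt_of_ne hs0 with hs | hs
  · right
    have := (hside' p α (-s) ⟨by linarith, by rwa [abs_of_neg hs] at hsε⟩).2.2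
    rwa [Complex.ofReal_neg, neg_mul, sub_neg_eq_add] at this
  · left
    exact (hside' p α s ⟨hs, by rwa [abs_of_pos hs] at hsε⟩).1.2

/-- Every point of winding number `0` is joined to the left collar, which is connected. All these
points thus form one component, and it contains points arbitrarily far away. -/
lemma not_isBounded_connectedComponentIn [PreconnectedSpace X] (h : IsCurveFamily ℓ δ H C γ)
    {p₀ : X} (hp₀ : IsClockwise ℓ (γ p₀)) {p : X} {x : ℂ} (hx : x ∉ range (γ p))
    (hw : windingNumber ℓ (γ p) x = 0) :
    ¬ Bornology.IsBounded (connectedComponentIn (range (γ p))ᶜ x) := by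
  have hC := h.chord_pos
  obtain ⟨ε, hε, hside⟩ := h.exists_sides_of_isClockwise hp₀ (C ^ 2)⁻¹ (by positivity) H h.bound_pos
  have hside' := fun p α => hside p α _ (h.norm_deriv_le p α) (h.sq_le_re_deriv_mul_conj p α)
  set L : Set ℂ := (fun y : ℝ × ℝ => γ p y.1 + y.2 * (Complex.I * deriv (γ p) y.1)) ''
    (univ ×ˢ Ioo 0 ε) with hL
  have hLpre : IsPreconnected L := by
    refine (isPreconnected_univ.prod isPreconnected_Ioo).image _ (Continuous.continuousOn ?_)
    have h1 := (h.continuous p).comp (continuous_fst (X := ℝ) (Y := ℝ))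
    have h2 := (h.continuous_deriv_apply p).comp (continuous_fst (X := ℝ) (Y := ℝ))
    exact h1.add ((Complex.continuous_ofReal.comp continuous_snd).mul (continuous_const.mul h2))
  have hLoff : L ⊆ (range (γ p))ᶜ := by
    rintro _ ⟨y, ⟨-, hy⟩, rfl⟩
    exact (hside' p y.1 y.2 hy).1.1
  have key : ∀ y, y ∉ range (γ p) → windingNumber ℓ (γ p) y = 0 →
      ∃ q ∈ L, q ∈ connectedComponentIn (range (γ p))ᶜ y := by
    intro y hy hy0
    obtain ⟨α, s, hs0, hsε, hmem⟩ := h.exists_normal_mem_connectedComponentIn hy hε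
    refine ⟨_, ⟨(α, s), ⟨mem_univ _, ?_⟩, rfl⟩, hmem⟩
    rcases lt_or_gt_of_ne hs0 with hs | hs
    · have := (hside' p α (-s) ⟨by linarith, by rwa [abs_of_neg hs] at hsε⟩).2.2
      rw [Complex.ofReal_neg, neg_mul, sub_neg_eq_add,
        h.windingNumber_eq_of_mem_connectedComponentIn hmem, hy0] at this
      norm_num at this
    · exact ⟨hs, by rwa [abs_of_pos hs] at hsε⟩
  obtain ⟨q, hqL, hq⟩ := key x hx hw
  have hne : (cocompact ℂ).NeBot := inferInstance
  intro hbd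
  rw [Bornology.isBounded_def, Metric.cobounded_eq_cocompact] at hbd
  obtain ⟨y, ⟨hy, hy0⟩, hyn⟩ := ((h.eventually_windingNumber_eq_zero p).and hbd).exists
  apply hyn
  obtain ⟨q', hqL', hq'⟩ := key y hy hy0
  have e1 := connectedComponentIn_eq hq
  have e2 := connectedComponentIn_eq hq'
  have e3 := connectedComponentIn_eq (hLpre.subset_connectedComponentIn hqL hLoff hqL')
  rw [e1, e3, ← e2]
  exact mem_connectedComponentIn hy

lemma mem_curveInterior_iff [PreconnectedSpace X] (h : IsCurveFamily ℓ δ H C γ)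
    {p₀ : X} (hp₀ : IsClockwise ℓ (γ p₀)) (p : X) (x : ℂ) :
    x ∈ curveInterior (γ p) ↔ x ∉ range (γ p) ∧ windingNumber ℓ (γ p) x = -1 := by
  refine and_congr_right fun hx => ⟨fun hb => ?_, fun hw => ?_⟩
  · exact (h.windingNumber_eq_zero_or hp₀ hx).resolve_left
      fun h0 => h.not_isBounded_connectedComponentIn hp₀ hx h0 hb
  · exact h.isBounded_connectedComponentIn (by rw [hw]; norm_num)

lemma mem_curveExterior_iff [PreconnectedSpace X] (h : IsCurveFamily ℓ δ H C γ)
    {p₀ : X} (hp₀ : IsClockwise ℓ (γ p₀)) (p : X) (x : ℂ) :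
    x ∈ curveExterior (γ p) ↔ x ∉ range (γ p) ∧ windingNumber ℓ (γ p) x = 0 := by
  refine and_congr_right fun hx => ⟨fun hb => ?_, fun hw => ?_⟩
  · by_contra h0
    exact hb (h.isBounded_connectedComponentIn h0)
  · exact h.not_isBounded_connectedComponentIn hp₀ hx hw

end IsCurveFamily

/-! ### Bounds and one-sided limits of the boundary integrals. -/

/-- The integral of `(∂_α γ)_2 / (x - γ)` over the closed curve `γ`. -/
noncomputable def imIntegral (ℓ : ℝ) (γ : ℝ → ℂ) (x : ℂ) : ℂ :=
  ∫ β in (-ℓ / 2)..(ℓ / 2), ((deriv γ β).im : ℂ) / (x - γ β)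

/-- The integral obtained from `imIntegral` by subtracting the multiple of the winding number for
which the numerator vanishes at the parameter `α`. -/
noncomputable def reducedIntegral (ℓ : ℝ) (γ : ℝ → ℂ) (α : ℝ) (x : ℂ) : ℂ :=
  ∫ u in (-ℓ / 2)..(ℓ / 2), (((deriv γ (α + u)).im : ℂ) -
    (deriv γ α).im / deriv γ α * deriv γ (α + u)) / (x - γ (α + u))

lemma norm_im_div_le_one (w : ℂ) : ‖(w.im : ℂ) / w‖ ≤ 1 := by
  rw [norm_div, Complex.norm_real]
  exact div_le_one_of_le₀ (Complex.abs_im_le_norm w) (norm_nonneg _)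

lemma intervalIntegrable_abs_rpow {r : ℝ} (hr : -1 < r) (a b : ℝ) :
    IntervalIntegrable (fun u : ℝ => |u| ^ r) volume a b := by
  have := (intervalIntegral.intervalIntegrable_cpow' (a := a) (b := b) (r := (r : ℂ))
    (by simpa using hr)).norm
  refine this.congr fun u _ => ?_
  simp only [Complex.norm_cpow_real, Complex.norm_real, Real.norm_eq_abs]

namespace IsCurveFamily

variable {X : Type*} [TopologicalSpace X] {ℓ δ H C : ℝ} {γ : X → ℝ → ℂ}

/-- The singular part of the integral is a multiple of the winding number. The identity holds for
every `α`; choosing the nearest parameter makes the remaining integral harmless. -/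
lemma imIntegral_eq (h : IsCurveFamily ℓ δ H C γ) {p : X} {x : ℂ} (hx : x ∉ range (γ p)) (α : ℝ) :
    imIntegral ℓ (γ p) x = -(2 * Real.pi * Complex.I) * windingNumber ℓ (γ p) x *
      ((deriv (γ p) α).im / deriv (γ p) α) + reducedIntegral ℓ (γ p) α x := by
  set κ : ℂ := (deriv (γ p) α).im / deriv (γ p) α with hκ
  have hne : ∀ β, x - γ p β ≠ 0 := fun β h0 => hx ⟨β, (sub_eq_zero.1 h0).symm⟩
  have hd := h.continuous_deriv_apply p
  have hi : Continuous (fun β => ((deriv (γ p) β).im : ℂ) / (x - γ p β)) :=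
    (Complex.continuous_ofReal.comp (Complex.continuous_im.comp hd)).div
      (continuous_const.sub (h.continuous p)) hne
  have hi' : Continuous (fun β => deriv (γ p) β / (x - γ p β)) :=
    hd.div (continuous_const.sub (h.continuous p)) hne
  have hred : reducedIntegral ℓ (γ p) α x = ∫ β in (-ℓ / 2)..(ℓ / 2),
      (((deriv (γ p) β).im : ℂ) - κ * deriv (γ p) β) / (x - γ p β) := by
    have hper : Function.Periodic (fun β => (((deriv (γ p) β).im : ℂ) - κ * deriv (γ p) β) /
        (x - γ p β)) ℓ := fun β => by
      simp only [h.periodic p β, periodic_deriv (h.periodic p) β]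
    have e := hper.intervalIntegral_add_eq (α + -ℓ / 2) (-ℓ / 2)
    rw [show α + -ℓ / 2 + ℓ = α + ℓ / 2 by ring, show -ℓ / 2 + ℓ = ℓ / 2 by ring] at e
    rw [← e, reducedIntegral, ← intervalIntegral.integral_comp_add_left]
  have hsplit : (fun β => (((deriv (γ p) β).im : ℂ) - κ * deriv (γ p) β) / (x - γ p β)) =
      fun β => ((deriv (γ p) β).im : ℂ) / (x - γ p β) - κ * (deriv (γ p) β / (x - γ p β)) := by
    ext β; ring
  rw [hred, hsplit, intervalIntegral.integral_sub (hi.intervalIntegrable _ _)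
    ((hi'.const_mul κ).intervalIntegrable _ _), intervalIntegral.integral_const_mul,
    windingNumber_eq, imIntegral]
  have := Complex.two_pi_I_ne_zero
  field_simp
  ring

/-- The numerator is zero at `u = 0`, so `γ'` may be replaced by its increment in both terms, and
the factor `Im γ' / γ'` has norm at most `1`. -/
lemma norm_numerator_le (h : IsCurveFamily ℓ δ H C γ) (p : X) (α u : ℝ) :
    ‖((deriv (γ p) (α + u)).im : ℂ) - (deriv (γ p) α).im / deriv (γ p) α * deriv (γ p) (α + u)‖
      ≤ 2 * H * |u| ^ δ := by
  have h0 := h.deriv_ne_zero p α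
  have hh := h.holder p (α + u) α
  rw [add_sub_cancel_left] at hh
  have e : ((deriv (γ p) (α + u)).im : ℂ) -
      (deriv (γ p) α).im / deriv (γ p) α * deriv (γ p) (α + u)
      = ((deriv (γ p) (α + u) - deriv (γ p) α).im : ℂ) -
        (deriv (γ p) α).im / deriv (γ p) α * (deriv (γ p) (α + u) - deriv (γ p) α) := by
    rw [mul_sub, div_mul_cancel₀ _ h0, Complex.sub_im]
    push_cast; ring
  rw [e]
  refine (norm_sub_le _ _).trans ?_
  have h1 : ‖((deriv (γ p) (α + u) - deriv (γ p) α).im : ℂ)‖ ≤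
      ‖deriv (γ p) (α + u) - deriv (γ p) α‖ := by
    rw [Complex.norm_real]; exact Complex.abs_im_le_norm _
  have h2 : ‖(deriv (γ p) α).im / deriv (γ p) α * (deriv (γ p) (α + u) - deriv (γ p) α)‖ ≤
      ‖deriv (γ p) (α + u) - deriv (γ p) α‖ := by
    rw [norm_mul]
    exact mul_le_of_le_one_left (norm_nonneg _) (norm_im_div_le_one _)
  linarith

lemma norm_reduced_integrand_le (h : IsCurveFamily ℓ δ H C γ) {p : X} {x : ℂ} {α u : ℝ}
    (hα : IsNearest (γ p) x α) (hu : |u| ≤ ℓ / 2) :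
    ‖(((deriv (γ p) (α + u)).im : ℂ) - (deriv (γ p) α).im / deriv (γ p) α * deriv (γ p) (α + u)) /
      (x - γ p (α + u))‖ ≤ 4 * H * C * |u| ^ (δ - 1) := by
  have hH := h.bound_pos
  have hC := h.chord_pos
  have h1 := h.norm_numerator_le p α u
  rcases eq_or_ne u 0 with rfl | hu0
  · rw [abs_zero, Real.zero_rpow h.exponent_pos.ne', mul_zero] at h1
    rw [norm_div, le_antisymm h1 (norm_nonneg _), zero_div]
    positivity
  have hua : 0 < |u| := abs_pos.2 hu0
  have h2 := h.le_of_isNearest hα hu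
  have h3 : |u| / (2 * C) ≤ ‖x - γ p (α + u)‖ := by
    rw [div_le_iff₀ (by positivity), mul_comm]; exact h2
  rw [norm_div]
  calc _ ≤ 2 * H * |u| ^ δ / (|u| / (2 * C)) := by gcongr
    _ = 4 * H * C * |u| ^ (δ - 1) := by
      rw [Real.rpow_sub hua, Real.rpow_one]; field_simp; ring

lemma abs_le_of_mem_uIoc (hℓ : 0 < ℓ) {u : ℝ} (hu : u ∈ uIoc (-ℓ / 2) (ℓ / 2)) :
    |u| ≤ ℓ / 2 := by
  rw [uIoc_of_le (by linarith)] at hu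
  rw [abs_le]; constructor <;> linarith [hu.1, hu.2]

/-- The integral `imIntegral` is bounded off the curves, uniformly in the family. -/
lemma exists_norm_imIntegral_le [PreconnectedSpace X] (h : IsCurveFamily ℓ δ H C γ)
    {p₀ : X} (hp₀ : IsClockwise ℓ (γ p₀)) :
    ∃ M, ∀ p x, x ∉ range (γ p) → ‖imIntegral ℓ (γ p) x‖ ≤ M := by
  refine ⟨2 * Real.pi + ∫ u in (-ℓ / 2)..(ℓ / 2), 4 * H * C * |u| ^ (δ - 1), fun p x hx => ?_⟩
  obtain ⟨α, -, hα⟩ := h.exists_isNearest p x 0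
  rw [h.imIntegral_eq hx α]
  refine (norm_add_le _ _).trans (add_le_add ?_ ?_)
  · have h1 := norm_im_div_le_one (deriv (γ p) α)
    have h2 : ‖windingNumber ℓ (γ p) x‖ ≤ 1 := by
      rcases h.windingNumber_eq_zero_or hp₀ hx with hw | hw <;> rw [hw] <;> simp
    rw [norm_mul, norm_mul, norm_neg]
    have h3 : ‖(2 * Real.pi * Complex.I : ℂ)‖ = 2 * Real.pi := by
      simp [Real.pi_pos.le]
    rw [h3]
    have := Real.pi_pos
    calc 2 * Real.pi * ‖windingNumber ℓ (γ p) x‖ * _ ≤ 2 * Real.pi * 1 * 1 := by gcongr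
      _ = _ := by ring
  · have hle : -ℓ / 2 ≤ ℓ / 2 := by linarith [h.length_pos]
    refine intervalIntegral.norm_integral_le_of_norm_le hle (ae_of_all _ fun u hu => ?_) ?_
    · rw [← uIoc_of_le hle] at hu
      exact h.norm_reduced_integrand_le hα (abs_le_of_mem_uIoc h.length_pos hu)
    · exact (intervalIntegrable_abs_rpow (by linarith [h.exponent_pos]) _ _).const_mul _

/-- The integral `imIntegral` has limits at the points of the curves, jointly in the parameter of
the family and the point, along sets on which the winding number is constant. -/
lemma exists_tendsto_imIntegral [FirstCountableTopology X] (h : IsCurveFamily ℓ δ H C γ)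
    {W : Set (X × ℂ)} {n : ℂ}
    (hW : ∀ q ∈ W, q.2 ∉ range (γ q.1) ∧ windingNumber ℓ (γ q.1) q.2 = n) (p₀ : X) (x₀ : ℂ) :
    ∃ L, Tendsto (fun q : X × ℂ => imIntegral ℓ (γ q.1) q.2) (𝓝[W] (p₀, x₀)) (𝓝 L) := by
  -- Off the curve the integral is continuous and the limit is its value.
  by_cases hx₀ : x₀ ∉ range (γ p₀)
  · refine ⟨_, (h.continuousOn_cauchyIntegral (a := fun p β => ((deriv (γ p) β).im : ℂ))
      (Complex.continuous_ofReal.comp (Complex.continuous_im.comp h.continuous_deriv))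
      (-ℓ / 2) (ℓ / 2) (p₀, x₀) hx₀).mono_left (nhdsWithin_mono _ fun q hq => (hW q hq).1)⟩
  rw [not_not] at hx₀
  obtain ⟨α₀, rfl⟩ := hx₀
  have hC := h.chord_pos
  -- Nearest parameters are chosen within half a period of `α₀`, so that the chord-arc bound forces
  -- them to converge to `α₀`.
  choose A hA hnear using fun q : X × ℂ => h.exists_isNearest q.1 q.2 α₀
  have hd : Tendsto (fun q : X × ℂ => ‖q.2 - γ q.1 α₀‖) (𝓝[W] (p₀, γ p₀ α₀)) (𝓝 0) := by
    have hc : Continuous (fun q : X × ℂ => ‖q.2 - γ q.1 α₀‖) :=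
      (continuous_snd.sub (h.continuous_uncurry.comp
        (continuous_fst.prodMk continuous_const))).norm
    have := hc.tendsto (p₀, γ p₀ α₀)
    simp only [sub_self, norm_zero] at this
    exact this.mono_left nhdsWithin_le_nhds
  have hAlim : Tendsto A (𝓝[W] (p₀, γ p₀ α₀)) (𝓝 α₀) := by
    rw [tendsto_iff_norm_sub_tendsto_zero]
    refine squeeze_zero (fun _ => norm_nonneg _) (fun q => ?_)
      (by simpa using hd.const_mul (2 * C))
    have h1 := h.chord q.1 α₀ (A q - α₀) (hA q)
    rw [add_sub_cancel] at h1
    refine h1.trans ?_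
    rw [mul_comm 2 C, mul_assoc]
    gcongr
    calc ‖γ q.1 (A q) - γ q.1 α₀‖ = ‖(q.2 - γ q.1 α₀) - (q.2 - γ q.1 (A q))‖ := by ring_nf
      _ ≤ ‖q.2 - γ q.1 α₀‖ + ‖q.2 - γ q.1 (A q)‖ := norm_sub_le _ _
      _ ≤ _ := by linarith [hnear q α₀]
  have hfst : Tendsto (fun q : X × ℂ => q.1) (𝓝[W] (p₀, γ p₀ α₀)) (𝓝 p₀) :=
    (continuous_fst.tendsto (p₀, γ p₀ α₀)).mono_left nhdsWithin_le_nhds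
  have hsnd : Tendsto (fun q : X × ℂ => q.2) (𝓝[W] (p₀, γ p₀ α₀)) (𝓝 (γ p₀ α₀)) :=
    (continuous_snd.tendsto (p₀, γ p₀ α₀)).mono_left nhdsWithin_le_nhds
  have hderiv : ∀ u : ℝ, Tendsto (fun q : X × ℂ => deriv (γ q.1) (A q + u))
      (𝓝[W] (p₀, γ p₀ α₀)) (𝓝 (deriv (γ p₀) (α₀ + u))) := fun u =>
    (h.continuous_deriv.tendsto (p₀, α₀ + u)).comp (hfst.prodMk_nhds (hAlim.add_const u))
  have him : ∀ {f : X × ℂ → ℂ} {a : ℂ}, Tendsto f (𝓝[W] (p₀, γ p₀ α₀)) (𝓝 a) →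
      Tendsto (fun q => ((f q).im : ℂ)) (𝓝[W] (p₀, γ p₀ α₀)) (𝓝 (a.im : ℂ)) := fun {f a} hf =>
    ((Complex.continuous_ofReal.comp Complex.continuous_im).tendsto a).comp hf
  have hκ : Tendsto (fun q : X × ℂ => ((deriv (γ q.1) (A q)).im : ℂ) / deriv (γ q.1) (A q))
      (𝓝[W] (p₀, γ p₀ α₀)) (𝓝 ((deriv (γ p₀) α₀).im / deriv (γ p₀) α₀)) := by
    have := hderiv 0
    simp only [add_zero] at this
    exact (him this).div this (h.deriv_ne_zero p₀ α₀)
  have hred : Tendsto (fun q : X × ℂ => reducedIntegral ℓ (γ q.1) (A q) q.2)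
      (𝓝[W] (p₀, γ p₀ α₀)) (𝓝 (reducedIntegral ℓ (γ p₀) α₀ (γ p₀ α₀))) := by
    refine intervalIntegral.tendsto_integral_filter_of_dominated_convergence
      (fun u => 4 * H * C * |u| ^ (δ - 1)) ?_ ?_
      ((intervalIntegrable_abs_rpow (by linarith [h.exponent_pos]) _ _).const_mul _) ?_
    · refine Eventually.of_forall fun q => ?_
      have hm1 : Measurable (fun u => γ q.1 (A q + u)) :=
        (h.continuous q.1).measurable.comp (by fun_prop)
      have hm2 : Measurable (fun u => deriv (γ q.1) (A q + u)) :=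
        (h.continuous_deriv_apply q.1).measurable.comp (by fun_prop)
      exact Measurable.aestronglyMeasurable
        (((Complex.measurable_ofReal.comp (Complex.measurable_im.comp hm2)).sub
          (hm2.const_mul _)).div (measurable_const.sub hm1))
    · exact Eventually.of_forall fun q => ae_of_all _ fun u hu =>
        h.norm_reduced_integrand_le (hnear q) (abs_le_of_mem_uIoc h.length_pos hu)
    · have hne0 : ∀ᵐ u : ℝ, u ≠ 0 := by
        rw [ae_iff]; simp
      filter_upwards [hne0] with u hu0 hu
      refine ((him (hderiv u)).sub (hκ.mul (hderiv u))).div (hsnd.sub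
        ((h.continuous_uncurry.tendsto (p₀, α₀ + u)).comp
          (hfst.prodMk_nhds (hAlim.add_const u)))) fun h0 => ?_
      have := h.chord p₀ α₀ u (abs_le_of_mem_uIoc h.length_pos hu)
      rw [norm_sub_rev, h0, norm_zero, mul_zero] at this
      exact hu0 (abs_eq_zero.1 (le_antisymm this (abs_nonneg u)))
  refine ⟨_, Tendsto.congr' ?_
    ((hκ.const_mul (-(2 * Real.pi * Complex.I) * n)).add hred)⟩
  filter_upwards [self_mem_nhdsWithin] with q hq
  rw [h.imIntegral_eq (hW q hq).1 (A q), (hW q hq).2]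

lemma continuousOn_imIntegral (h : IsCurveFamily ℓ δ H C γ) :
    ContinuousOn (fun q : X × ℂ => imIntegral ℓ (γ q.1) q.2) {q | q.2 ∉ range (γ q.1)} :=
  h.continuousOn_cauchyIntegral (a := fun p β => ((deriv (γ p) β).im : ℂ))
    (Complex.continuous_ofReal.comp (Complex.continuous_im.comp h.continuous_deriv)) _ _

lemma tendsto_imIntegral_cocompact (h : IsCurveFamily ℓ δ H C γ) (p : X) :
    Tendsto (imIntegral ℓ (γ p)) (cocompact ℂ) (𝓝 0) :=
  h.tendsto_cauchyIntegral_cocompact p (a := fun β => ((deriv (γ p) β).im : ℂ))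
    (Complex.continuous_ofReal.comp (Complex.continuous_im.comp (h.continuous_deriv_apply p))) _ _

end IsCurveFamily

/-! ### The Cauchy kernel -/

/-- In polar coordinates the Jacobian `r` cancels the singularity. -/
lemma locallyIntegrable_inv_complex : LocallyIntegrable (fun y : ℂ => y⁻¹) volume := by
  rw [locallyIntegrable_iff]
  intro K hK
  obtain ⟨R, hR⟩ := hK.isBounded.subset_closedBall (0 : ℂ)
  refine IntegrableOn.mono_set ?_ hR
  have h1 : Integrable (fun y : ℂ => (Iic R).indicator (fun r : ℝ => r⁻¹) ‖y‖) volume := by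
    rw [integrable_fun_norm_addHaar (volume : Measure ℂ)
      (f := (Iic R).indicator (fun r : ℝ => r⁻¹)), Complex.finrank_real_complex]
    have h2 : IntegrableOn (fun _ : ℝ => (1 : ℝ)) (Ioc 0 R) volume :=
      integrableOn_const (by simp)
    have h3 : IntegrableOn ((Iic R).indicator (fun _ : ℝ => (1 : ℝ))) (Ioi 0) volume := by
      rw [IntegrableOn, integrable_indicator_iff measurableSet_Iic, IntegrableOn,
        Measure.restrict_restrict measurableSet_Iic, inter_comm, Ioi_inter_Iic]
      exact h2
    refine h3.congr_fun (fun r hr => ?_) measurableSet_Ioi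
    by_cases hrR : r ∈ Iic R
    · have : r ≠ 0 := ne_of_gt hr
      simp [indicator_of_mem hrR, this]
    · simp [indicator_of_notMem hrR]
  rw [← integrable_indicator_iff Metric.isClosed_closedBall.measurableSet]
  refine h1.mono ?_ (ae_of_all _ fun y => ?_)
  · exact (measurable_inv.indicator Metric.isClosed_closedBall.measurableSet).aestronglyMeasurable
  · by_cases hy : y ∈ Metric.closedBall (0 : ℂ) R
    · have hy' : ‖y‖ ∈ Iic R := by simpa using hy
      rw [indicator_of_mem hy, indicator_of_mem hy']
      simp
    · rw [indicator_of_notMem hy, norm_zero]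
      positivity

section Kernel

variable {ψ : ℂ → ℂ} (hψ : Continuous ψ) (hψc : HasCompactSupport ψ)
include hψ hψc

lemma integrable_mul_inv_sub (w : ℂ) : Integrable (fun x => ψ x * (x - w)⁻¹) volume := by
  have h1 : LocallyIntegrable (fun x : ℂ => (x - w)⁻¹) volume := by
    rw [locallyIntegrable_iff]
    intro K hK
    have h2 := (locallyIntegrable_iff.1 locallyIntegrable_inv_complex)
      ((fun x : ℂ => x - w) '' K) (hK.image (by fun_prop))
    exact ((measurePreserving_sub_right volume w).integrableOn_image
      (MeasurableEquiv.subRight w).measurableEmbedding).1 h2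
  have h3 := h1.integrable_smul_left_of_hasCompactSupport hψ hψc
  simpa using h3

/-- This integral is the convolution of `‖ψ‖` with the locally integrable kernel `1 / ‖y‖`. Its
continuity in `w` makes it integrable along a curve, as Fubini requires below. -/
lemma continuous_integral_norm_mul_inv_sub :
    Continuous (fun w => ∫ x, ‖ψ x * (x - w)⁻¹‖) := by
  have hloc : LocallyIntegrable (fun y : ℂ => ‖y⁻¹‖) volume := fun x =>
    (locallyIntegrable_inv_complex x).norm
  have h1 := hψc.norm.continuous_convolution_right (ContinuousLinearMap.mul ℝ ℝ) hloc hψ.norm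
  refine h1.congr fun w => ?_
  rw [convolution, ← integral_sub_left_eq_self (fun x => ‖ψ x * (x - w)⁻¹‖) volume w]
  congr 1
  ext y
  have : w - y - w = -y := by ring
  rw [this, norm_mul, inv_neg, norm_neg]
  simp [mul_comm]

lemma integrable_prod_kernel {a γ : ℝ → ℂ} (ha : Continuous a) (hγ : Continuous γ) (r s : ℝ) :
    Integrable (Function.uncurry fun (β : ℝ) (x : ℂ) => ψ x * (a β / (x - γ β)))
      ((volume.restrict (uIoc r s)).prod volume) := by
  have hm : Measurable (Function.uncurry fun (β : ℝ) (x : ℂ) => ψ x * (a β / (x - γ β))) :=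
    (hψ.measurable.comp measurable_snd).mul ((ha.measurable.comp measurable_fst).div
      (measurable_snd.sub (hγ.measurable.comp measurable_fst)))
  have e : ∀ β x, ψ x * (a β / (x - γ β)) = a β * (ψ x * (x - γ β)⁻¹) := fun β x => by
    rw [div_eq_mul_inv]; ring
  rw [integrable_prod_iff hm.aestronglyMeasurable]
  constructor
  · refine ae_of_all _ fun β => ?_
    simp only [Function.uncurry_apply_pair, e]
    exact (integrable_mul_inv_sub hψ hψc (γ β)).const_mul _
  · have h1 : Continuous (fun β => ‖a β‖ * ∫ x, ‖ψ x * (x - γ β)⁻¹‖) :=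
      ha.norm.mul ((continuous_integral_norm_mul_inv_sub hψ hψc).comp hγ)
    have h2 := (intervalIntegrable_iff.1 (h1.intervalIntegrable (μ := volume) r s))
    refine h2.congr (ae_of_all _ fun β => ?_)
    simp only [Function.uncurry_apply_pair, e, norm_mul, integral_const_mul]

lemma integrable_mul_cauchyIntegral {a γ : ℝ → ℂ} (ha : Continuous a) (hγ : Continuous γ)
    (r s : ℝ) : Integrable (fun x => ψ x * ∫ β in r..s, a β / (x - γ β)) volume := by
  have h1 := (integrable_prod_kernel hψ hψc ha hγ r s).integral_prod_right
  simp only [Function.uncurry_apply_pair, integral_const_mul] at h1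
  rcases le_total r s with hrs | hrs
  · simpa [intervalIntegral.integral_of_le hrs, uIoc_of_le hrs] using h1
  · simpa [intervalIntegral.integral_of_ge hrs, uIoc_of_ge hrs] using h1

lemma integral_mul_cauchyIntegral {a γ : ℝ → ℂ} (ha : Continuous a) (hγ : Continuous γ)
    (r s : ℝ) : ∫ x, ψ x * ∫ β in r..s, a β / (x - γ β) =
      ∫ β in r..s, a β * ∫ x, ψ x * (x - γ β)⁻¹ := by
  have h1 := intervalIntegral_integral_swap (integrable_prod_kernel hψ hψc ha hγ r s)
  simp only [intervalIntegral.integral_const_mul] at h1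
  rw [← h1]
  congr 1
  ext β
  rw [← integral_const_mul]
  congr 1
  ext x
  rw [div_eq_mul_inv]
  ring

end Kernel

/-! ### The Cauchy-Pompeiu formula -/

/-- The gradient `∂₁φ + i ∂₂φ`. -/
noncomputable def cgrad (φ : ℂ → ℝ) (x : ℂ) : ℂ :=
  (fderiv ℝ φ x 1 : ℂ) + Complex.I * (fderiv ℝ φ x Complex.I : ℂ)

section Pompeiu

variable {φ : ℂ → ℝ} (hφ : ContDiff ℝ 1 φ) (hφc : HasCompactSupport φ)
include hφ

lemma continuous_fderiv_apply_const (v : ℂ) : Continuous (fun x => fderiv ℝ φ x v) :=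
  (hφ.continuous_fderiv one_ne_zero).clm_apply continuous_const

lemma continuous_cgrad : Continuous (cgrad φ) :=
  (Complex.continuous_ofReal.comp (continuous_fderiv_apply_const hφ 1)).add
    (continuous_const.mul
      (Complex.continuous_ofReal.comp (continuous_fderiv_apply_const hφ Complex.I)))

omit hφ in
include hφc in
lemma hasCompactSupport_cgrad : HasCompactSupport (cgrad φ) :=
  (hφc.fderiv (𝕜 := ℝ)).mono fun x hx h0 => hx (by simp [cgrad, h0])

omit hφ in
include hφc in
lemma hasCompactSupport_fderiv_apply_const (v : ℂ) :
    HasCompactSupport (fun x => fderiv ℝ φ x v) :=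
  (hφc.fderiv (𝕜 := ℝ)).mono fun x hx h0 => hx (by simp [h0])

omit hφ in
-- The gradient in the rotated orthonormal frame `(e, I * e)`; with `e` the radial direction it
-- splits the Pompeiu integrand into a radial and an angular derivative.
lemma cgrad_eq_fderiv_mul (x e : ℂ) (he : ‖e‖ = 1) :
    cgrad φ x * e⁻¹ = (fderiv ℝ φ x e : ℂ) + Complex.I * (fderiv ℝ φ x (Complex.I * e) : ℂ) := by
  have h1 : fderiv ℝ φ x e = e.re * fderiv ℝ φ x 1 + e.im * fderiv ℝ φ x Complex.I := by
    have : e = e.re • (1 : ℂ) + e.im • Complex.I := by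
      simp
    conv_lhs => rw [this, map_add, map_smul, map_smul]
    simp
  have h2 : fderiv ℝ φ x (Complex.I * e)
      = -e.im * fderiv ℝ φ x 1 + e.re * fderiv ℝ φ x Complex.I := by
    have : Complex.I * e = (-e.im) • (1 : ℂ) + e.re • Complex.I := by
      apply Complex.ext <;> simp
    conv_lhs => rw [this, map_add, map_smul, map_smul]
    simp
  have h3 : e⁻¹ = (e.re : ℂ) - e.im * Complex.I := by
    rw [Complex.inv_def, Complex.normSq_eq_norm_sq, he]
    apply Complex.ext <;> simp
  rw [h1, h2, h3, cgrad]
  push_cast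
  linear_combination -(fderiv ℝ φ x Complex.I : ℂ) * e.im * Complex.I_sq

include hφc in
lemma integral_Ioi_fderiv_ray (w e : ℂ) (he : ‖e‖ = 1) :
    ∫ r in Ioi (0 : ℝ), fderiv ℝ φ (w - r * e) e = φ w := by
  obtain ⟨R, hR0, hR⟩ : ∃ R > 0, ∀ r : ℝ, R ≤ r → w - r * e ∉ tsupport φ := by
    obtain ⟨M, hM⟩ := hφc.isBounded.exists_norm_le
    refine ⟨|M| + ‖w‖ + 1, by positivity, fun r hr hmem => ?_⟩
    have h1 := hM _ hmem
    have h2 : ‖(r : ℂ) * e‖ ≤ ‖w - r * e‖ + ‖w‖ := by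
      calc ‖(r : ℂ) * e‖ = ‖w - (w - r * e)‖ := by ring_nf
        _ ≤ ‖w‖ + ‖w - r * e‖ := norm_sub_le _ _
        _ = _ := add_comm _ _
    rw [norm_mul, he, mul_one, Complex.norm_real] at h2
    have := le_abs_self M
    have := Real.le_norm_self r
    linarith
  have hd : ∀ r : ℝ, HasDerivAt (fun r : ℝ => φ (w - r * e)) (-fderiv ℝ φ (w - r * e) e) r := by
    intro r
    have h1 : HasDerivAt (fun r : ℝ => w - (r : ℂ) * e) (-e) r := by
      simpa using ((Complex.ofRealCLM.hasDerivAt (x := r)).mul_const e).const_sub w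
    have h2 := ((hφ.differentiable one_ne_zero) (w - r * e)).hasFDerivAt.comp_hasDerivAt r h1
    rw [map_neg] at h2
    exact h2
  have hc : Continuous (fun r : ℝ => fderiv ℝ φ (w - r * e) e) :=
    (continuous_fderiv_apply_const hφ e).comp (by fun_prop)
  have hzero : ∀ r ∈ Ioi (0 : ℝ) \ Ioc 0 R, fderiv ℝ φ (w - r * e) e = 0 := by
    intro r hr
    have : R ≤ r := by
      by_contra hlt
      exact hr.2 ⟨hr.1, (not_le.1 hlt).le⟩
    have h0 : fderiv ℝ φ (w - r * e) = 0 := by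
      by_contra hne
      exact hR r this (support_fderiv_subset ℝ hne)
    rw [h0]; rfl
  rw [setIntegral_eq_of_subset_of_forall_sdiff_eq_zero measurableSet_Ioi Ioc_subset_Ioi_self hzero,
    ← intervalIntegral.integral_of_le hR0.le]
  have h3 := intervalIntegral.integral_eq_sub_of_hasDerivAt (a := 0) (b := R) (fun r _ => hd r)
    (hc.neg.intervalIntegrable _ _)
  rw [intervalIntegral.integral_neg] at h3
  have h4 : φ (w - R * e) = 0 := image_eq_zero_of_notMem_tsupport (hR R le_rfl)
  simp only [h4, Complex.ofReal_zero, zero_mul, sub_zero, zero_sub, neg_inj] at h3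
  exact h3

lemma integral_fderiv_circle (w : ℂ) {r : ℝ} (hr : 0 < r) :
    ∫ θ in Ioo (-Real.pi) Real.pi, fderiv ℝ φ (w - r * Complex.exp (θ * Complex.I))
      (Complex.I * Complex.exp (θ * Complex.I)) = 0 := by
  have hd : ∀ θ : ℝ, HasDerivAt (fun θ : ℝ => φ (w - r * Complex.exp (θ * Complex.I)))
      (-r * fderiv ℝ φ (w - r * Complex.exp (θ * Complex.I))
        (Complex.I * Complex.exp (θ * Complex.I))) θ := by
    intro θ
    have h0 : HasDerivAt (fun θ : ℝ => (θ : ℂ) * Complex.I) Complex.I θ := by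
      simpa using (Complex.ofRealCLM.hasDerivAt (x := θ)).mul_const Complex.I
    have h1 : HasDerivAt (fun θ : ℝ => w - r * Complex.exp (θ * Complex.I))
        ((-r) • (Complex.I * Complex.exp (θ * Complex.I))) θ := by
      refine ((h0.cexp.const_mul (r : ℂ)).const_sub w).congr_deriv ?_
      rw [Complex.real_smul]; push_cast; ring
    have h2 := ((hφ.differentiable one_ne_zero) (w - r * Complex.exp (θ * Complex.I))
      ).hasFDerivAt.comp_hasDerivAt θ h1
    rw [map_smul, smul_eq_mul] at h2
    exact h2
  have hc : Continuous (fun θ : ℝ => fderiv ℝ φ (w - r * Complex.exp (θ * Complex.I))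
      (Complex.I * Complex.exp (θ * Complex.I))) :=
    ((hφ.continuous_fderiv one_ne_zero).comp (by fun_prop)).clm_apply (by fun_prop)
  rw [← integral_Ioc_eq_integral_Ioo,
    ← intervalIntegral.integral_of_le (by linarith [Real.pi_pos])]
  have h3 := intervalIntegral.integral_eq_sub_of_hasDerivAt (a := -Real.pi) (b := Real.pi)
    (fun θ _ => hd θ) ((continuous_const.mul hc).intervalIntegrable _ _)
  rw [intervalIntegral.integral_const_mul] at h3
  have h4 : Complex.exp ((-Real.pi : ℝ) * Complex.I) = Complex.exp (Real.pi * Complex.I) := by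
    push_cast
    rw [neg_mul, Complex.exp_neg, Complex.exp_pi_mul_I]; norm_num
  rw [h4, sub_self] at h3
  exact (mul_eq_zero.1 h3).resolve_left (neg_ne_zero.2 hr.ne')

include hφc in
lemma integrableOn_polar (w : ℂ) {v : ℝ → ℂ} (hv : Continuous v) :
    IntegrableOn (fun q : ℝ × ℝ => fderiv ℝ φ (w - q.1 * Complex.exp (q.2 * Complex.I)) (v q.2))
      (Ioi 0 ×ˢ Ioo (-Real.pi) Real.pi) volume := by
  obtain ⟨M, hM⟩ := hφc.isBounded.exists_norm_le
  set R := |M| + ‖w‖ with hR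
  have hc : Continuous (fun q : ℝ × ℝ =>
      fderiv ℝ φ (w - q.1 * Complex.exp (q.2 * Complex.I)) (v q.2)) :=
    ((hφ.continuous_fderiv one_ne_zero).comp (by fun_prop)).clm_apply (hv.comp continuous_snd)
  have h1 : IntegrableOn (fun q : ℝ × ℝ =>
      fderiv ℝ φ (w - q.1 * Complex.exp (q.2 * Complex.I)) (v q.2))
      (Icc 0 R ×ˢ Icc (-Real.pi) Real.pi) volume :=
    hc.continuousOn.integrableOn_compact (isCompact_Icc.prod isCompact_Icc)
  refine h1.of_forall_sdiff_eq_zero (measurableSet_Ioi.prod measurableSet_Ioo) ?_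
  rintro ⟨r, θ⟩ ⟨⟨hr, hθ⟩, hn⟩
  have hr0 : (0 : ℝ) < r := hr
  have hrR : R < r := by
    by_contra hle
    exact hn ⟨⟨hr0.le, not_lt.1 hle⟩, Ioo_subset_Icc_self hθ⟩
  have h0 : fderiv ℝ φ (w - r * Complex.exp (θ * Complex.I)) = 0 := by
    by_contra hne
    have h2 := hM _ (support_fderiv_subset ℝ hne)
    have h3 : ‖(r : ℂ) * Complex.exp (θ * Complex.I)‖ ≤
        ‖w - r * Complex.exp (θ * Complex.I)‖ + ‖w‖ := by
      calc ‖(r : ℂ) * Complex.exp (θ * Complex.I)‖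
          = ‖w - (w - r * Complex.exp (θ * Complex.I))‖ := by ring_nf
        _ ≤ ‖w‖ + ‖w - r * Complex.exp (θ * Complex.I)‖ := norm_sub_le _ _
        _ = _ := add_comm _ _
    rw [norm_mul, Complex.norm_exp_ofReal_mul_I, mul_one, Complex.norm_real,
      Real.norm_of_nonneg hr0.le] at h3
    have := le_abs_self M
    linarith
  dsimp only
  rw [h0]; rfl

include hφc in
/-- The Cauchy-Pompeiu formula for compactly supported functions. -/
lemma integral_cgrad_mul_inv_sub (w : ℂ) :
    ∫ x, cgrad φ x * (x - w)⁻¹ = -(2 * Real.pi) * φ w := by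
  have h1 : ∫ x, cgrad φ x * (x - w)⁻¹ = -∫ y, cgrad φ (w - y) * y⁻¹ := by
    rw [← integral_sub_left_eq_self (fun x => cgrad φ x * (x - w)⁻¹) volume w, ← integral_neg]
    congr 1
    ext y
    have : w - y - w = -y := by ring
    rw [this, inv_neg, mul_neg]
  rw [h1, ← Complex.integral_comp_polarCoord_symm]
  have hA := integrableOn_polar hφ hφc w (v := fun θ => Complex.exp (θ * Complex.I)) (by fun_prop)
  have hB := integrableOn_polar hφ hφc w
    (v := fun θ => Complex.I * Complex.exp (θ * Complex.I)) (by fun_prop)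
  have htarget : polarCoord.target = Ioi (0 : ℝ) ×ˢ Ioo (-Real.pi) Real.pi := rfl
  rw [htarget]
  -- The Jacobian cancels the modulus of the kernel, and only its phase, which rotates the frame, is
  -- left.
  have h2 : ∀ q ∈ Ioi (0 : ℝ) ×ˢ Ioo (-Real.pi) Real.pi,
      q.1 • (cgrad φ (w - Complex.polarCoord.symm q) * (Complex.polarCoord.symm q)⁻¹) =
      ((fderiv ℝ φ (w - q.1 * Complex.exp (q.2 * Complex.I))
        (Complex.exp (q.2 * Complex.I)) : ℝ) : ℂ) +
      Complex.I * ((fderiv ℝ φ (w - q.1 * Complex.exp (q.2 * Complex.I))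
        (Complex.I * Complex.exp (q.2 * Complex.I)) : ℝ) : ℂ) := by
    rintro ⟨r, θ⟩ ⟨hr, -⟩
    have hr0 : (r : ℂ) ≠ 0 := by exact_mod_cast (ne_of_gt hr)
    have e : Complex.polarCoord.symm (r, θ) = r * Complex.exp (θ * Complex.I) := by
      rw [Complex.polarCoord_symm_apply, Complex.exp_mul_I]; push_cast; ring
    rw [e, ← cgrad_eq_fderiv_mul _ _ (Complex.norm_exp_ofReal_mul_I θ), Complex.real_smul,
      mul_inv]
    field_simp
  rw [setIntegral_congr_fun (measurableSet_Ioi.prod measurableSet_Ioo) h2,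
    integral_add hA.ofReal (hB.ofReal.const_mul _), integral_const_mul, integral_complex_ofReal,
    integral_complex_ofReal]
  -- Radial part: integrating first along each ray yields `φ w`, then the angles contribute `2π`.
  have eA : ∫ q in Ioi (0 : ℝ) ×ˢ Ioo (-Real.pi) Real.pi,
      fderiv ℝ φ (w - q.1 * Complex.exp (q.2 * Complex.I)) (Complex.exp (q.2 * Complex.I))
      = 2 * Real.pi * φ w := by
    rw [Measure.volume_eq_prod] at hA ⊢
    refine (setIntegral_prod_swap _ _ _).symm.trans ((setIntegral_prod _ hA.swap).trans ?_)
    simp only [Function.comp_apply, Prod.swap_prod_mk]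
    simp_rw [integral_Ioi_fderiv_ray hφ hφc w _ (Complex.norm_exp_ofReal_mul_I _)]
    rw [setIntegral_const, measureReal_def, Real.volume_Ioo, ENNReal.toReal_ofReal
      (by linarith [Real.pi_pos]), smul_eq_mul]
    ring
  -- Angular part: on each circle this is, up to the radius, the derivative of a periodic function
  -- of the angle.
  have eB : ∫ q in Ioi (0 : ℝ) ×ˢ Ioo (-Real.pi) Real.pi,
      fderiv ℝ φ (w - q.1 * Complex.exp (q.2 * Complex.I))
        (Complex.I * Complex.exp (q.2 * Complex.I)) = 0 := by
    rw [Measure.volume_eq_prod] at hB ⊢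
    rw [setIntegral_prod _ hB]
    rw [setIntegral_congr_fun measurableSet_Ioi
      (fun r hr => integral_fderiv_circle hφ w (show (0 : ℝ) < r from hr))]
    simp
  rw [eA, eB]
  push_cast
  ring

end Pompeiu


/-! ### A Green formula for Cauchy transforms along a closed curve. -/

section Potential

variable {φ : ℂ → ℝ} (hφ : ContDiff ℝ 1 φ) (hφc : HasCompactSupport φ)
include hφ hφc

/-- Take for `F` the convolution of `φ` with `1 / y` and let the derivative fall on `φ`. -/
lemma exists_potential : ∃ F : ℂ → ℂ, ContDiff ℝ 1 F ∧
    ∀ w v, fderiv ℝ F w v = -∫ x, (fderiv ℝ φ x v : ℂ) * (x - w)⁻¹ := by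
  set L : ℂ →L[ℝ] ℝ →L[ℝ] ℂ := (ContinuousLinearMap.lsmul ℝ ℝ : ℝ →L[ℝ] ℂ →L[ℝ] ℂ).flip with hL
  refine ⟨convolution (fun y : ℂ => y⁻¹) φ L volume,
    hφc.contDiff_convolution_right L locallyIntegrable_inv_complex hφ, fun w v => ?_⟩
  rw [(hφc.hasFDerivAt_convolution_right L locallyIntegrable_inv_complex hφ w).fderiv,
    convolution_precompR_apply L locallyIntegrable_inv_complex (hφc.fderiv (𝕜 := ℝ))
      (hφ.continuous_fderiv one_ne_zero), convolution,
    ← integral_sub_left_eq_self (fun x => (fderiv ℝ φ x v : ℂ) * (x - w)⁻¹) volume w,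
    ← integral_neg]
  congr 1
  ext y
  have : w - y - w = -y := by ring
  rw [this, inv_neg, mul_neg, neg_neg]
  simp [hL]

lemma integral_fderiv_apply_eq_zero (v : ℂ) : ∫ x, fderiv ℝ φ x v = 0 := by
  have hi : Integrable (fun x => fderiv ℝ φ x v) volume :=
    (continuous_fderiv_apply_const hφ v).integrable_of_hasCompactSupport
      (hasCompactSupport_fderiv_apply_const hφc v)
  have := integral_bilinear_hasLineDerivAt_right_eq_neg_left_of_integrable (μ := volume)
    (B := ContinuousLinearMap.mul ℝ ℝ) (f := fun _ : ℂ => (1 : ℝ)) (f' := fun _ => 0) (g := φ)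
    (g' := fun x => fderiv ℝ φ x v) (v := v) (by simp) (by simpa using hi)
    (by simpa using hφ.continuous.integrable_of_hasCompactSupport hφc)
    (fun x _ => (hasFDerivAt_const (1 : ℝ) x).hasLineDerivAt v)
    (fun x _ => ((hφ.differentiable one_ne_zero) x).hasFDerivAt.hasLineDerivAt v)
  simpa using this

/-- Green's theorem for the Cauchy transform of `∂₁φ` along a closed curve. -/
lemma integral_deriv_mul_cauchyTransform {ℓ : ℝ} {γ : ℝ → ℂ} (hγ : Differentiable ℝ γ)
    (hγ' : Continuous (deriv γ)) (hper : Function.Periodic γ ℓ) :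
    ∫ β in (-ℓ / 2)..(ℓ / 2), deriv γ β * ∫ x, (fderiv ℝ φ x 1 : ℂ) * (x - γ β)⁻¹ =
      -(2 * Real.pi * Complex.I) *
        ((∫ β in (-ℓ / 2)..(ℓ / 2), (deriv γ β).im * φ (γ β) : ℝ) : ℂ) := by
  obtain ⟨F, hF, hF'⟩ := exists_potential hφ hφc
  have hd : ∀ β, HasDerivAt (fun β => F (γ β)) (fderiv ℝ F (γ β) (deriv γ β)) β := fun β =>
    ((hF.differentiable one_ne_zero) (γ β)).hasFDerivAt.comp_hasDerivAt β (hγ β).hasDerivAt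
  have hc : Continuous (fun β => fderiv ℝ F (γ β) (deriv γ β)) :=
    ((hF.continuous_fderiv one_ne_zero).comp hγ.continuous).clm_apply hγ'
  have h0 := intervalIntegral.integral_eq_sub_of_hasDerivAt (a := -ℓ / 2) (b := ℓ / 2)
    (fun β _ => hd β) (hc.intervalIntegrable _ _)
  have hend : γ (ℓ / 2) = γ (-ℓ / 2) := by
    rw [← hper (-ℓ / 2)]; congr 1; ring
  rw [hend, sub_self] at h0
  -- The Cauchy-Pompeiu formula expresses the transform of `∂₂φ` through that of `∂₁φ` and the value
  -- of `φ`.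
  have hpomp : ∀ w, ∫ x, (fderiv ℝ φ x Complex.I : ℂ) * (x - w)⁻¹ =
      Complex.I * ((∫ x, (fderiv ℝ φ x 1 : ℂ) * (x - w)⁻¹) + 2 * Real.pi * φ w) := by
    intro w
    have h1 := integral_cgrad_mul_inv_sub hφ hφc w
    have hi : ∀ v : ℂ, Integrable (fun x => (fderiv ℝ φ x v : ℂ) * (x - w)⁻¹) volume := fun v =>
      integrable_mul_inv_sub
        (Complex.continuous_ofReal.comp (continuous_fderiv_apply_const hφ v))
        ((hasCompactSupport_fderiv_apply_const hφc v).comp_left Complex.ofReal_zero) w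
    have h2 : (fun x => cgrad φ x * (x - w)⁻¹) = fun x => (fderiv ℝ φ x 1 : ℂ) * (x - w)⁻¹ +
        Complex.I * ((fderiv ℝ φ x Complex.I : ℂ) * (x - w)⁻¹) := by
      ext x; rw [cgrad]; ring
    rw [h2, integral_add (hi 1) ((hi Complex.I).const_mul _), integral_const_mul] at h1
    linear_combination (-Complex.I) * h1 +
      (∫ x, (fderiv ℝ φ x Complex.I : ℂ) * (x - w)⁻¹) * Complex.I_sq
  -- So the derivative of `F ∘ γ`, whose integral over a period is zero, is `-γ'` times the
  -- transform of `∂₁φ`, minus `2πi Im γ' φ(γ)`.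
  have hlin : ∀ β, fderiv ℝ F (γ β) (deriv γ β) =
      -(deriv γ β * ∫ x, (fderiv ℝ φ x 1 : ℂ) * (x - γ β)⁻¹) -
        2 * Real.pi * Complex.I * (((deriv γ β).im * φ (γ β) : ℝ) : ℂ) := by
    intro β
    have e : deriv γ β = (deriv γ β).re • (1 : ℂ) + (deriv γ β).im • Complex.I := by simp
    have e' : deriv γ β = (deriv γ β).re + (deriv γ β).im * Complex.I :=
      (Complex.re_add_im _).symm
    conv_lhs => rw [e, map_add, map_smul, map_smul, hF', hF', hpomp]
    conv_rhs => rw [e']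
    simp only [Complex.real_smul, Complex.add_im, Complex.ofReal_im, Complex.mul_im,
      Complex.ofReal_re, Complex.I_im, Complex.I_re, mul_one, mul_zero, add_zero, zero_add]
    push_cast
    ring
  have hi2 : Continuous (fun β => (((deriv γ β).im * φ (γ β) : ℝ) : ℂ)) :=
    Complex.continuous_ofReal.comp ((Complex.continuous_im.comp hγ').mul
      (hφ.continuous.comp hγ.continuous))
  have hi1 : Continuous (fun β => deriv γ β * ∫ x, (fderiv ℝ φ x 1 : ℂ) * (x - γ β)⁻¹) := by
    have : (fun β => deriv γ β * ∫ x, (fderiv ℝ φ x 1 : ℂ) * (x - γ β)⁻¹) = fun β =>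
        -fderiv ℝ F (γ β) (deriv γ β) -
        2 * Real.pi * Complex.I * (((deriv γ β).im * φ (γ β) : ℝ) : ℂ) := by
      ext β; rw [hlin]; ring
    rw [this]
    exact hc.neg.sub (continuous_const.mul hi2)
  simp_rw [hlin] at h0
  have i1 : IntervalIntegrable (fun β => -(deriv γ β * ∫ x, (fderiv ℝ φ x 1 : ℂ) * (x - γ β)⁻¹))
      volume (-ℓ / 2) (ℓ / 2) := hi1.neg.intervalIntegrable _ _
  have i2 : IntervalIntegrable (fun β => 2 * Real.pi * Complex.I *
      (((deriv γ β).im * φ (γ β) : ℝ) : ℂ)) volume (-ℓ / 2) (ℓ / 2) :=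
    (hi2.intervalIntegrable _ _).const_mul _
  rw [intervalIntegral.integral_sub i1 i2, intervalIntegral.integral_neg,
    intervalIntegral.integral_const_mul, intervalIntegral.integral_ofReal] at h0
  linear_combination -h0

end Potential

/-! ### The velocity of two curves tested against gradients. -/

/-- The velocity induced by the two curves with parameters `p` and `m`. -/
noncomputable def pairVelocity {X : Type*} (ℓ : ℝ) (γ : X → ℝ → ℂ) (p m : X) (x : ℂ) : ℂ :=
  (starRingEnd ℂ) (-(2 * Real.pi * Complex.I)⁻¹ *
    (imIntegral ℓ (γ p) x + imIntegral ℓ (γ m) x))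

namespace IsCurveFamily

variable {X : Type*} [TopologicalSpace X] {ℓ δ H C : ℝ} {γ : X → ℝ → ℂ}

section Test

variable {φ : ℂ → ℝ} (hφ : ContDiff ℝ 1 φ) (hφc : HasCompactSupport φ)
include hφ hφc

lemma integrable_fderiv_mul_windingNumber (h : IsCurveFamily ℓ δ H C γ) (p : X) :
    Integrable (fun x => (fderiv ℝ φ x 1 : ℂ) * windingNumber ℓ (γ p) x) volume := by
  simp_rw [windingNumber_eq, mul_left_comm _ (-(2 * Real.pi * Complex.I)⁻¹ : ℂ)]
  exact (integrable_mul_cauchyIntegral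
    (Complex.continuous_ofReal.comp (continuous_fderiv_apply_const hφ 1))
    ((hasCompactSupport_fderiv_apply_const hφc 1).comp_left Complex.ofReal_zero)
    (h.continuous_deriv_apply p) (h.continuous p) _ _).const_mul _

/-- Fubini moves the test function onto the curve, where the Green formula applies. The result is
the boundary integral that also appears in `integral_cgrad_mul_imIntegral`; this coincidence is the
Darcy law. -/
lemma integral_fderiv_mul_windingNumber (h : IsCurveFamily ℓ δ H C γ) (p : X) :
    ∫ x, (fderiv ℝ φ x 1 : ℂ) * windingNumber ℓ (γ p) x =
      ((∫ β in (-ℓ / 2)..(ℓ / 2), (deriv (γ p) β).im * φ (γ p β) : ℝ) : ℂ) := by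
  simp_rw [windingNumber_eq, mul_left_comm _ (-(2 * Real.pi * Complex.I)⁻¹ : ℂ)]
  rw [integral_const_mul, integral_mul_cauchyIntegral
    (ψ := fun x => (fderiv ℝ φ x 1 : ℂ))
    (Complex.continuous_ofReal.comp (continuous_fderiv_apply_const hφ 1))
    ((hasCompactSupport_fderiv_apply_const hφc 1).comp_left Complex.ofReal_zero)
    (h.continuous_deriv_apply p) (h.continuous p),
    integral_deriv_mul_cauchyTransform hφ hφc (h.differentiable p) (h.continuous_deriv_apply p)
      (h.periodic p)]
  have := Complex.two_pi_I_ne_zero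
  field_simp

lemma integrable_cgrad_mul_imIntegral (h : IsCurveFamily ℓ δ H C γ) (p : X) :
    Integrable (fun x => cgrad φ x * imIntegral ℓ (γ p) x) volume :=
  integrable_mul_cauchyIntegral (continuous_cgrad hφ) (hasCompactSupport_cgrad hφc)
    (a := fun β => ((deriv (γ p) β).im : ℂ))
    (Complex.continuous_ofReal.comp (Complex.continuous_im.comp (h.continuous_deriv_apply p)))
    (h.continuous p) _ _

/-- Fubini, followed by the Cauchy-Pompeiu formula at each point of the curve. -/
lemma integral_cgrad_mul_imIntegral (h : IsCurveFamily ℓ δ H C γ) (p : X) :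
    ∫ x, cgrad φ x * imIntegral ℓ (γ p) x = -(2 * Real.pi) *
      ((∫ β in (-ℓ / 2)..(ℓ / 2), (deriv (γ p) β).im * φ (γ p β) : ℝ) : ℂ) := by
  have h1 := integral_mul_cauchyIntegral (continuous_cgrad hφ) (hasCompactSupport_cgrad hφc)
    (a := fun β => ((deriv (γ p) β).im : ℂ))
    (Complex.continuous_ofReal.comp (Complex.continuous_im.comp (h.continuous_deriv_apply p)))
    (h.continuous p) (-ℓ / 2) (ℓ / 2)
  simp_rw [integral_cgrad_mul_inv_sub hφ hφc] at h1
  simp only [imIntegral]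
  rw [h1, ← intervalIntegral.integral_ofReal, ← intervalIntegral.integral_const_mul]
  congr 1
  ext β
  push_cast
  ring

end Test

section Equations

variable {φ : ℂ → ℝ} (hφ : ContDiff ℝ 1 φ) (hφc : HasCompactSupport φ)
include hφ hφc

lemma integrable_conj_pairVelocity_mul_cgrad (h : IsCurveFamily ℓ δ H C γ) (p m : X) :
    Integrable (fun x => (starRingEnd ℂ) (pairVelocity ℓ γ p m x) * cgrad φ x) volume := by
  have h1 := ((h.integrable_cgrad_mul_imIntegral hφ hφc p).add
    (h.integrable_cgrad_mul_imIntegral hφ hφc m)).const_mul (-(2 * Real.pi * Complex.I)⁻¹)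
  refine h1.congr (ae_of_all _ fun x => ?_)
  simp only [pairVelocity, Complex.conj_conj, Pi.add_apply]
  ring

lemma integral_conj_pairVelocity_mul_cgrad (h : IsCurveFamily ℓ δ H C γ) (p m : X) :
    ∫ x, (starRingEnd ℂ) (pairVelocity ℓ γ p m x) * cgrad φ x = -Complex.I *
      (((∫ β in (-ℓ / 2)..(ℓ / 2), (deriv (γ p) β).im * φ (γ p β)) +
        ∫ β in (-ℓ / 2)..(ℓ / 2), (deriv (γ m) β).im * φ (γ m β) : ℝ) : ℂ) := by
  have e : (fun x => (starRingEnd ℂ) (pairVelocity ℓ γ p m x) * cgrad φ x) = fun x =>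
      -(2 * Real.pi * Complex.I)⁻¹ * (cgrad φ x * imIntegral ℓ (γ p) x +
        cgrad φ x * imIntegral ℓ (γ m) x) := by
    ext x
    simp only [pairVelocity, Complex.conj_conj]
    ring
  rw [e, integral_const_mul, integral_add (h.integrable_cgrad_mul_imIntegral hφ hφc p)
    (h.integrable_cgrad_mul_imIntegral hφ hφc m), h.integral_cgrad_mul_imIntegral hφ hφc,
    h.integral_cgrad_mul_imIntegral hφ hφc]
  have h1 := Complex.I_ne_zero
  have h2 : (Real.pi : ℂ) ≠ 0 := by exact_mod_cast Real.pi_ne_zero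
  push_cast
  field_simp
  rw [Complex.I_sq]
  ring

/-- The complex integral is `-I` times a real number, and the divergence only sees its real part. -/
lemma integral_dot_cgrad_eq_zero (h : IsCurveFamily ℓ δ H C γ) (p m : X) :
    ∫ x, dot (pairVelocity ℓ γ p m x) (cgrad φ x) = 0 := by
  have e : ∀ x, dot (pairVelocity ℓ γ p m x) (cgrad φ x) =
      ((starRingEnd ℂ) (pairVelocity ℓ γ p m x) * cgrad φ x).re := fun x => by
    simp [dot]
  simp_rw [e]
  have := integral_re (h.integrable_conj_pairVelocity_mul_cgrad hφ hφc p m)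
  simp only [RCLike.re_to_complex] at this
  rw [this, h.integral_conj_pairVelocity_mul_cgrad hφ hφc, neg_mul, Complex.neg_re,
    Complex.I_mul_re, Complex.ofReal_im, neg_zero, neg_zero]

/-- The density enters only through `ρ ∂₁φ`. The boundary integrals from the velocity and from the
winding numbers cancel, and the constant `-1` contributes the integral of `∂₁φ`, which is zero. -/
lemma integral_dot_I_mul_cgrad_eq_zero (h : IsCurveFamily ℓ δ H C γ) (p m : X) {ρ : ℂ → ℝ}
    (hρ : ∀ᵐ x, (ρ x : ℂ) = -windingNumber ℓ (γ p) x - windingNumber ℓ (γ m) x - 1) :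
    ∫ x, dot (pairVelocity ℓ γ p m x + (ρ x : ℂ) * Complex.I) (Complex.I * cgrad φ x) = 0 := by
  have hV := h.integrable_conj_pairVelocity_mul_cgrad hφ hφc p m
  have hp := h.integrable_fderiv_mul_windingNumber hφ hφc p
  have hm := h.integrable_fderiv_mul_windingNumber hφ hφc m
  have h1 : Integrable (fun x => (fderiv ℝ φ x 1 : ℂ)) volume :=
    ((continuous_fderiv_apply_const hφ 1).integrable_of_hasCompactSupport
      (hasCompactSupport_fderiv_apply_const hφc 1)).ofReal
  have e : (fun x => dot (pairVelocity ℓ γ p m x + (ρ x : ℂ) * Complex.I)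
      (Complex.I * cgrad φ x)) =ᵐ[volume] fun x =>
      (Complex.I * ((starRingEnd ℂ) (pairVelocity ℓ γ p m x) * cgrad φ x) -
        ((fderiv ℝ φ x 1 : ℂ) * windingNumber ℓ (γ p) x +
        (fderiv ℝ φ x 1 : ℂ) * windingNumber ℓ (γ m) x) - (fderiv ℝ φ x 1 : ℂ)).re := by
    filter_upwards [hρ] with x hx
    have e1 : Complex.I * ((starRingEnd ℂ) (pairVelocity ℓ γ p m x) * cgrad φ x) -
        ((fderiv ℝ φ x 1 : ℂ) * windingNumber ℓ (γ p) x +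
        (fderiv ℝ φ x 1 : ℂ) * windingNumber ℓ (γ m) x) - (fderiv ℝ φ x 1 : ℂ) =
        Complex.I * ((starRingEnd ℂ) (pairVelocity ℓ γ p m x) * cgrad φ x) +
        ((ρ x * fderiv ℝ φ x 1 : ℝ) : ℂ) := by
      push_cast
      rw [hx]
      ring
    rw [e1]
    simp [dot, cgrad]
    ring
  rw [integral_congr_ae e]
  have hall := ((hV.const_mul Complex.I).sub (hp.add hm)).sub h1
  have h2 := integral_re hall
  simp only [RCLike.re_to_complex, Pi.sub_apply, Pi.add_apply] at h2
  rw [h2]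
  have hpm : Integrable (fun x => (fderiv ℝ φ x 1 : ℂ) * windingNumber ℓ (γ p) x +
      (fderiv ℝ φ x 1 : ℂ) * windingNumber ℓ (γ m) x) volume := hp.add hm
  have h3 : ∫ x, (Complex.I * ((starRingEnd ℂ) (pairVelocity ℓ γ p m x) * cgrad φ x) -
        ((fderiv ℝ φ x 1 : ℂ) * windingNumber ℓ (γ p) x +
        (fderiv ℝ φ x 1 : ℂ) * windingNumber ℓ (γ m) x) - (fderiv ℝ φ x 1 : ℂ)) = 0 := by
    rw [integral_sub ((hV.const_mul Complex.I).sub' hpm) h1,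
      integral_sub (hV.const_mul Complex.I) hpm, integral_add hp hm, integral_const_mul,
      h.integral_conj_pairVelocity_mul_cgrad hφ hφc, h.integral_fderiv_mul_windingNumber hφ hφc,
      h.integral_fderiv_mul_windingNumber hφ hφc, integral_complex_ofReal,
      integral_fderiv_apply_eq_zero hφ hφc]
    push_cast
    linear_combination (-(((∫ β in (-ℓ / 2)..(ℓ / 2), (deriv (γ p) β).im * φ (γ p β) : ℝ) : ℂ) +
      ((∫ β in (-ℓ / 2)..(ℓ / 2), (deriv (γ m) β).im * φ (γ m β) : ℝ) : ℂ))) * Complex.I_sq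
  rw [h3, Complex.zero_re]

end Equations

end IsCurveFamily

/-! ### Uniqueness -/

/-- A bounded weak solution of the Cauchy-Riemann equations in the plane that vanishes at infinity
is zero. -/
lemma ae_eq_zero_of_integral_mul_cgrad_eq_zero {W : ℂ → ℂ} (hW : MemLp W ∞ volume)
    (hinf : Tendsto W (ae volume ⊓ cocompact ℂ) (𝓝 0))
    (hCR : ∀ ψ : ℂ → ℝ, ContDiff ℝ 1 ψ → HasCompactSupport ψ → ∫ x, W x * cgrad ψ x = 0) :
    W =ᵐ[volume] 0 := by
  have hloc : LocallyIntegrable W volume := hW.locallyIntegrable le_top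
  refine ae_eq_zero_of_integral_contDiff_smul_eq_zero hloc fun g hg hgc => ?_
  -- Reflected, so that the convolution `W * k` at `0` is the integral of `g` against `W`.
  set k : ℂ → ℝ := fun x => g (-x) with hk
  have hkd : ContDiff ℝ 1 k := (hg.of_le (mod_cast le_top)).comp contDiff_neg
  have hkc : HasCompactSupport k := hgc.comp_homeomorph (Homeomorph.neg ℂ)
  set L : ℂ →L[ℝ] ℝ →L[ℝ] ℂ := (ContinuousLinearMap.lsmul ℝ ℝ : ℝ →L[ℝ] ℂ →L[ℝ] ℂ).flip with hL
  set G : ℂ → ℂ := convolution W k L volume with hG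
  have hGd : ∀ y, HasFDerivAt G _ y := fun y => hkc.hasFDerivAt_convolution_right L hloc hkd y
  have hG' : ∀ y v, fderiv ℝ G y v = ∫ t, (fderiv ℝ k (y - t) v : ℂ) * W t := by
    intro y v
    rw [(hGd y).fderiv, convolution_precompR_apply L hloc (hkc.fderiv (𝕜 := ℝ))
      (hkd.continuous_fderiv one_ne_zero), convolution]
    simp [hL]
  have hint : ∀ y v, Integrable (fun t => (fderiv ℝ k (y - t) v : ℂ) * W t) volume := by
    intro y v
    have h1 : Continuous (fun t => fderiv ℝ k (y - t) v) :=
      (continuous_fderiv_apply_const hkd v).comp (continuous_const.sub continuous_id)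
    have h2 : HasCompactSupport (fun t => fderiv ℝ k (y - t) v) :=
      (hasCompactSupport_fderiv_apply_const hkc v).comp_homeomorph (Homeomorph.subLeft y)
    simpa using hloc.integrable_smul_left_of_hasCompactSupport h1 h2
  have hhol : Differentiable ℂ G := by
    intro y
    rw [differentiableAt_complex_iff_differentiableAt_real]
    refine ⟨(hGd y).differentiableAt, ?_⟩
    -- Testing with the translated kernel is the Cauchy-Riemann equation for `G` at `y`.
    set ψ : ℂ → ℝ := fun t => k (y - t) with hψ
    have hψd : ContDiff ℝ 1 ψ := hkd.comp (contDiff_const.sub contDiff_id)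
    have hψc : HasCompactSupport ψ := hkc.comp_homeomorph (Homeomorph.subLeft y)
    have hfd : ∀ t v, fderiv ℝ ψ t v = -fderiv ℝ k (y - t) v := by
      intro t v
      have h1 : HasFDerivAt ψ ((fderiv ℝ k (y - t)).comp (-ContinuousLinearMap.id ℝ ℂ)) t :=
        ((hkd.differentiable one_ne_zero) (y - t)).hasFDerivAt.comp t
          ((hasFDerivAt_id t).const_sub y)
      rw [h1.fderiv]; simp
    have h0 := hCR ψ hψd hψc
    have e : (fun t => W t * cgrad ψ t) = fun t => -((fderiv ℝ k (y - t) 1 : ℂ) * W t) -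
        Complex.I * ((fderiv ℝ k (y - t) Complex.I : ℂ) * W t) := by
      ext t
      rw [cgrad, hfd, hfd]; push_cast; ring
    have hn : Integrable (fun t => -((fderiv ℝ k (y - t) 1 : ℂ) * W t)) volume := (hint y 1).neg
    rw [e, integral_sub hn ((hint y Complex.I).const_mul _), integral_neg,
      integral_const_mul, ← hG', ← hG'] at h0
    rw [smul_eq_mul]
    linear_combination Complex.I * h0 + fderiv ℝ G y Complex.I * Complex.I_sq
  have hlim : Tendsto G (cocompact ℂ) (𝓝 0) := by
    obtain ⟨r, hr⟩ := hkc.isBounded.exists_norm_le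
    rw [Metric.tendsto_nhds]
    intro ε hε
    set J := ∫ t, ‖k t‖ with hJ
    have hJ0 : 0 ≤ J := integral_nonneg fun _ => norm_nonneg _
    have hη : 0 < ε / (J + 1) := by positivity
    have hev := (Metric.tendsto_nhds.1 hinf) _ hη
    rw [eventually_inf] at hev
    obtain ⟨s, hs, S, hS, hsS⟩ := hev
    rw [mem_cocompact] at hS
    obtain ⟨K, hK, hKS⟩ := hS
    obtain ⟨R, hR⟩ := hK.isBounded.exists_norm_le
    -- For `y` this far out, the support of `k (y - ·)` lies where `W` is almost everywhere small.
    filter_upwards [tendsto_norm_cocompact_atTop.eventually_gt_atTop (R + r)] with y hy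
    have hki : Integrable (fun t => ‖k (y - t)‖) volume :=
      (hkd.continuous.norm.integrable_of_hasCompactSupport hkc.norm).comp_sub_left y
    rw [dist_zero_right]
    have hb : ‖G y‖ ≤ ∫ t, ε / (J + 1) * ‖k (y - t)‖ := by
      rw [hG, convolution]
      refine norm_integral_le_of_norm_le (hki.const_mul _) ?_
      filter_upwards [hs] with t ht
      have e : L (W t) (k (y - t)) = k (y - t) • W t := by simp [hL]
      rw [e, norm_smul, mul_comm]
      by_cases h0 : k (y - t) = 0
      · simp [h0]
      have h1 := hr _ (subset_tsupport _ (Function.mem_support.2 h0))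
      have h2 : t ∈ S := by
        apply hKS
        intro htK
        have h3 := hR t htK
        have : ‖y‖ ≤ ‖y - t‖ + ‖t‖ := by
          calc ‖y‖ = ‖(y - t) + t‖ := by ring_nf
            _ ≤ _ := norm_add_le _ _
        linarith
      have h4 := hsS t ⟨ht, h2⟩
      rw [dist_zero_right] at h4
      gcongr
    rw [integral_const_mul, integral_sub_left_eq_self (fun t => ‖k t‖) volume y] at hb
    calc ‖G y‖ ≤ ε / (J + 1) * J := hb
      _ < ε / (J + 1) * (J + 1) := by gcongr; linarith
      _ = ε := by field_simp
  have h0 := hhol.apply_eq_of_tendsto_cocompact 0 hlim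
  rw [hG, convolution] at h0
  rw [← h0]
  congr 1
  ext t
  simp [hL, hk]

lemma dot_eq (z w : ℂ) : dot z w = w.re * z.re + w.im * z.im := by
  simp [dot]; ring

lemma integrable_dot {v X : ℂ → ℂ} (hv : MemLp v ∞ volume) (hX : Integrable X volume) :
    Integrable (fun x => dot (v x) (X x)) volume := by
  have h1 := (Integrable.smul_of_top_left hX.re hv).re
  have h2 := (Integrable.smul_of_top_left hX.im hv).im
  refine (h1.add h2).congr (ae_of_all _ fun x => ?_)
  simp [dot_eq]

lemma IsWeakStarContinuous.continuousOn_integral_dot {T : ℝ} {v : ℝ → ℂ → ℂ}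
    (hv : IsWeakStarContinuous T v) {X : ℂ → ℂ} (hX : Integrable X volume) :
    ContinuousOn (fun t => ∫ x, dot (v t x) (X x)) (Icc 0 T) := by
  have h1 := Complex.continuous_re.comp_continuousOn (hv.2 (fun x => (X x).re) hX.re)
  have h2 := Complex.continuous_im.comp_continuousOn (hv.2 (fun x => (X x).im) hX.im)
  refine (h1.add h2).congr fun t ht => ?_
  have i1 : Integrable (fun x => (X x).re • v t x) volume :=
    Integrable.smul_of_top_left hX.re (hv.1 t ht)
  have i2 : Integrable (fun x => (X x).im • v t x) volume :=
    Integrable.smul_of_top_left hX.im (hv.1 t ht)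
  have e1 := integral_re i1
  have e2 := integral_im i2
  simp only [RCLike.re_to_complex, RCLike.im_to_complex] at e1 e2
  change _ = (∫ x, (X x).re • v t x).re + (∫ x, (X x).im • v t x).im
  rw [← e1, ← e2]
  refine Eq.trans ?_ (integral_add i1.re i2.im)
  congr 1
  ext x
  simp [dot_eq]

/-- Differentiate in the upper limit at interior times; continuity settles the end points. -/
lemma eqOn_zero_of_integral_eq_zero {T : ℝ} (hT : 0 < T) {k : ℝ → ℝ}
    (hk : ContinuousOn k (Icc 0 T)) (h0 : ∀ t ∈ Ioc 0 T, ∫ s in (0 : ℝ)..t, k s = 0) :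
    EqOn k 0 (Icc 0 T) := by
  have hIoo : EqOn k 0 (Ioo 0 T) := by
    intro t ht
    have hnhds : Icc 0 T ∈ 𝓝 t := Icc_mem_nhds ht.1 ht.2
    have hd : HasDerivAt (fun t => ∫ s in (0 : ℝ)..t, k s) (k t) t := by
      refine intervalIntegral.integral_hasDerivAt_right ?_ ?_ (hk.continuousAt hnhds)
      · refine (hk.mono ?_).intervalIntegrable
        rw [uIcc_of_le ht.1.le]
        exact Icc_subset_Icc_right ht.2.le
      · exact hk.stronglyMeasurableAtFilter_nhdsWithin measurableSet_Icc t |>.filter_mono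
          (by rw [nhdsWithin_eq_nhds.2 hnhds])
    have hz : HasDerivAt (fun t => ∫ s in (0 : ℝ)..t, k s) 0 t := by
      refine (hasDerivAt_const t (0 : ℝ)).congr_of_eventuallyEq ?_
      filter_upwards [Ioo_mem_nhds ht.1 ht.2] with s hs
      exact h0 s ⟨hs.1, hs.2.le⟩
    exact hd.unique hz
  refine hIoo.of_subset_closure hk continuousOn_const Ioo_subset_Icc_self ?_
  rw [closure_Ioo hT.ne]

/-- A test function in space, extended to a test function in time and space. -/
lemma exists_space_time_extension (T : ℝ) {φ : ℂ → ℝ} (hφ : ContDiff ℝ 1 φ)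
    (hφc : HasCompactSupport φ) :
    ∃ Φ : ℝ × ℂ → ℝ, ContDiff ℝ 1 Φ ∧ HasCompactSupport Φ ∧
      ∀ s ∈ Icc 0 T, ∀ x, gradX Φ s x = cgrad φ x := by
  obtain ⟨χ, hχ, hχc, hone⟩ : ∃ χ : ℝ → ℝ, ContDiff ℝ 1 χ ∧ HasCompactSupport χ ∧
      ∀ s ∈ Icc 0 T, χ s = 1 := by
    let χ : ContDiffBump (0 : ℝ) := ⟨|T| + 1, |T| + 2, by positivity, by linarith⟩
    refine ⟨χ, χ.contDiff, χ.hasCompactSupport, fun s hs => χ.one_of_mem_closedBall ?_⟩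
    rw [mem_closedBall_zero_iff, Real.norm_of_nonneg hs.1]
    change s ≤ |T| + 1
    linarith [hs.2, le_abs_self T]
  refine ⟨fun q => χ q.1 * φ q.2, (hχ.comp contDiff_fst).mul (hφ.comp contDiff_snd), ?_, ?_⟩
  · refine HasCompactSupport.of_support_subset_isCompact
      (hχc.isCompact.prod hφc.isCompact) ?_
    rintro ⟨s, x⟩ hq
    rw [Function.mem_support] at hq
    exact ⟨subset_tsupport _ (left_ne_zero_of_mul hq),
      subset_tsupport _ (right_ne_zero_of_mul hq)⟩
  · intro s hs x
    have h1 : HasFDerivAt (fun q : ℝ × ℂ => χ q.1)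
        ((fderiv ℝ χ s).comp (ContinuousLinearMap.fst ℝ ℝ ℂ)) (s, x) :=
      ((hχ.differentiable one_ne_zero) s).hasFDerivAt.comp (s, x) hasFDerivAt_fst
    have h2 : HasFDerivAt (fun q : ℝ × ℂ => φ q.2)
        ((fderiv ℝ φ x).comp (ContinuousLinearMap.snd ℝ ℝ ℂ)) (s, x) :=
      ((hφ.differentiable one_ne_zero) x).hasFDerivAt.comp (s, x) hasFDerivAt_snd
    have h3 := (h1.fun_mul h2).fderiv
    rw [gradX, cgrad, h3]
    simp [hone s hs]

/-- Two relaxed velocities for the same density agree, if one of them solves the equations at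
each time. -/
lemma IsRelaxedVelocity.ae_eq {T : ℝ} (hT : 0 < T) {ρ : ℝ → ℂ → ℝ} {u v : ℝ → ℂ → ℂ}
    (hu : IsRelaxedVelocity T ρ u) (hv : IsWeakStarContinuous T v) (hvinf : VanishesAtInfinity T v)
    (hρ : ∀ t ∈ Icc 0 T, ∀ φ : ℂ → ℝ, ContDiff ℝ 1 φ → HasCompactSupport φ →
      Integrable (fun x => ρ t x * fderiv ℝ φ x 1) volume)
    (hdiv : ∀ t ∈ Icc 0 T, ∀ φ : ℂ → ℝ, ContDiff ℝ 1 φ → HasCompactSupport φ →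
      ∫ x, dot (v t x) (cgrad φ x) = 0)
    (hdarcy : ∀ t ∈ Icc 0 T, ∀ φ : ℂ → ℝ, ContDiff ℝ 1 φ → HasCompactSupport φ →
      ∫ x, dot (v t x + (ρ t x : ℂ) * Complex.I) (Complex.I * cgrad φ x) = 0) :
    ∀ t ∈ Icc 0 T, u t =ᵐ[volume] v t := by
  intro t ht
  have hcg : ∀ φ : ℂ → ℝ, ContDiff ℝ 1 φ → HasCompactSupport φ → Integrable (cgrad φ) volume :=
    fun φ hφ hφc =>
      (continuous_cgrad hφ).integrable_of_hasCompactSupport (hasCompactSupport_cgrad hφc)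
  have hudiv : ∀ φ : ℂ → ℝ, ContDiff ℝ 1 φ → HasCompactSupport φ →
      ∫ x, dot (u t x) (cgrad φ x) = 0 := by
    intro φ hφ hφc
    obtain ⟨Φ, hΦ, hΦc, hgrad⟩ := exists_space_time_extension T hφ hφc
    refine eqOn_zero_of_integral_eq_zero hT
      (hu.weakStar.continuousOn_integral_dot (hcg φ hφ hφc)) (fun t ht => ?_) ht
    refine Eq.trans ?_ (hu.divFree Φ hΦ hΦc t ht)
    refine intervalIntegral.integral_congr fun s hs => ?_
    rw [uIcc_of_le ht.1.le] at hs
    simp only [hgrad s ⟨hs.1, hs.2.trans ht.2⟩]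
  -- Continuity in time of the integrals of `ρ` is not assumed. Subtracting the equation of `v` at
  -- each time removes `ρ` and leaves a difference that is continuous by weak-star continuity.
  have hucurl : ∀ φ : ℂ → ℝ, ContDiff ℝ 1 φ → HasCompactSupport φ →
      (∫ x, dot (u t x) (Complex.I * cgrad φ x)) -
        ∫ x, dot (v t x) (Complex.I * cgrad φ x) = 0 := by
    intro φ hφ hφc
    obtain ⟨Φ, hΦ, hΦc, hgrad⟩ := exists_space_time_extension T hφ hφc
    have hI := (hcg φ hφ hφc).const_mul Complex.I
    refine eqOn_zero_of_integral_eq_zero hT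
      ((hu.weakStar.continuousOn_integral_dot hI).sub (hv.continuousOn_integral_dot hI))
      (fun t ht => ?_) ht
    refine Eq.trans ?_ (hu.darcy Φ hΦ hΦc t ht)
    refine intervalIntegral.integral_congr fun s hs => ?_
    rw [uIcc_of_le ht.1.le] at hs
    have hs' : s ∈ Icc 0 T := ⟨hs.1, hs.2.trans ht.2⟩
    simp only [hgrad s hs']
    have e : ∀ (w : ℂ → ℂ) x, dot (w x + (ρ s x : ℂ) * Complex.I) (Complex.I * cgrad φ x) =
        dot (w x) (Complex.I * cgrad φ x) + ρ s x * fderiv ℝ φ x 1 := fun w x => by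
      simp [dot_eq, cgrad]; ring
    have h1 := hdarcy s hs' φ hφ hφc
    simp_rw [e] at h1 ⊢
    rw [integral_add (integrable_dot (hv.1 s hs') hI) (hρ s hs' φ hφ hφc)] at h1
    rw [integral_add (integrable_dot (hu.weakStar.1 s hs') hI) (hρ s hs' φ hφ hφc), Pi.sub_apply]
    linarith
  have hW : MemLp (fun x => (starRingEnd ℂ) (u t x - v t x)) ∞ volume :=
    ((hu.weakStar.1 t ht).sub (hv.1 t ht)).star
  have hWinf : Tendsto (fun x => (starRingEnd ℂ) (u t x - v t x)) (ae volume ⊓ cocompact ℂ)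
      (𝓝 0) := by
    have h1 := (hu.vanishes t ht).sub (hvinf t ht)
    rw [sub_zero] at h1
    have h2 := (Complex.continuous_conj.tendsto 0).comp h1
    rwa [map_zero] at h2
  -- The real and imaginary parts of the tested integral are the divergence of `u - v` and minus its
  -- curl, both weak.
  have hzero := ae_eq_zero_of_integral_mul_cgrad_eq_zero hW hWinf fun ψ hψ hψc => by
    have hX := hcg ψ hψ hψc
    have hI := hX.const_mul Complex.I
    have hi : Integrable (fun x => (starRingEnd ℂ) (u t x - v t x) * cgrad ψ x) volume := by
      have h1 := Integrable.smul_of_top_left hX hW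
      refine h1.congr (ae_of_all _ fun x => ?_)
      simp [mul_comm]
    have hre := integral_re hi
    have him := integral_im hi
    simp only [RCLike.re_to_complex, RCLike.im_to_complex] at hre him
    have ere : ∀ x, ((starRingEnd ℂ) (u t x - v t x) * cgrad ψ x).re =
        dot (u t x) (cgrad ψ x) - dot (v t x) (cgrad ψ x) := fun x => by
      simp [dot_eq]; ring
    have eim : ∀ x, ((starRingEnd ℂ) (u t x - v t x) * cgrad ψ x).im =
        -(dot (u t x) (Complex.I * cgrad ψ x) - dot (v t x) (Complex.I * cgrad ψ x)) :=
      fun x => by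
        simp [dot_eq]; ring
    apply Complex.ext
    · rw [← hre, Complex.zero_re]
      simp_rw [ere]
      rw [integral_sub (integrable_dot (hu.weakStar.1 t ht) hX) (integrable_dot (hv.1 t ht) hX),
        hudiv ψ hψ hψc, hdiv t ht ψ hψ hψc, sub_zero]
    · rw [← him, Complex.zero_im]
      simp_rw [eim]
      rw [integral_neg, integral_sub (integrable_dot (hu.weakStar.1 t ht) hI)
        (integrable_dot (hv.1 t ht) hI), hucurl ψ hψ hψc, neg_zero]
  filter_upwards [hzero] with x hx
  have : u t x - v t x = 0 := (map_eq_zero (starRingEnd ℂ)).1 hx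
  exact sub_eq_zero.1 this


/-! ### Bounded Hölder continuous functions -/

/-- `f` is bounded and Hölder continuous with exponent `θ`. -/
def IsHolderBounded {E : Type*} [NormedAddCommGroup E] (θ : ℝ) (f : ℝ → E) : Prop :=
  ∃ K, 0 ≤ K ∧ (∀ α, ‖f α‖ ≤ K) ∧ ∀ α β, ‖f α - f β‖ ≤ K * |α - β| ^ θ

lemma IsHolderBounded.add {θ : ℝ} {f g : ℝ → ℂ} (hf : IsHolderBounded θ f)
    (hg : IsHolderBounded θ g) : IsHolderBounded θ (fun α => f α + g α) := by
  obtain ⟨K, hK, hf1, hf2⟩ := hf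
  obtain ⟨L, hL, hg1, hg2⟩ := hg
  refine ⟨K + L, by positivity, fun α => (norm_add_le _ _).trans (add_le_add (hf1 α) (hg1 α)),
    fun α β => ?_⟩
  calc ‖f α + g α - (f β + g β)‖ = ‖(f α - f β) + (g α - g β)‖ := by ring_nf
    _ ≤ _ := (norm_add_le _ _).trans (add_le_add (hf2 α β) (hg2 α β))
    _ = _ := by ring

lemma IsHolderBounded.mul {θ : ℝ} {f g : ℝ → ℂ} (hf : IsHolderBounded θ f)
    (hg : IsHolderBounded θ g) : IsHolderBounded θ (fun α => f α * g α) := by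
  obtain ⟨K, hK, hf1, hf2⟩ := hf
  obtain ⟨L, hL, hg1, hg2⟩ := hg
  refine ⟨2 * K * L, by positivity, fun α => ?_, fun α β => ?_⟩
  · rw [norm_mul]
    calc ‖f α‖ * ‖g α‖ ≤ K * L := by gcongr; exacts [hf1 α, hg1 α]
      _ ≤ _ := by nlinarith [mul_nonneg hK hL]
  · have hpos : 0 ≤ |α - β| ^ θ := by positivity
    calc ‖f α * g α - f β * g β‖ = ‖f α * (g α - g β) + (f α - f β) * g β‖ := by ring_nf
      _ ≤ ‖f α‖ * ‖g α - g β‖ + ‖f α - f β‖ * ‖g β‖ := by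
        rw [← norm_mul, ← norm_mul]; exact norm_add_le _ _
      _ ≤ K * (L * |α - β| ^ θ) + K * |α - β| ^ θ * L := by
        gcongr
        exacts [hf1 α, hg2 α β, hf2 α β, hg1 β]
      _ = _ := by ring

lemma rpow_le_rpow_of_le_one {x θ δ : ℝ} (hx : 0 ≤ x) (hθ : 0 < θ) (hθδ : θ ≤ δ) (hx1 : x ≤ 1) :
    x ^ δ ≤ x ^ θ := by
  rcases hx.eq_or_lt with rfl | hx0
  · rw [Real.zero_rpow hθ.ne', Real.zero_rpow (hθ.trans_le hθδ).ne']
  · exact Real.rpow_le_rpow_of_exponent_ge hx0 hx1 hθδ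

/-- A bounded function that is `δ`-Hölder is `θ`-Hölder for all smaller exponents. -/
lemma norm_sub_le_of_holder_of_bounded {E : Type*} [NormedAddCommGroup E] {f : ℝ → E}
    {θ δ K : ℝ} (hθ : 0 < θ) (hθδ : θ ≤ δ) (hb : ∀ α, ‖f α‖ ≤ K)
    (hf : ∀ α β, ‖f α - f β‖ ≤ K * |α - β| ^ δ) (α β : ℝ) :
    ‖f α - f β‖ ≤ 2 * K * |α - β| ^ θ := by
  have hK : 0 ≤ K := (norm_nonneg _).trans (hb 0)
  rcases le_total |α - β| 1 with h1 | h1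
  · calc ‖f α - f β‖ ≤ K * |α - β| ^ δ := hf α β
      _ ≤ K * |α - β| ^ θ := by
        exact mul_le_mul_of_nonneg_left
          (rpow_le_rpow_of_le_one (abs_nonneg _) hθ hθδ h1) hK
      _ ≤ _ := by
        have : 0 ≤ K * |α - β| ^ θ := by positivity
        linarith
  · have h2 : 1 ≤ |α - β| ^ θ := Real.one_le_rpow h1 hθ.le
    calc ‖f α - f β‖ ≤ ‖f α‖ + ‖f β‖ := norm_sub_le _ _
      _ ≤ 2 * K * 1 := by linarith [hb α, hb β]
      _ ≤ _ := by gcongr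

lemma exists_bound_of_periodic {E : Type*} [NormedAddCommGroup E] {f : ℝ → E} {ℓ : ℝ}
    (hℓ : 0 < ℓ) (hf : Continuous f) (hper : Function.Periodic f ℓ) :
    ∃ K, 0 ≤ K ∧ ∀ α, ‖f α‖ ≤ K := by
  obtain ⟨K, hK⟩ := (isCompact_Icc (a := (0:ℝ)) (b := ℓ)).exists_bound_of_continuousOn
    hf.continuousOn
  refine ⟨K, (norm_nonneg _).trans (hK 0 ⟨le_rfl, hℓ.le⟩), fun α => ?_⟩
  obtain ⟨y, hy, e⟩ := hper.exists_mem_Ico₀ hℓ α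
  rw [e]
  exact hK y (Ico_subset_Icc_self hy)

lemma exists_holder_bound {E : Type*} [NormedAddCommGroup E] {f : ℝ → E} {δ : ℝ≥0}
    (hf : MemHolder δ f) : ∃ K : ℝ, 0 ≤ K ∧ ∀ α β, ‖f α - f β‖ ≤ K * |α - β| ^ (δ : ℝ) := by
  obtain ⟨K, hK⟩ := hf
  refine ⟨K, K.2, fun α β => ?_⟩
  have := hK.dist_le α β
  rwa [dist_eq_norm, Real.dist_eq] at this

lemma isHolderBounded_of_memHolder {E : Type*} [NormedAddCommGroup E] {f : ℝ → E} {ℓ θ : ℝ}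
    {δ : ℝ≥0} (hℓ : 0 < ℓ) (hθ : 0 < θ) (hθδ : θ ≤ δ) (hf : Continuous f)
    (hper : Function.Periodic f ℓ) (hh : MemHolder δ f) : IsHolderBounded θ f := by
  obtain ⟨K, hK, hb⟩ := exists_bound_of_periodic hℓ hf hper
  obtain ⟨L, hL, hLf⟩ := exists_holder_bound hh
  have hb' : ∀ α, ‖f α‖ ≤ max K L := fun α => (hb α).trans (le_max_left _ _)
  refine ⟨2 * max K L, by positivity, fun α => ?_,
    norm_sub_le_of_holder_of_bounded hθ hθδ hb' fun α β => (hLf α β).trans ?_⟩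
  · have : 0 ≤ max K L := hK.trans (le_max_left _ _)
    linarith [hb' α]
  · gcongr; exact le_max_right _ _

lemma isHolderBounded_of_contDiff_one {E : Type*} [NormedAddCommGroup E] [NormedSpace ℝ E]
    {f : ℝ → E} {ℓ θ : ℝ} (hℓ : 0 < ℓ) (hθ : 0 < θ) (hθ1 : θ ≤ 1) (hf : ContDiff ℝ 1 f)
    (hper : Function.Periodic f ℓ) : IsHolderBounded θ f := by
  obtain ⟨K, hK, hb⟩ := exists_bound_of_periodic hℓ hf.continuous hper
  obtain ⟨L, hL, hLf⟩ := exists_bound_of_periodic hℓ (hf.continuous_deriv le_rfl)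
    (periodic_deriv hper)
  have hb' : ∀ α, ‖f α‖ ≤ max K L := fun α => (hb α).trans (le_max_left _ _)
  refine ⟨2 * max K L, by positivity, fun α => ?_,
    norm_sub_le_of_holder_of_bounded hθ hθ1 hb' fun α β => ?_⟩
  · have : 0 ≤ max K L := hK.trans (le_max_left _ _)
    linarith [hb' α]
  · have := convex_univ.norm_image_sub_le_of_norm_deriv_le (f := f) (x := β) (y := α)
      (fun x _ => (hf.differentiable one_ne_zero) x) (fun x _ => hLf x) (mem_univ _) (mem_univ _)
    rw [Real.rpow_one]
    refine this.trans ?_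
    rw [Real.norm_eq_abs]
    gcongr
    exact le_max_right _ _

/-! ### Curves depending continuously differentiably on time -/

section Time

variable {T ℓ : ℝ} {δ : ℝ≥0} {z : ℝ → ℝ → ℂ}

lemma enorm_le_cHolderNorm {δ : ℝ≥0} (f : ℝ → ℂ) (α : ℝ) : ‖f α‖ₑ ≤ cHolderNorm 1 δ f := by
  refine le_trans ?_ le_self_add
  refine le_iSup₂_of_le 0 zero_le_one ?_
  rw [iteratedDeriv_zero]
  exact le_iSup (fun α => ‖f α‖ₑ) α

lemma enorm_deriv_le_cHolderNorm {δ : ℝ≥0} (f : ℝ → ℂ) (α : ℝ) :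
    ‖deriv f α‖ₑ ≤ cHolderNorm 1 δ f := by
  refine le_trans ?_ le_self_add
  refine le_iSup₂_of_le 1 le_rfl ?_
  rw [iteratedDeriv_one]
  exact le_iSup (fun α => ‖deriv f α‖ₑ) α

lemma norm_sub_le_of_cHolderNorm_le_one {δ : ℝ≥0} {f : ℝ → ℂ} (hf : cHolderNorm 1 δ f ≤ 1)
    (α β : ℝ) : ‖deriv f α - deriv f β‖ ≤ |α - β| ^ (δ : ℝ) := by
  have h1 : eHolderNorm δ (deriv f) ≤ 1 := by
    refine le_trans ?_ hf
    rw [cHolderNorm, iteratedDeriv_one]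
    exact le_add_self
  have h2 : MemHolder δ (deriv f) := eHolderNorm_lt_top.1 (h1.trans_lt ENNReal.one_lt_top)
  have h3 := h2.holderWith.dist_le α β
  have h4 : (nnHolderNorm δ (deriv f) : ℝ) ≤ 1 := by
    rw [← h2.coe_nnHolderNorm_eq_eHolderNorm] at h1
    exact_mod_cast h1
  rw [dist_eq_norm, Real.dist_eq] at h3
  refine h3.trans (mul_le_of_le_one_left (by positivity) h4)

lemma norm_le_one_of_enorm_le_one {x : ℂ} (hx : ‖x‖ₑ ≤ 1) : ‖x‖ ≤ 1 := by
  have : (‖x‖₊ : ℝ≥0∞) ≤ 1 := hx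
  have : ‖x‖₊ ≤ 1 := by exact_mod_cast this
  exact_mod_cast this

lemma norm_le_of_norm_inv_smul_sub_le {r A B : ℝ} (hr : r ≠ 0) {x y : ℂ}
    (h : ‖r⁻¹ • x - y‖ ≤ A) (hy : ‖y‖ ≤ B) : ‖x‖ ≤ (A + B) * |r| := by
  have h1 : ‖r⁻¹ • x‖ ≤ A + B := by
    calc ‖r⁻¹ • x‖ = ‖(r⁻¹ • x - y) + y‖ := by rw [sub_add_cancel]
      _ ≤ _ := (norm_add_le _ _).trans (add_le_add h hy)
  rw [norm_smul, norm_inv, Real.norm_eq_abs, inv_mul_le_iff₀ (abs_pos.2 hr)] at h1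
  linarith

/-- The local Lipschitz dependence on time. -/
lemma IsC1InTime.eventually_lipschitz (hℓ : 0 < ℓ) (hz : IsC1InTime T ℓ 1 δ z) {t : ℝ}
    (ht : t ∈ Icc 0 T) : ∃ K, 0 ≤ K ∧ ∀ᶠ s in 𝓝[Icc 0 T] t,
      (∀ α, ‖z s α - z t α‖ ≤ K * |s - t|) ∧
      (∀ α, ‖deriv (z s) α - deriv (z t) α‖ ≤ K * |s - t|) ∧
      ∀ α β, ‖(deriv (z s) α - deriv (z t) α) - (deriv (z s) β - deriv (z t) β)‖ ≤
        K * |s - t| * |α - β| ^ (δ : ℝ) := by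
  obtain ⟨hmem, w, hw, hlim, -⟩ := hz
  obtain ⟨hwp, hwd, hwh⟩ := hw t ht
  have hwd1 : ContDiff ℝ 1 (w t) := hwd
  rw [iteratedDeriv_one] at hwh
  obtain ⟨K₀, hK₀, h0⟩ := exists_bound_of_periodic hℓ hwd1.continuous hwp
  obtain ⟨K₁, hK₁, h1⟩ := exists_bound_of_periodic hℓ (hwd1.continuous_deriv le_rfl)
    (periodic_deriv hwp)
  obtain ⟨K₂, hK₂, h2⟩ := exists_holder_bound hwh
  refine ⟨1 + (K₀ + K₁ + K₂), by positivity, ?_⟩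
  -- Near `t` the difference quotient is within norm `1` of the time derivative `w t`; this is the
  -- summand `1` in the Lipschitz constant.
  have hev := (hlim t ht).eventually (ge_mem_nhds (show (0 : ℝ≥0∞) < 1 from one_pos))
  rw [eventually_nhdsWithin_iff] at hev ⊢
  filter_upwards [hev] with s hs hsI
  rcases eq_or_ne s t with rfl | hst
  · simp
  have hN := hs ⟨hsI, hst⟩
  have hr : s - t ≠ 0 := sub_ne_zero.2 hst
  have hzs : Differentiable ℝ (z s) :=
    (show ContDiff ℝ 1 (z s) from (hmem s hsI).2.1).differentiable one_ne_zero
  have hzt : Differentiable ℝ (z t) :=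
    (show ContDiff ℝ 1 (z t) from (hmem t ht).2.1).differentiable one_ne_zero
  have hderiv : ∀ α, deriv (fun α => (s - t)⁻¹ • (z s α - z t α) - w t α) α =
      (s - t)⁻¹ • (deriv (z s) α - deriv (z t) α) - deriv (w t) α := fun α =>
    ((((hzs α).hasDerivAt.fun_sub (hzt α).hasDerivAt).fun_const_smul (s - t)⁻¹).fun_sub
      ((hwd1.differentiable one_ne_zero) α).hasDerivAt).deriv
  refine ⟨fun α => ?_, fun α => ?_, fun α β => ?_⟩
  · have e := norm_le_one_of_enorm_le_one
      ((enorm_le_cHolderNorm (δ := δ) _ α).trans hN)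
    refine (norm_le_of_norm_inv_smul_sub_le hr e (h0 α)).trans ?_
    gcongr
    linarith
  · have e := norm_le_one_of_enorm_le_one
      ((enorm_deriv_le_cHolderNorm (δ := δ) _ α).trans hN)
    rw [hderiv] at e
    refine (norm_le_of_norm_inv_smul_sub_le hr e (h1 α)).trans ?_
    gcongr
    linarith
  · have e := norm_sub_le_of_cHolderNorm_le_one hN α β
    rw [hderiv, hderiv, sub_sub_sub_comm, ← smul_sub] at e
    refine (norm_le_of_norm_inv_smul_sub_le hr e (h2 α β)).trans ?_
    have : 0 ≤ |α - β| ^ (δ : ℝ) := by positivity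
    calc (|α - β| ^ (δ : ℝ) + K₂ * |α - β| ^ (δ : ℝ)) * |s - t|
        = (1 + K₂) * |s - t| * |α - β| ^ (δ : ℝ) := by ring
      _ ≤ _ := by
        gcongr
        linarith

/-- The Lipschitz bound at `t` is uniform in `α`, so continuity in each variable becomes joint
continuity. -/
lemma continuousOn_of_eventually_lipschitz {f : ℝ → ℝ → ℂ} (hf : ∀ t ∈ Icc 0 T, Continuous (f t))
    (hlip : ∀ t ∈ Icc 0 T, ∃ K, ∀ᶠ s in 𝓝[Icc 0 T] t, ∀ α, ‖f s α - f t α‖ ≤ K * |s - t|) :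
    ContinuousOn (fun q : ℝ × ℝ => f q.1 q.2) (Icc 0 T ×ˢ univ) := by
  rintro ⟨t, α₀⟩ ⟨ht, -⟩
  have ht' : t ∈ Icc 0 T := ht
  obtain ⟨K, hK⟩ := hlip t ht'
  rw [ContinuousWithinAt, tendsto_iff_norm_sub_tendsto_zero, nhdsWithin_prod_eq, nhdsWithin_univ]
  have h1 : Tendsto (fun q : ℝ × ℝ => K * |q.1 - t| + ‖f t q.2 - f t α₀‖)
      (𝓝[Icc 0 T] t ×ˢ 𝓝 α₀) (𝓝 (K * |t - t| + ‖f t α₀ - f t α₀‖)) := by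
    have hc : Continuous (fun q : ℝ × ℝ => K * |q.1 - t| + ‖f t q.2 - f t α₀‖) := by
      have := hf t ht'
      fun_prop
    refine (hc.tendsto (t, α₀)).mono_left ?_
    rw [nhds_prod_eq]
    exact prod_mono nhdsWithin_le_nhds le_rfl
  simp only [sub_self, abs_zero, mul_zero, norm_zero, add_zero] at h1
  refine squeeze_zero' (Eventually.of_forall fun _ => norm_nonneg _) ?_ h1
  filter_upwards [tendsto_fst.eventually hK] with q hq
  calc ‖f q.1 q.2 - f t α₀‖ = ‖(f q.1 q.2 - f t q.2) + (f t q.2 - f t α₀)‖ := by ring_nf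
    _ ≤ _ := (norm_add_le _ _).trans (by gcongr; exact hq q.2)

/-- The curves and their tangents are uniformly bounded in Hölder norm. -/
lemma IsC1InTime.exists_uniform_bound (hℓ : 0 < ℓ) (hz : IsC1InTime T ℓ 1 δ z) :
    ∃ M, ∀ t ∈ Icc 0 T, (∀ α, ‖deriv (z t) α‖ ≤ M) ∧
      ∀ α β, ‖deriv (z t) α - deriv (z t) β‖ ≤ M * |α - β| ^ (δ : ℝ) := by
  -- The bounds hold near each time by the local Lipschitz estimate; compactness of `[0,T]` makes
  -- them uniform.
  refine isCompact_Icc.induction_on (s := Icc 0 T)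
    (p := fun S => ∃ M, ∀ t ∈ S, (∀ α, ‖deriv (z t) α‖ ≤ M) ∧
      ∀ α β, ‖deriv (z t) α - deriv (z t) β‖ ≤ M * |α - β| ^ (δ : ℝ)) ⟨0, by simp⟩ ?_ ?_ ?_
  · rintro S S' hSS' ⟨M, hM⟩
    exact ⟨M, fun t ht => hM t (hSS' ht)⟩
  · rintro S S' ⟨M, hM⟩ ⟨M', hM'⟩
    refine ⟨max M M', fun t ht => ?_⟩
    rcases ht with ht | ht
    · exact ⟨fun α => ((hM t ht).1 α).trans (le_max_left _ _), fun α β =>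
        ((hM t ht).2 α β).trans (by gcongr; exact le_max_left _ _)⟩
    · exact ⟨fun α => ((hM' t ht).1 α).trans (le_max_right _ _), fun α β =>
        ((hM' t ht).2 α β).trans (by gcongr; exact le_max_right _ _)⟩
  · intro t ht
    obtain ⟨K, hK, hev⟩ := hz.eventually_lipschitz hℓ ht
    obtain ⟨hp, hd, hh⟩ := hz.1 t ht
    have hd1 : ContDiff ℝ 1 (z t) := hd
    rw [iteratedDeriv_one] at hh
    obtain ⟨K₁, hK₁, h1⟩ := exists_bound_of_periodic hℓ (hd1.continuous_deriv le_rfl)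
      (periodic_deriv hp)
    obtain ⟨K₂, hK₂, h2⟩ := exists_holder_bound hh
    refine ⟨_, hev.and self_mem_nhdsWithin, K₁ + K₂ + K * T, ?_⟩
    rintro s ⟨⟨-, h3, h4⟩, hs⟩
    have hst : K * |s - t| ≤ K * T := by
      gcongr
      rw [abs_le]
      constructor <;> linarith [hs.1, hs.2, ht.1, ht.2]
    refine ⟨fun α => ?_, fun α β => ?_⟩
    · calc ‖deriv (z s) α‖ = ‖(deriv (z s) α - deriv (z t) α) + deriv (z t) α‖ := by ring_nf
        _ ≤ K * T + K₁ := (norm_add_le _ _).trans (add_le_add ((h3 α).trans hst) (h1 α))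
        _ ≤ _ := by linarith
    · have hpos : 0 ≤ |α - β| ^ (δ : ℝ) := by positivity
      calc ‖deriv (z s) α - deriv (z s) β‖ = ‖((deriv (z s) α - deriv (z t) α) -
            (deriv (z s) β - deriv (z t) β)) + (deriv (z t) α - deriv (z t) β)‖ := by ring_nf
        _ ≤ K * T * |α - β| ^ (δ : ℝ) + K₂ * |α - β| ^ (δ : ℝ) :=
          (norm_add_le _ _).trans (add_le_add ((h4 α β).trans (by gcongr)) (h2 α β))
        _ ≤ _ := by nlinarith

end Time

/-! ### The curves `z_λ` -/

/-- The curves `z_λ(t)`, with the parameters `(λ,t)` projected to `[-1,1] × [0,T]`. -/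
noncomputable def clampedCurve (T : ℝ) (c : ℝ → ℝ) (z : ℝ → ℝ → ℂ) (p : ℝ × ℝ) : ℝ → ℂ :=
  zCurve c z (max (-1) (min 1 p.1)) (max 0 (min T p.2))

lemma clampedCurve_eq {T : ℝ} {c : ℝ → ℝ} {z : ℝ → ℝ → ℂ} {lam t : ℝ}
    (hlam : lam ∈ Icc (-1 : ℝ) 1) (ht : t ∈ Icc 0 T) :
    clampedCurve T c z (lam, t) = zCurve c z lam t := by
  rw [clampedCurve, min_eq_right hlam.2, max_eq_right hlam.1, min_eq_right ht.2,
    max_eq_right ht.1]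

/-- The curve is `z - λ t E` with `E = c · iτ`. Differentiating `E` involves the second derivative
of the initial curve, which is where its higher regularity is used. Projecting the parameters makes
the parameter space the whole plane, which is connected. -/
lemma isCurveFamily_clampedCurve {ℓ T : ℝ} {δ : ℝ≥0} {c : ℝ → ℝ} {z : ℝ → ℝ → ℂ}
    (hℓ : 0 < ℓ) (hT : 0 < T) (hδ : 0 < δ) (hc : MemCHolder ℓ 1 δ c)
    (hz : IsC1InTime T ℓ 1 δ z) (hz0 : MemCHolder ℓ 2 δ (z 0)) (hchord : EquiChordArc T ℓ c z) :
    ∃ θ H C, IsCurveFamily ℓ θ H C (clampedCurve T c z) := by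
  have hδ' : (0 : ℝ) < δ := hδ
  -- An exponent at most `1` is also admissible for the `C^1` factors `c` and `τ`.
  set θ : ℝ := min δ 1 with hθ
  have hθ0 : 0 < θ := by positivity
  have hθδ : θ ≤ δ := min_le_left _ _
  have hθ1 : θ ≤ 1 := min_le_right _ _
  obtain ⟨hcp, hcd, hch⟩ := hc
  obtain ⟨hzp, hzd, hzh⟩ := hz0
  have hcd1 : ContDiff ℝ 1 c := hcd
  have hτd : ContDiff ℝ 1 (tau z) :=
    ((contDiff_succ_iff_deriv (n := 1)).1 (by exact_mod_cast hzd)).2.2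
  have hτp : Function.Periodic (tau z) ℓ := periodic_deriv hzp
  rw [iteratedDeriv_one] at hch
  have hzh' : MemHolder δ (deriv (tau z)) := by
    rw [iteratedDeriv_succ, iteratedDeriv_one] at hzh
    exact hzh
  set E : ℝ → ℂ := fun α => (c α : ℂ) * (Complex.I * tau z α) with hE
  have hcC : ContDiff ℝ 1 (fun α => (c α : ℂ)) := Complex.ofRealCLM.contDiff.comp hcd1
  have hEd : ContDiff ℝ 1 E := hcC.mul (contDiff_const.mul hτd)
  have hcCp : Function.Periodic (fun α => (c α : ℂ)) ℓ := fun α => by simp [hcp α]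
  have hE' : ∀ α, deriv E α = ((deriv c α : ℝ) : ℂ) * (Complex.I * tau z α) +
      (c α : ℂ) * (Complex.I * deriv (tau z) α) := fun α =>
    (((hcd1.differentiable one_ne_zero) α).hasDerivAt.ofReal_comp.fun_mul
      (((hτd.differentiable one_ne_zero) α).hasDerivAt.const_mul Complex.I)).deriv
  have hEh : IsHolderBounded θ (deriv E) := by
    have h1 : IsHolderBounded θ (fun α => ((deriv c α : ℝ) : ℂ)) := by
      obtain ⟨K, hK, ha, hb⟩ := isHolderBounded_of_memHolder hℓ hθ0 hθδ
        (hcd1.continuous_deriv le_rfl) (periodic_deriv hcp) hch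
      refine ⟨K, hK, fun α => by simpa using ha α, fun α β => ?_⟩
      rw [← Complex.ofReal_sub, Complex.norm_real]
      exact hb α β
    have h2 : IsHolderBounded θ (fun α => (c α : ℂ)) :=
      isHolderBounded_of_contDiff_one hℓ hθ0 hθ1 hcC hcCp
    have hI : IsHolderBounded θ (fun _ => Complex.I) :=
      isHolderBounded_of_contDiff_one hℓ hθ0 hθ1 contDiff_const fun _ => rfl
    have h3 := isHolderBounded_of_contDiff_one hℓ hθ0 hθ1 hτd hτp
    have h4 := isHolderBounded_of_memHolder hℓ hθ0 hθδ (hτd.continuous_deriv le_rfl)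
      (periodic_deriv hτp) hzh'
    have := (h1.mul (hI.mul h3)).add (h2.mul (hI.mul h4))
    convert this using 1
    ext α
    exact hE' α
  obtain ⟨K, hK, hEb, hEH⟩ := hEh
  obtain ⟨M, hM⟩ := hz.exists_uniform_bound hℓ
  have hM0 : 0 ≤ M := (norm_nonneg _).trans ((hM 0 ⟨le_rfl, hT.le⟩).1 0)
  obtain ⟨C, hC⟩ := hchord
  have hzform : ∀ lam t α, zCurve c z lam t α = z t α - ((lam * t : ℝ) : ℂ) * E α := by
    intro lam t α
    rw [zCurve, hE]; push_cast; ring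
  have hzt : ∀ t ∈ Icc 0 T, ContDiff ℝ 1 (z t) := fun t ht => (hz.1 t ht).2.1
  have hEdiff := hEd.differentiable one_ne_zero
  have hder : ∀ lam, ∀ t ∈ Icc 0 T, ∀ α, HasDerivAt (zCurve c z lam t)
      (deriv (z t) α - ((lam * t : ℝ) : ℂ) * deriv E α) α := by
    intro lam t ht α
    have h1 := (((hzt t ht).differentiable one_ne_zero) α).hasDerivAt.fun_sub
      ((hEdiff α).hasDerivAt.const_mul ((lam * t : ℝ) : ℂ))
    exact h1.congr_of_eventuallyEq (Eventually.of_forall (hzform lam t))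
  have hA : ∀ p : ℝ × ℝ, max (-1) (min 1 p.1) ∈ Icc (-1 : ℝ) 1 := fun p =>
    ⟨le_max_left _ _, max_le (by norm_num) (min_le_left _ _)⟩
  have hB : ∀ p : ℝ × ℝ, max 0 (min T p.2) ∈ Icc 0 T := fun p =>
    ⟨le_max_left _ _, max_le hT.le (min_le_left _ _)⟩
  have hABT : ∀ p : ℝ × ℝ, ‖((max (-1) (min 1 p.1) * max 0 (min T p.2) : ℝ) : ℂ)‖ ≤ T := by
    intro p
    rw [Complex.norm_real, norm_mul, Real.norm_eq_abs, Real.norm_eq_abs,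
      abs_of_nonneg (hB p).1]
    calc _ ≤ 1 * T := mul_le_mul (abs_le.2 (hA p)) (hB p).2 (hB p).1 zero_le_one
      _ = T := one_mul _
  have hderiv : ∀ p α, deriv (clampedCurve T c z p) α = deriv (z (max 0 (min T p.2))) α -
      ((max (-1) (min 1 p.1) * max 0 (min T p.2) : ℝ) : ℂ) * deriv E α := fun p α =>
    (hder _ _ (hB p) α).deriv
  have hcz : Continuous (fun q : (ℝ × ℝ) × ℝ => z (max 0 (min T q.1.2)) q.2) := by
    have h1 : ContinuousOn (fun q : ℝ × ℝ => z q.1 q.2) (Icc 0 T ×ˢ univ) :=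
      continuousOn_of_eventually_lipschitz (fun t ht => (hzt t ht).continuous) fun t ht => by
        obtain ⟨K, -, hK⟩ := hz.eventually_lipschitz hℓ ht
        exact ⟨K, hK.mono fun s hs => hs.1⟩
    exact h1.comp_continuous (f := fun q : (ℝ × ℝ) × ℝ => (max 0 (min T q.1.2), q.2))
      (by fun_prop) fun q => ⟨hB q.1, mem_univ _⟩
  have hcz' : Continuous (fun q : (ℝ × ℝ) × ℝ => deriv (z (max 0 (min T q.1.2))) q.2) := by
    have h1 : ContinuousOn (fun q : ℝ × ℝ => deriv (z q.1) q.2) (Icc 0 T ×ˢ univ) :=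
      continuousOn_of_eventually_lipschitz (f := fun t => deriv (z t))
        (fun t ht => (hzt t ht).continuous_deriv le_rfl) fun t ht => by
        obtain ⟨K, -, hK⟩ := hz.eventually_lipschitz hℓ ht
        exact ⟨K, hK.mono fun s hs => hs.2.1⟩
    exact h1.comp_continuous (f := fun q : (ℝ × ℝ) × ℝ => (max 0 (min T q.1.2), q.2))
      (by fun_prop) fun q => ⟨hB q.1, mem_univ _⟩
  have hcoef : Continuous (fun q : (ℝ × ℝ) × ℝ =>
      ((max (-1) (min 1 q.1.1) * max 0 (min T q.1.2) : ℝ) : ℂ)) := by fun_prop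
  refine ⟨θ, 2 * M + T * K + 1, max C 1, hℓ, hθ0, by positivity, by positivity, ?_, ?_, ?_, ?_,
    ?_, ?_, ?_⟩
  · intro p α
    rw [clampedCurve, hzform, hzform, (hz.1 _ (hB p)).1 α]
    simp only [hE, hcp α, hτp α]
  · exact fun p α => (hder _ _ (hB p) α).differentiableAt
  · simp only [clampedCurve, hzform]
    exact hcz.sub (hcoef.mul (hEd.continuous.comp continuous_snd))
  · simp only [hderiv]
    exact hcz'.sub (hcoef.mul ((hEd.continuous_deriv le_rfl).comp continuous_snd))
  · intro p α
    rw [hderiv]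
    refine (norm_sub_le _ _).trans ?_
    rw [norm_mul]
    calc _ ≤ M + T * K := add_le_add ((hM _ (hB p)).1 α)
          (mul_le_mul (hABT p) (hEb α) (norm_nonneg _) hT.le)
      _ ≤ _ := by linarith
  · intro p α β
    rw [hderiv, hderiv, sub_sub_sub_comm, ← mul_sub]
    refine (norm_sub_le _ _).trans ?_
    rw [norm_mul]
    have h1 := norm_sub_le_of_holder_of_bounded hθ0 hθδ (hM _ (hB p)).1 (hM _ (hB p)).2 α β
    have hpos : 0 ≤ |α - β| ^ θ := by positivity
    calc _ ≤ 2 * M * |α - β| ^ θ + T * (K * |α - β| ^ θ) := add_le_add h1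
          (mul_le_mul (hABT p) (hEH α β) (norm_nonneg _) hT.le)
      _ ≤ _ := by nlinarith
  · intro p α u hu
    -- Equal parameters `λ = μ` reduce the equi-chord-arc condition to the chord-arc condition of a
    -- single curve.
    have h1 := hC (α + u) u (by rw [abs_le] at hu; constructor <;> linarith) _ (hA p) _ (hA p)
      _ (hB p)
    rw [sub_self, zero_mul, zero_mul, zero_pow two_ne_zero, add_zero, Real.sqrt_sq_eq_abs,
      add_sub_cancel_right] at h1
    refine h1.trans ?_
    rw [clampedCurve]
    gcongr
    exact le_max_left _ _


lemma tendsto_pairVelocity {X : Type*} {ℓ : ℝ} {γ : X → ℝ → ℂ} {Y : Type*} {l : Filter Y} {f g : Y → X} {k : Y → ℂ} {a b : ℂ}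
    (ha : Tendsto (fun y => imIntegral ℓ (γ (f y)) (k y)) l (𝓝 a))
    (hb : Tendsto (fun y => imIntegral ℓ (γ (g y)) (k y)) l (𝓝 b)) :
    Tendsto (fun y => pairVelocity ℓ γ (f y) (g y) (k y)) l
      (𝓝 ((starRingEnd ℂ) (-(2 * Real.pi * Complex.I)⁻¹ * (a + b)))) :=
  (Complex.continuous_conj.tendsto _).comp ((ha.add hb).const_mul _)

namespace IsCurveFamily

variable {X : Type*} [TopologicalSpace X] {ℓ δ H C : ℝ} {γ : X → ℝ → ℂ}

/-! ### The velocity of two curves -/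

/-- The complement is the projection of a closed set along the compact interval `[0,ℓ]`, hence
closed. -/
lemma isOpen_setOf_notMem_range (h : IsCurveFamily ℓ δ H C γ) :
    IsOpen {q : X × ℂ | q.2 ∉ range (γ q.1)} := by
  rw [← isClosed_compl_iff]
  have e : {q : X × ℂ | q.2 ∉ range (γ q.1)}ᶜ =
      Prod.fst '' {y : (X × ℂ) × Icc 0 ℓ | y.1.2 = γ y.1.1 y.2} := by
    ext ⟨p, x⟩
    simp only [mem_compl_iff, mem_ofPred_eq, not_not, mem_image]
    constructor
    · rintro ⟨β, rfl⟩
      obtain ⟨y, hy, e⟩ := (h.periodic p).exists_mem_Ico₀ h.length_pos β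
      exact ⟨((p, γ p β), ⟨y, Ico_subset_Icc_self hy⟩), e, rfl⟩
    · rintro ⟨⟨⟨p', x'⟩, y⟩, hy, hq⟩
      obtain ⟨rfl, rfl⟩ := Prod.mk.inj hq
      exact ⟨y, hy.symm⟩
  rw [e]
  refine isClosedMap_fst_of_compactSpace _ (isClosed_eq (by fun_prop) ?_)
  exact h.continuous_uncurry.comp ((continuous_fst.comp continuous_fst).prodMk
    (continuous_subtype_val.comp continuous_snd))

lemma stronglyMeasurable_imIntegral (h : IsCurveFamily ℓ δ H C γ) (p : X) :
    StronglyMeasurable (imIntegral ℓ (γ p)) := by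
  have hm : Measurable (Function.uncurry fun (x : ℂ) (β : ℝ) =>
      ((deriv (γ p) β).im : ℂ) / (x - γ p β)) :=
    ((Complex.measurable_ofReal.comp (Complex.measurable_im.comp
      (h.continuous_deriv_apply p).measurable)).comp measurable_snd).div
      (measurable_fst.sub ((h.continuous p).measurable.comp measurable_snd))
  have hle : -ℓ / 2 ≤ ℓ / 2 := by linarith [h.length_pos]
  have e : imIntegral ℓ (γ p) = fun x => ∫ β in Ioc (-ℓ / 2) (ℓ / 2),
      ((deriv (γ p) β).im : ℂ) / (x - γ p β) := by
    ext x
    rw [imIntegral, intervalIntegral.integral_of_le hle]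
  rw [e]
  exact hm.stronglyMeasurable.integral_prod_right

lemma stronglyMeasurable_pairVelocity (h : IsCurveFamily ℓ δ H C γ) (p m : X) :
    StronglyMeasurable (pairVelocity ℓ γ p m) :=
  Complex.continuous_conj.comp_stronglyMeasurable
    (((h.stronglyMeasurable_imIntegral p).add (h.stronglyMeasurable_imIntegral m)).const_mul _)

lemma exists_norm_pairVelocity_le [PreconnectedSpace X] (h : IsCurveFamily ℓ δ H C γ)
    {p₀ : X} (hp₀ : IsClockwise ℓ (γ p₀)) :
    ∃ M, ∀ p m x, x ∉ range (γ p) → x ∉ range (γ m) → ‖pairVelocity ℓ γ p m x‖ ≤ M := by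
  obtain ⟨M, hM⟩ := h.exists_norm_imIntegral_le hp₀
  refine ⟨‖(-(2 * Real.pi * Complex.I)⁻¹ : ℂ)‖ * (M + M), fun p m x hp hm => ?_⟩
  rw [pairVelocity, RCLike.norm_conj, norm_mul]
  gcongr
  exact (norm_add_le _ _).trans (add_le_add (hM p x hp) (hM m x hm))

lemma tendsto_pairVelocity_cocompact (h : IsCurveFamily ℓ δ H C γ) (p m : X) :
    Tendsto (pairVelocity ℓ γ p m) (cocompact ℂ) (𝓝 0) := by
  have := tendsto_pairVelocity (f := fun _ : ℂ => p) (g := fun _ => m) (k := fun x => x)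
    (h.tendsto_imIntegral_cocompact p) (h.tendsto_imIntegral_cocompact m)
  simpa using this

lemma continuousAt_imIntegral (h : IsCurveFamily ℓ δ H C γ) {p : X} {x : ℂ}
    (hx : x ∉ range (γ p)) : Tendsto (fun q => imIntegral ℓ (γ q) x) (𝓝 p)
      (𝓝 (imIntegral ℓ (γ p) x)) := by
  have hmem : {q : X × ℂ | q.2 ∉ range (γ q.1)} ∈ 𝓝 (p, x) :=
    h.isOpen_setOf_notMem_range.mem_nhds hx
  have h1 : ContinuousAt (fun q : X × ℂ => imIntegral ℓ (γ q.1) q.2) (p, x) :=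
    h.continuousOn_imIntegral.continuousAt hmem
  have h2 : ContinuousAt (fun q : X => (q, x)) p := (Continuous.prodMk_left x).continuousAt
  have h3 := ContinuousAt.comp (x := p) (f := fun q : X => (q, x)) h1 h2
  exact h3

end IsCurveFamily

/-! ### The boundaries `z_±`: the density as a combination of winding numbers. -/

section Main

variable {ℓ T θ H C : ℝ} {c : ℝ → ℝ} {z : ℝ → ℝ → ℂ}

lemma isClockwise_clampedCurve (hT : 0 < T) (hor : IsClockwise ℓ (z 0)) :
    IsClockwise ℓ (clampedCurve T c z (1, 0)) := by
  have e : clampedCurve T c z (1, 0) = z 0 := by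
    rw [clampedCurve_eq (by simp) ⟨le_rfl, hT.le⟩]
    ext α
    simp [zCurve]
  rwa [e]

lemma one_mem_Icc_neg_one : (1 : ℝ) ∈ Icc (-1 : ℝ) 1 := by simp

lemma neg_one_mem_Icc_neg_one : (-1 : ℝ) ∈ Icc (-1 : ℝ) 1 := by simp

lemma vBar_eq {t : ℝ} (ht : t ∈ Icc 0 T) :
    vBar ℓ c z t = pairVelocity ℓ (clampedCurve T c z) (1, t) (-1, t) := by
  ext x
  rw [pairVelocity, clampedCurve_eq one_mem_Icc_neg_one ht,
    clampedCurve_eq neg_one_mem_Icc_neg_one ht]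
  rfl

lemma zCurve_add_smul (lam b t α : ℝ) :
    zCurve c z lam t α = zCurve c z b t α + (((b - lam) * (t * c α) : ℝ) : ℂ) *
      (Complex.I * tau z α) := by
  simp only [zCurve]; push_cast; ring

lemma mem_omegaPlus_iff (h : IsCurveFamily ℓ θ H C (clampedCurve T c z))
    (hcw : IsClockwise ℓ (clampedCurve T c z (1, 0))) {t : ℝ} (ht : t ∈ Icc 0 T) (x : ℂ) :
    x ∈ omegaPlus c z t ↔ x ∉ range (clampedCurve T c z (1, t)) ∧
      windingNumber ℓ (clampedCurve T c z (1, t)) x = -1 := by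
  rw [← h.mem_curveInterior_iff hcw, clampedCurve_eq one_mem_Icc_neg_one ht]
  rfl

lemma mem_omegaMinus_iff (h : IsCurveFamily ℓ θ H C (clampedCurve T c z))
    (hcw : IsClockwise ℓ (clampedCurve T c z (1, 0))) {t : ℝ} (ht : t ∈ Icc 0 T) (x : ℂ) :
    x ∈ omegaMinus c z t ↔ x ∉ range (clampedCurve T c z (-1, t)) ∧
      windingNumber ℓ (clampedCurve T c z (-1, t)) x = 0 := by
  rw [← h.mem_curveExterior_iff hcw, clampedCurve_eq neg_one_mem_Icc_neg_one ht]
  rfl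

/-- Off the curves the indicator of `Ω_+` is `-w_+` and that of `Ω_-` is `1 + w_-`. -/
lemma ae_rhoBar_eq (h : IsCurveFamily ℓ θ H C (clampedCurve T c z))
    (hcw : IsClockwise ℓ (clampedCurve T c z (1, 0))) {t : ℝ} (ht : t ∈ Icc 0 T) :
    ∀ᵐ x : ℂ, (rhoBar c z t x : ℂ) = -windingNumber ℓ (clampedCurve T c z (1, t)) x -
      windingNumber ℓ (clampedCurve T c z (-1, t)) x - 1 := by
  filter_upwards [h.ae_notMem_range (1, t), h.ae_notMem_range (-1, t)] with x hp hm
  have h1 := mem_omegaPlus_iff h hcw ht x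
  have h2 := mem_omegaMinus_iff h hcw ht x
  simp only [hp, hm, not_false_eq_true, true_and] at h1 h2
  rw [rhoBar]
  rcases h.windingNumber_eq_zero_or hcw hp with e1 | e1 <;>
  rcases h.windingNumber_eq_zero_or hcw hm with e2 | e2 <;>
  simp [indicator, h1, h2, e1, e2]

/-! ### The position of the mixing zone -/

/-- At a coincidence the equi-chord-arc condition would bound a positive number by `0`, because `λ ≠
b` and `t c(α) > 0`. -/
lemma zCurve_notMem_range (h : IsCurveFamily ℓ θ H C (clampedCurve T c z))
    (hchord : EquiChordArc T ℓ c z) {t : ℝ} (ht : t ∈ Icc 0 T) {α : ℝ} (hα : 0 < t * c α)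
    {lam b : ℝ} (hlam : lam ∈ Icc (-1 : ℝ) 1) (hb : b ∈ Icc (-1 : ℝ) 1) (hne : lam ≠ b) :
    zCurve c z lam t α ∉ range (clampedCurve T c z (b, t)) := by
  rintro ⟨β, hβ⟩
  obtain ⟨u, hu, e⟩ := h.exists_eq_add (b, t) α β
  rw [hβ, clampedCurve_eq hb ht] at e
  obtain ⟨C', hC'⟩ := hchord
  rw [abs_le] at hu
  have h1 := hC' α (-u) ⟨by linarith, by linarith⟩ lam hlam b hb t ht
  rw [sub_neg_eq_add, ← e, sub_self, norm_zero, mul_zero] at h1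
  have h2 : (0 : ℝ) < (-u) ^ 2 + ((lam - b) * t * c α) ^ 2 := by
    have : (lam - b) * t * c α ≠ 0 := by
      rw [mul_assoc]; exact mul_ne_zero (sub_ne_zero.2 hne) hα.ne'
    positivity
  exact absurd h1 (not_le.2 (Real.sqrt_pos.2 h2))

lemma exists_le_re_tau_mul_conj (h : IsCurveFamily ℓ θ H C (clampedCurve T c z))
    (hangle : EquiAngle T c z) :
    ∃ κ > 0, ∀ b ∈ Icc (-1 : ℝ) 1, ∀ t ∈ Icc 0 T, ∀ α,
      κ ≤ (tau z α * (starRingEnd ℂ) (deriv (clampedCurve T c z (b, t)) α)).re := by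
  obtain ⟨κ, hκ, hang⟩ := hangle
  have hC := h.chord_pos
  refine ⟨κ / C, by positivity, fun b hb t ht α => ?_⟩
  have h1 := (hang α b hb t ht).2
  have h2 := h.one_le_norm_deriv (b, t) α
  rw [clampedCurve_eq hb ht] at h2 ⊢
  set d := deriv (zCurve c z b t) α with hd
  have hn : 0 < ‖d‖ := norm_pos_iff.2 (hang α b hb t ht).1
  have e : dot (d / (‖d‖ : ℂ)) (tau z α) = (tau z α * (starRingEnd ℂ) d).re / ‖d‖ := by
    rw [dot_eq, Complex.div_ofReal_re, Complex.div_ofReal_im]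
    simp; ring
  rw [e, le_div_iff₀ hn] at h1
  refine le_trans ?_ h1
  rw [div_le_iff₀ hC]
  nlinarith

/-- The mixing zone lies on the left of `z_+` and on the right of `z_-`. -/
lemma windingNumber_mixing (h : IsCurveFamily ℓ θ H C (clampedCurve T c z))
    (hcw : IsClockwise ℓ (clampedCurve T c z (1, 0))) (hangle : EquiAngle T c z)
    (hchord : EquiChordArc T ℓ c z) (harc : ∀ α, ‖deriv (z 0) α‖ = 1) {t : ℝ}
    (ht : t ∈ Icc 0 T) {α : ℝ} (hα : 0 < t * c α) :
    (∀ lam ∈ Ico (-1 : ℝ) 1,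
      windingNumber ℓ (clampedCurve T c z (1, t)) (zCurve c z lam t α) = 0) ∧
    (∀ lam ∈ Ioc (-1 : ℝ) 1,
      windingNumber ℓ (clampedCurve T c z (-1, t)) (zCurve c z lam t α) = -1) := by
  obtain ⟨κ, hκ, hre⟩ := exists_le_re_tau_mul_conj h hangle
  obtain ⟨ε, hε, hside⟩ := h.exists_sides_of_isClockwise hcw κ hκ 1 one_pos
  have hcont : Continuous (fun lam => zCurve c z lam t α) := by
    simp only [zCurve]; fun_prop
  -- With this `r` the points `z_(1-r)` and `z_(-1+r)` lie in the collars of `z_+` and `z_-`,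
  -- reached in the direction `τ`, which is transversal by the equi-angle condition. From there the
  -- winding numbers are carried along `λ`.
  set r := min 1 (ε / (2 * (t * c α))) with hr
  have hr0 : 0 < r := by positivity
  have hr1 : r ≤ 1 := min_le_left _ _
  have hrε : r * (t * c α) ∈ Ioo 0 ε := by
    refine ⟨by positivity, ?_⟩
    calc r * (t * c α) ≤ ε / (2 * (t * c α)) * (t * c α) := by gcongr; exact min_le_right _ _
      _ = ε / 2 := by rw [div_mul_eq_mul_div, mul_div_mul_right _ _ hα.ne']
      _ < ε := by linarith
  constructor
  · intro lam hlam
    have h1 := (hside (1, t) α (tau z α) (harc α).le (hre 1 one_mem_Icc_neg_one t ht α)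
      (r * (t * c α)) hrε).1.2
    rw [clampedCurve_eq one_mem_Icc_neg_one ht] at h1
    have e := zCurve_add_smul (c := c) (z := z) (1 - r) 1 t α
    rw [sub_sub_cancel] at e
    rw [← e, ← clampedCurve_eq (T := T) one_mem_Icc_neg_one ht] at h1
    rw [← h1]
    exact h.windingNumber_eq_of_path (S := Ico (-1 : ℝ) 1) isPreconnected_Ico
      (f := fun _ => (1, t)) (g := fun lam => zCurve c z lam t α) continuousOn_const
      hcont.continuousOn (fun lam hl => zCurve_notMem_range h hchord ht hα
        (Ico_subset_Icc_self hl) one_mem_Icc_neg_one hl.2.ne) hlam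
      (⟨by linarith, by linarith⟩ : (1 - r) ∈ Ico (-1 : ℝ) 1)
  · intro lam hlam
    have h1 := (hside (-1, t) α (tau z α) (harc α).le (hre (-1) neg_one_mem_Icc_neg_one t ht α)
      (r * (t * c α)) hrε).2.2
    rw [clampedCurve_eq neg_one_mem_Icc_neg_one ht] at h1
    have e := zCurve_add_smul (c := c) (z := z) (-1 + r) (-1) t α
    have e' : zCurve c z (-1) t α - ((r * (t * c α) : ℝ) : ℂ) * (Complex.I * tau z α) =
        zCurve c z (-1 + r) t α := by
      rw [e]; push_cast; ring
    rw [e', ← clampedCurve_eq (T := T) neg_one_mem_Icc_neg_one ht] at h1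
    rw [← h1]
    exact h.windingNumber_eq_of_path (S := Ioc (-1 : ℝ) 1) isPreconnected_Ioc
      (f := fun _ => (-1, t)) (g := fun lam => zCurve c z lam t α) continuousOn_const
      hcont.continuousOn (fun lam hl => zCurve_notMem_range h hchord ht hα
        (Ioc_subset_Icc_self hl) neg_one_mem_Icc_neg_one hl.1.ne') hlam
      (⟨by linarith, by linarith⟩ : (-1 + r) ∈ Ioc (-1 : ℝ) 1)

lemma zCurve_eq_of_mul_eq_zero {t α : ℝ} (h0 : t * c α = 0) (lam b : ℝ) :
    zCurve c z lam t α = zCurve c z b t α := by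
  rw [zCurve_add_smul lam b, h0]; simp

/-- The point stays fixed while the curve moves from `λ = 1` to `λ = -1`. -/
lemma windingNumber_eq_of_avoids (h : IsCurveFamily ℓ θ H C (clampedCurve T c z)) {t : ℝ}
    (ht : t ∈ Icc 0 T) {x : ℂ} (hx : ∀ lam ∈ Icc (-1 : ℝ) 1, ∀ α, x ≠ zCurve c z lam t α) :
    x ∉ range (clampedCurve T c z (1, t)) ∧ x ∉ range (clampedCurve T c z (-1, t)) ∧
    windingNumber ℓ (clampedCurve T c z (1, t)) x =
      windingNumber ℓ (clampedCurve T c z (-1, t)) x := by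
  have hoff : ∀ lam ∈ Icc (-1 : ℝ) 1, x ∉ range (clampedCurve T c z (lam, t)) := by
    rintro lam hlam ⟨α, hα⟩
    rw [clampedCurve_eq hlam ht] at hα
    exact hx lam hlam α hα.symm
  exact ⟨hoff 1 one_mem_Icc_neg_one, hoff _ neg_one_mem_Icc_neg_one,
    h.windingNumber_eq_of_path (S := Icc (-1 : ℝ) 1) isPreconnected_Icc
      (f := fun lam => (lam, t)) (g := fun _ => x) (by fun_prop) continuousOn_const hoff
      one_mem_Icc_neg_one neg_one_mem_Icc_neg_one⟩

lemma windingNumber_of_mem_omegaPlus (h : IsCurveFamily ℓ θ H C (clampedCurve T c z))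
    (hcw : IsClockwise ℓ (clampedCurve T c z (1, 0))) (hangle : EquiAngle T c z)
    (hchord : EquiChordArc T ℓ c z) (harc : ∀ α, ‖deriv (z 0) α‖ = 1) (hc0 : ∀ α, 0 ≤ c α)
    {t : ℝ} (ht : t ∈ Icc 0 T) {x : ℂ} (hx : x ∈ omegaPlus c z t) :
    (x ∉ range (clampedCurve T c z (1, t)) ∧
      windingNumber ℓ (clampedCurve T c z (1, t)) x = -1) ∧
    (x ∉ range (clampedCurve T c z (-1, t)) ∧
      windingNumber ℓ (clampedCurve T c z (-1, t)) x = -1) := by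
  rw [mem_omegaPlus_iff h hcw ht] at hx
  -- A point of `Ω_+` lies on no `z_λ`: where `t c = 0` it would be on `z_+`, and where `t c > 0`
  -- and `λ < 1` its winding number around `z_+` would be `0` instead of `-1`.
  have hav : ∀ lam ∈ Icc (-1 : ℝ) 1, ∀ α, x ≠ zCurve c z lam t α := by
    rintro lam hlam α rfl
    have hnot : ∀ β, zCurve c z 1 t β ≠ zCurve c z lam t α := fun β hβ =>
      hx.1 ⟨β, by rw [clampedCurve_eq one_mem_Icc_neg_one ht]; exact hβ⟩
    rcases (mul_nonneg ht.1 (hc0 α)).eq_or_lt with h0 | h0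
    · exact hnot α (zCurve_eq_of_mul_eq_zero h0.symm 1 lam)
    · rcases hlam.2.eq_or_lt with rfl | hlt
      · exact hnot α rfl
      · have := (windingNumber_mixing h hcw hangle hchord harc ht h0).1 lam ⟨hlam.1, hlt⟩
        rw [hx.2] at this
        norm_num at this
  obtain ⟨-, h2, h3⟩ := windingNumber_eq_of_avoids h ht hav
  exact ⟨hx, h2, by rw [← h3, hx.2]⟩

lemma windingNumber_of_mem_omegaMinus (h : IsCurveFamily ℓ θ H C (clampedCurve T c z))
    (hcw : IsClockwise ℓ (clampedCurve T c z (1, 0))) (hangle : EquiAngle T c z)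
    (hchord : EquiChordArc T ℓ c z) (harc : ∀ α, ‖deriv (z 0) α‖ = 1) (hc0 : ∀ α, 0 ≤ c α)
    {t : ℝ} (ht : t ∈ Icc 0 T) {x : ℂ} (hx : x ∈ omegaMinus c z t) :
    (x ∉ range (clampedCurve T c z (1, t)) ∧
      windingNumber ℓ (clampedCurve T c z (1, t)) x = 0) ∧
    (x ∉ range (clampedCurve T c z (-1, t)) ∧
      windingNumber ℓ (clampedCurve T c z (-1, t)) x = 0) := by
  rw [mem_omegaMinus_iff h hcw ht] at hx
  have hav : ∀ lam ∈ Icc (-1 : ℝ) 1, ∀ α, x ≠ zCurve c z lam t α := by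
    rintro lam hlam α rfl
    have hnot : ∀ β, zCurve c z (-1) t β ≠ zCurve c z lam t α := fun β hβ =>
      hx.1 ⟨β, by rw [clampedCurve_eq neg_one_mem_Icc_neg_one ht]; exact hβ⟩
    rcases (mul_nonneg ht.1 (hc0 α)).eq_or_lt with h0 | h0
    · exact hnot α (zCurve_eq_of_mul_eq_zero h0.symm (-1) lam)
    · rcases hlam.1.eq_or_lt with rfl | hlt
      · exact hnot α rfl
      · have := (windingNumber_mixing h hcw hangle hchord harc ht h0).2 lam ⟨hlt, hlam.2⟩
        rw [hx.2] at this
        norm_num at this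
  obtain ⟨h1, -, h3⟩ := windingNumber_eq_of_avoids h ht hav
  exact ⟨⟨h1, by rw [h3, hx.2]⟩, hx⟩

/-! ### One-sided limits -/

/-- The winding numbers `n` and `m` are the same for all times, so the velocity has limits jointly
in time and space along the space-time domain. The function extended by these limits is continuous,
which gives continuity of the traces. -/
lemma hasContinuousLimits_vBar (h : IsCurveFamily ℓ θ H C (clampedCurve T c z))
    {Ω : ℝ → Set ℂ} {S : Set (ℝ × ℝ)} {a : ℝ} (ha : a ∈ Icc (-1 : ℝ) 1)
    (hS : ∀ p ∈ S, p.1 ∈ Icc 0 T)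
    (hcl : ∀ p ∈ S, zCurve c z a p.1 p.2 ∈ closure (Ω p.1)) {n m : ℂ}
    (hw : ∀ p ∈ S, ∀ x ∈ Ω p.1, (x ∉ range (clampedCurve T c z (1, p.1)) ∧
      windingNumber ℓ (clampedCurve T c z (1, p.1)) x = n) ∧
      (x ∉ range (clampedCurve T c z (-1, p.1)) ∧
      windingNumber ℓ (clampedCurve T c z (-1, p.1)) x = m)) :
    HasContinuousLimits (vBar ℓ c z) Ω (zCurve c z a) S := by
  set D : Set (ℝ × ℂ) := {q | (∃ α, (q.1, α) ∈ S) ∧ q.2 ∈ Ω q.1} with hD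
  have hlimb : ∀ (b : ℝ) (k : ℂ), (∀ q ∈ D, q.2 ∉ range (clampedCurve T c z (b, q.1)) ∧
      windingNumber ℓ (clampedCurve T c z (b, q.1)) q.2 = k) → ∀ q₀ : ℝ × ℂ,
      ∃ L, Tendsto (fun q : ℝ × ℂ => imIntegral ℓ (clampedCurve T c z (b, q.1)) q.2)
        (𝓝[D] q₀) (𝓝 L) := by
    -- The domain is embedded in the parameter space of the family at fixed `λ = b`; the limit there
    -- concerns one boundary curve, whether or not the base point lies on it.
    intro b k hk q₀
    set j : ℝ × ℂ → (ℝ × ℝ) × ℂ := fun q => ((b, q.1), q.2) with hj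
    have hjc : Continuous j := by fun_prop
    obtain ⟨L, hL⟩ := h.exists_tendsto_imIntegral (W := j '' D) (n := k)
      (by rintro _ ⟨q, hq, rfl⟩; exact hk q hq) (b, q₀.1) q₀.2
    have hj' : Tendsto j (𝓝[D] q₀) (𝓝[j '' D] ((b, q₀.1), q₀.2)) :=
      hjc.continuousWithinAt.tendsto_nhdsWithin_image
    have hcomp := hL.comp hj'
    exact ⟨L, hcomp⟩
  have hlim : ∀ q₀ : ℝ × ℂ, ∃ L,
      Tendsto (fun q : ℝ × ℂ => vBar ℓ c z q.1 q.2) (𝓝[D] q₀) (𝓝 L) := by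
    intro q₀
    obtain ⟨L, hL⟩ := hlimb 1 n (fun q hq => by
      obtain ⟨⟨α, hα⟩, hqΩ⟩ := hq
      exact (hw _ hα q.2 hqΩ).1) q₀
    obtain ⟨L', hL'⟩ := hlimb (-1) m (fun q hq => by
      obtain ⟨⟨α, hα⟩, hqΩ⟩ := hq
      exact (hw _ hα q.2 hqΩ).2) q₀
    refine ⟨_, Tendsto.congr' ?_ (tendsto_pairVelocity hL hL')⟩
    filter_upwards [self_mem_nhdsWithin] with q hq
    obtain ⟨⟨α, hα⟩, -⟩ := hq
    rw [vBar_eq (T := T) (hS _ hα)]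
  have hslice : ∀ p ∈ S, MapsTo (fun x => (p.1, x)) (Ω p.1) D := fun p hp x hx =>
    ⟨⟨p.2, hp⟩, hx⟩
  set g : ℝ × ℝ → ℝ × ℂ := fun p => (p.1, zCurve c z a p.1 p.2) with hg
  have hgc : ContinuousOn g S := by
    have h1 : Continuous (fun p : ℝ × ℝ => (p.1, clampedCurve T c z (a, p.1) p.2)) :=
      continuous_fst.prodMk (h.continuous_uncurry.comp
        ((continuous_const.prodMk continuous_fst).prodMk continuous_snd))
    refine h1.continuousOn.congr fun p hp => ?_
    simp only [hg, clampedCurve_eq ha (hS p hp)]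
  refine ⟨fun p => extendFrom D (fun q : ℝ × ℂ => vBar ℓ c z q.1 q.2) (g p), ?_, ?_⟩
  · refine (continuousOn_extendFrom (B := g '' S) ?_ fun q _ => hlim q).comp hgc (mapsTo_image g S)
    rintro _ ⟨p, hp, rfl⟩
    exact map_mem_closure (f := fun x : ℂ => (p.1, x)) (Continuous.prodMk_right p.1) (hcl p hp) (hslice p hp)
  · intro p hp
    refine ⟨hcl p hp, ?_⟩
    have h1 := tendsto_extendFrom (hlim (g p))
    have h2 : Tendsto (fun x : ℂ => (p.1, x)) (𝓝[Ω p.1] (zCurve c z a p.1 p.2)) (𝓝[D] (g p)) :=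
      (Continuous.prodMk_right p.1).continuousWithinAt.tendsto_nhdsWithin (hslice p hp)
    have h3 := h1.comp h2
    exact h3

lemma mem_closure_of_eventually_mem {Ω : Set ℂ} {f : ℝ → ℂ} {r x : ℝ} (hf : Continuous f)
    (hr : r < x) (hmem : ∀ s ∈ Ioo r x, f s ∈ Ω) : f x ∈ closure Ω := by
  have hcl : x ∈ closure (Ioo r x) := by
    rw [closure_Ioo hr.ne]; exact right_mem_Icc.2 hr.le
  exact map_mem_closure hf hcl hmem

lemma zCurve_mem_closure_omegaPlus (h : IsCurveFamily ℓ θ H C (clampedCurve T c z))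
    (hcw : IsClockwise ℓ (clampedCurve T c z (1, 0))) {t : ℝ} (ht : t ∈ Icc 0 T) (α : ℝ) :
    zCurve c z 1 t α ∈ closure (omegaPlus c z t) := by
  have hC := h.chord_pos
  obtain ⟨ε, hε, hside⟩ := h.exists_sides_of_isClockwise hcw (C ^ 2)⁻¹ (by positivity) H h.bound_pos
  set G := clampedCurve T c z (1, t) with hG
  have := mem_closure_of_eventually_mem (Ω := omegaPlus c z t) (r := -ε) (x := 0)
    (f := fun s : ℝ => G α + s * (Complex.I * deriv G α)) (by fun_prop) (by linarith)
    fun s hs => by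
      rw [mem_omegaPlus_iff h hcw ht]
      have := (hside (1, t) α _ (h.norm_deriv_le _ α) (h.sq_le_re_deriv_mul_conj _ α) (-s)
        ⟨by linarith [hs.2], by linarith [hs.1]⟩).2
      rwa [Complex.ofReal_neg, neg_mul, sub_neg_eq_add] at this
  simpa [hG, clampedCurve_eq one_mem_Icc_neg_one ht] using this

lemma zCurve_mem_closure_omegaMinus (h : IsCurveFamily ℓ θ H C (clampedCurve T c z))
    (hcw : IsClockwise ℓ (clampedCurve T c z (1, 0))) {t : ℝ} (ht : t ∈ Icc 0 T) (α : ℝ) :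
    zCurve c z (-1) t α ∈ closure (omegaMinus c z t) := by
  have hC := h.chord_pos
  obtain ⟨ε, hε, hside⟩ := h.exists_sides_of_isClockwise hcw (C ^ 2)⁻¹ (by positivity) H h.bound_pos
  set G := clampedCurve T c z (-1, t) with hG
  have := mem_closure_of_eventually_mem (Ω := omegaMinus c z t) (r := -ε) (x := 0)
    (f := fun s : ℝ => G α + ((-s : ℝ) : ℂ) * (Complex.I * deriv G α)) (by fun_prop) (by linarith)
    fun s hs => by
      rw [mem_omegaMinus_iff h hcw ht]
      exact (hside (-1, t) α _ (h.norm_deriv_le _ α) (h.sq_le_re_deriv_mul_conj _ α) (-s)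
        ⟨by linarith [hs.2], by linarith [hs.1]⟩).1
  simpa [hG, clampedCurve_eq neg_one_mem_Icc_neg_one ht] using this

lemma zCurve_mem_closure_omegaMix {t α : ℝ} (hα : 0 < c α) {a : ℝ} (ha : a = 1 ∨ a = -1) :
    zCurve c z a t α ∈ closure (omegaMix c z t) := by
  have hcont : Continuous (fun lam => zCurve c z lam t α) := by
    simp only [zCurve]; fun_prop
  have hcl : a ∈ closure (Ioo (-1 : ℝ) 1) := by
    rw [closure_Ioo (by norm_num)]
    rcases ha with rfl | rfl <;> simp
  exact map_mem_closure (f := fun lam => zCurve c z lam t α) hcont hcl fun lam hlam => ⟨α, hα, lam, hlam, rfl⟩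

/-! ### The velocity as a solution of the relaxed equations -/

lemma contDiff_slice {φ : ℝ × ℂ → ℝ} (hφ : ContDiff ℝ 1 φ) (s : ℝ) :
    ContDiff ℝ 1 (fun x => φ (s, x)) := hφ.comp (contDiff_const.prodMk contDiff_id)

lemma hasCompactSupport_slice {φ : ℝ × ℂ → ℝ} (hφ : HasCompactSupport φ) (s : ℝ) :
    HasCompactSupport (fun x => φ (s, x)) := by
  refine HasCompactSupport.of_support_subset_isCompact (hφ.isCompact.image continuous_snd) ?_
  exact fun x hx => ⟨(s, x), subset_tsupport _ hx, rfl⟩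

lemma gradX_eq_cgrad {φ : ℝ × ℂ → ℝ} (hφ : ContDiff ℝ 1 φ) (s : ℝ) (x : ℂ) :
    gradX φ s x = cgrad (fun x => φ (s, x)) x := by
  have h1 : HasFDerivAt (fun x => φ (s, x))
      ((fderiv ℝ φ (s, x)).comp (ContinuousLinearMap.inr ℝ ℝ ℂ)) x :=
    ((hφ.differentiable one_ne_zero) (s, x)).hasFDerivAt.comp x (hasFDerivAt_prodMk_right s x)
  rw [gradX, cgrad, h1.fderiv]
  simp

/-- Dominated convergence: the velocity is uniformly bounded, and at each point off the two curves
at time `t`, hence almost everywhere, it is continuous in time. -/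
lemma isWeakStarContinuous_vBar (h : IsCurveFamily ℓ θ H C (clampedCurve T c z))
    (hcw : IsClockwise ℓ (clampedCurve T c z (1, 0))) : IsWeakStarContinuous T (vBar ℓ c z) := by
  obtain ⟨M, hM⟩ := h.exists_norm_pairVelocity_le hcw
  have hb : ∀ t ∈ Icc 0 T, ∀ᵐ x, ‖vBar ℓ c z t x‖ ≤ M := fun t ht => by
    filter_upwards [h.ae_notMem_range (1, t), h.ae_notMem_range (-1, t)] with x hp hm
    rw [vBar_eq ht]
    exact hM _ _ x hp hm
  have hmeas : ∀ t ∈ Icc 0 T, StronglyMeasurable (vBar ℓ c z t) := fun t ht => by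
    rw [vBar_eq ht]
    exact h.stronglyMeasurable_pairVelocity _ _
  refine ⟨fun t ht => memLp_top_of_bound (hmeas t ht).aestronglyMeasurable M (hb t ht),
    fun g hg t ht => ?_⟩
  refine tendsto_integral_filter_of_dominated_convergence (fun x => ‖g x‖ * M) ?_ ?_
    (hg.norm.mul_const M) ?_
  · filter_upwards [self_mem_nhdsWithin] with s hs
    exact hg.aestronglyMeasurable.smul (hmeas s hs).aestronglyMeasurable
  · filter_upwards [self_mem_nhdsWithin] with s hs
    filter_upwards [hb s hs] with x hx
    rw [norm_smul]
    gcongr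
  · filter_upwards [h.ae_notMem_range (1, t), h.ae_notMem_range (-1, t)] with x hp hm
    refine Tendsto.const_smul ?_ (g x)
    have hb : ∀ b : ℝ, Tendsto (fun s : ℝ => (b, s)) (𝓝[Icc 0 T] t) (𝓝 (b, t)) := fun b =>
      ((Continuous.prodMk_right b).tendsto t).mono_left nhdsWithin_le_nhds
    have h1 := tendsto_pairVelocity (k := fun _ => x)
      ((h.continuousAt_imIntegral hp).comp (hb 1)) ((h.continuousAt_imIntegral hm).comp (hb (-1)))
    rw [vBar_eq ht]
    refine h1.congr' ?_
    filter_upwards [self_mem_nhdsWithin] with s hs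
    rw [vBar_eq hs]

lemma vanishesAtInfinity_vBar (h : IsCurveFamily ℓ θ H C (clampedCurve T c z)) :
    VanishesAtInfinity T (vBar ℓ c z) := by
  intro t ht
  rw [vBar_eq ht]
  exact (h.tendsto_pairVelocity_cocompact _ _).mono_left inf_le_right

lemma integral_dot_vBar_cgrad (h : IsCurveFamily ℓ θ H C (clampedCurve T c z)) {t : ℝ}
    (ht : t ∈ Icc 0 T) {φ : ℂ → ℝ} (hφ : ContDiff ℝ 1 φ) (hφc : HasCompactSupport φ) :
    ∫ x, dot (vBar ℓ c z t x) (cgrad φ x) = 0 := by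
  rw [vBar_eq ht]
  exact h.integral_dot_cgrad_eq_zero hφ hφc _ _

lemma integral_dot_vBar_add_I_mul_cgrad (h : IsCurveFamily ℓ θ H C (clampedCurve T c z))
    (hcw : IsClockwise ℓ (clampedCurve T c z (1, 0))) {t : ℝ}
    (ht : t ∈ Icc 0 T) {φ : ℂ → ℝ} (hφ : ContDiff ℝ 1 φ) (hφc : HasCompactSupport φ) :
    ∫ x, dot (vBar ℓ c z t x + (rhoBar c z t x : ℂ) * Complex.I) (Complex.I * cgrad φ x) = 0 := by
  rw [vBar_eq ht]
  exact h.integral_dot_I_mul_cgrad_eq_zero hφ hφc _ _ (ae_rhoBar_eq h hcw ht)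

lemma isRelaxedVelocity_vBar (h : IsCurveFamily ℓ θ H C (clampedCurve T c z))
    (hcw : IsClockwise ℓ (clampedCurve T c z (1, 0))) :
    IsRelaxedVelocity T (rhoBar c z) (vBar ℓ c z) where
  weakStar := isWeakStarContinuous_vBar h hcw
  vanishes := vanishesAtInfinity_vBar h
  divFree := by
    intro φ hφ hφc t ht
    refine Eq.trans (intervalIntegral.integral_congr (g := fun _ => (0 : ℝ)) fun s hs => ?_)
      (by simp)
    rw [uIcc_of_le ht.1.le] at hs
    simp only [gradX_eq_cgrad hφ]
    exact integral_dot_vBar_cgrad h ⟨hs.1, hs.2.trans ht.2⟩ (contDiff_slice hφ s)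
      (hasCompactSupport_slice hφc s)
  darcy := by
    intro φ hφ hφc t ht
    refine Eq.trans (intervalIntegral.integral_congr (g := fun _ => (0 : ℝ)) fun s hs => ?_)
      (by simp)
    rw [uIcc_of_le ht.1.le] at hs
    simp only [gradX_eq_cgrad hφ]
    exact integral_dot_vBar_add_I_mul_cgrad h hcw ⟨hs.1, hs.2.trans ht.2⟩ (contDiff_slice hφ s)
      (hasCompactSupport_slice hφc s)

/-- Measurability and integrability are inherited from the winding numbers, with which the density
agrees almost everywhere. -/
lemma integrable_rhoBar_mul_fderiv (h : IsCurveFamily ℓ θ H C (clampedCurve T c z))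
    (hcw : IsClockwise ℓ (clampedCurve T c z (1, 0))) {t : ℝ}
    (ht : t ∈ Icc 0 T) {φ : ℂ → ℝ} (hφ : ContDiff ℝ 1 φ) (hφc : HasCompactSupport φ) :
    Integrable (fun x => rhoBar c z t x * fderiv ℝ φ x 1) volume := by
  have hp := h.integrable_fderiv_mul_windingNumber hφ hφc (1, t)
  have hm := h.integrable_fderiv_mul_windingNumber hφ hφc (-1, t)
  have h1 : Integrable (fun x => (fderiv ℝ φ x 1 : ℂ)) volume :=
    ((continuous_fderiv_apply_const hφ 1).integrable_of_hasCompactSupport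
      (hasCompactSupport_fderiv_apply_const hφc 1)).ofReal
  refine ((hp.neg.sub hm).sub h1).re.congr ?_
  filter_upwards [ae_rhoBar_eq h hcw ht] with x hx
  have e : (rhoBar c z t x * fderiv ℝ φ x 1 : ℝ) =
      ((rhoBar c z t x : ℂ) * (fderiv ℝ φ x 1 : ℂ)).re := by
    rw [← Complex.ofReal_mul, Complex.ofReal_re]
  rw [e, hx]
  simp only [Pi.sub_apply, Pi.neg_apply, RCLike.re_to_complex]
  congr 1
  ring

end Main

end IPM

theorem mainTheorem7
    (ℓ T : ℝ) (δ : ℝ≥0) (c : ℝ → ℝ) (z : ℝ → ℝ → ℂ)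
    (hℓ : 0 < ℓ) (hT : 0 < T) (hδ : 0 < δ)
    (hc : IPM.MemCHolder ℓ 1 δ c) (hc0 : ∀ α, 0 ≤ c α)
    (hz : IPM.IsC1InTime T ℓ 1 δ z)
    (hz0 : IPM.MemCHolder ℓ 2 δ (z 0))
    (harc : ∀ α, ‖deriv (z 0) α‖ = 1)
    (hor : IPM.IsClockwise ℓ (z 0))
    (hangle : IPM.EquiAngle T c z)
    (hchord : IPM.EquiChordArc T ℓ c z) :
    -- the Biot-Savart velocity is a solution that vanishes at infinity, and the only one
    IPM.IsRelaxedVelocity T (IPM.rhoBar c z) (IPM.vBar ℓ c z) ∧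
    (∀ u : ℝ → ℂ → ℂ, IPM.IsRelaxedVelocity T (IPM.rhoBar c z) u →
      ∀ t ∈ Icc 0 T, u t =ᵐ[volume] IPM.vBar ℓ c z t) ∧
    -- it is uniformly bounded off the two boundary curves
    (∃ M : ℝ, ∀ t ∈ Icc 0 T, ∀ x : ℂ,
      x ∉ range (IPM.zCurve c z 1 t) → x ∉ range (IPM.zCurve c z (-1) t) →
        ‖IPM.vBar ℓ c z t x‖ ≤ M) ∧
    -- it has continuous limits from the non-mixing zones
    IPM.HasContinuousLimits (IPM.vBar ℓ c z) (IPM.omegaPlus c z) (IPM.zCurve c z 1)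
      (Icc 0 T ×ˢ univ) ∧
    IPM.HasContinuousLimits (IPM.vBar ℓ c z) (IPM.omegaMinus c z) (IPM.zCurve c z (-1))
      (Icc 0 T ×ˢ univ) ∧
    -- and from the mixing zone, where it is open
    (∀ a : ℝ, (a = 1 ∨ a = -1) →
      IPM.HasContinuousLimits (IPM.vBar ℓ c z) (IPM.omegaMix c z) (IPM.zCurve c z a)
        {p | p.1 ∈ Icc 0 T ∧ 0 < p.1 * c p.2}) := by
  obtain ⟨θ, H, C, h⟩ := IPM.isCurveFamily_clampedCurve hℓ hT hδ hc hz hz0 hchord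
  have hcw := IPM.isClockwise_clampedCurve (c := c) hT hor
  refine ⟨IPM.isRelaxedVelocity_vBar h hcw, fun u hu => ?_, ?_, ?_, ?_, fun a ha => ?_⟩
  · exact hu.ae_eq hT (IPM.isWeakStarContinuous_vBar h hcw) (IPM.vanishesAtInfinity_vBar h)
      (fun t ht φ hφ hφc => IPM.integrable_rhoBar_mul_fderiv h hcw ht hφ hφc)
      (fun t ht φ hφ hφc => IPM.integral_dot_vBar_cgrad h ht hφ hφc)
      (fun t ht φ hφ hφc => IPM.integral_dot_vBar_add_I_mul_cgrad h hcw ht hφ hφc)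
  · obtain ⟨M, hM⟩ := h.exists_norm_pairVelocity_le hcw
    refine ⟨M, fun t ht x hp hm => ?_⟩
    rw [IPM.vBar_eq ht]
    refine hM _ _ x ?_ ?_
    · rwa [IPM.clampedCurve_eq IPM.one_mem_Icc_neg_one ht]
    · rwa [IPM.clampedCurve_eq IPM.neg_one_mem_Icc_neg_one ht]
  · exact IPM.hasContinuousLimits_vBar h IPM.one_mem_Icc_neg_one (fun p hp => hp.1)
      (fun p hp => IPM.zCurve_mem_closure_omegaPlus h hcw hp.1 p.2)
      (fun p hp x hx =>
        IPM.windingNumber_of_mem_omegaPlus h hcw hangle hchord harc hc0 hp.1 hx)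
  · exact IPM.hasContinuousLimits_vBar h IPM.neg_one_mem_Icc_neg_one (fun p hp => hp.1)
      (fun p hp => IPM.zCurve_mem_closure_omegaMinus h hcw hp.1 p.2)
      (fun p hp x hx =>
        IPM.windingNumber_of_mem_omegaMinus h hcw hangle hchord harc hc0 hp.1 hx)
  · have hpos : ∀ p ∈ {p : ℝ × ℝ | p.1 ∈ Icc 0 T ∧ 0 < p.1 * c p.2}, 0 < p.1 ∧ 0 < c p.2 :=
      fun p hp => by
        have h1 : 0 < p.1 := lt_of_le_of_ne hp.1.1 fun h0 => by
          have := hp.2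
          rw [← h0, zero_mul] at this
          exact lt_irrefl _ this
        exact ⟨h1, pos_of_mul_pos_right hp.2 h1.le⟩
    -- The mixing zone lies outside `z_+` and inside `z_-`, hence the values `0` and `-1`.
    refine IPM.hasContinuousLimits_vBar h ?_ (fun p hp => hp.1)
      (fun p hp => IPM.zCurve_mem_closure_omegaMix (hpos p hp).2 ha) (n := 0) (m := -1) ?_
    · rcases ha with rfl | rfl
      exacts [IPM.one_mem_Icc_neg_one, IPM.neg_one_mem_Icc_neg_one]
    · rintro p hp x ⟨α, hα, lam, hlam, rfl⟩
      have htc : 0 < p.1 * c α := mul_pos (hpos p hp).1 hα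
      have hmix := IPM.windingNumber_mixing h hcw hangle hchord harc hp.1 htc
      exact ⟨⟨IPM.zCurve_notMem_range h hchord hp.1 htc (Ioo_subset_Icc_self hlam)
          IPM.one_mem_Icc_neg_one hlam.2.ne, hmix.1 lam ⟨hlam.1.le, hlam.2⟩⟩,
        ⟨IPM.zCurve_notMem_range h hchord hp.1 htc (Ioo_subset_Icc_self hlam)
          IPM.neg_one_mem_Icc_neg_one hlam.1.ne', hmix.2 lam ⟨hlam.1, hlam.2.le⟩⟩⟩
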